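/- **Setting.** Let $\mathcal V$ be a finite set of buses with a distinguished substation bus, and let $\mathcal E_p\subset\mathcal V\times\mathcal V$ be the set of lines of a radial network: the underlying undirected graph is a tree, and for $(i,j)\in\mathcal E_p$ the bus $i$ is the one closer to the substation. Let $M$ be the incidence matrix ($M_{ie}=1$, $M_{je}=-1$ for $e=(i,j)$, all other entries $0$). The security-constrained economic dispatch problem (SCED) is $$\min_{g,p}\ f(g)=\sum_{i}f_i(g_i)\quad\text{s.t.}\quad g-l=Mp,\quad g^{\min}\le g\le g^{\max},\quad -p^{\max}\le p\le p^{\max},$$ with $g^{\min}\le g^{\max}$ and $p^{\max}\ge 0$. Each $f_i:\mathbb R\to\mathbb R$ is twice differentiable and $f_i''\ge m>0$ on $[g_i^{\min},g_i^{\max}]$. Let $\rho>0$ and $$L(g,p,\lambda)=f(g)+\lambda^\top(g-l-Mp)+\tfrac{\rho}{2}\|g-l-Mp\|_2^2 .$$ Write $[\cdot]_a^b$ for the projection onto the box $[a,b]$. Assume that the centralized iteration $$g\leftarrow[g-s\,\partial_gL]_{g^{\min}}^{g^{\max}},\qquad p\leftarrow[p-s\,\partial_pL]_{-p^{\max}}^{p^{\max}},\qquad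 \lambda\leftarrow\lambda+s\,\partial_\lambda L$$ has a unique equilibrium $(g^*,p^*,\lambda^*)$ (a triple fixed for all stepsizes $s>0$; being fixed does not depend on the value of $s>0$). **Communication.** At each time $k=0,1,\dots$ a set $\vec{\mathcal E}_c[k]$ of directed links is active, where $(i,j)\in\vec{\mathcal E}_c[k]$ means that $j$ receives information from $i$; links exist only along lines, in both directions. For a positive integer $B$, for every $(i,j)\in\mathcal E_p$ and every $k\ge 0$, both $(i,j)$ and $(j,i)$ belong to $\bigcup_{t=kB}^{(k+1)B-1}\vec{\mathcal E}_c[t]$. **Algorithm.** Node $i$ maintains $g_i$, $\lambda_i$, the values $\hat p_{ij},\hat y_{ij}$ for its outgoing lines $(i,j)\in\mathcal E_p$, and $\breve p_{li},\breve y_{li}$ for its incoming lines $(l,i)\in\mathcal E_p$. Its local Lagrangian is $L^{(i)}=f_i(g_i)+\lambda_ib_i+\frac{\rho}{2}b_i^2$, where $b_i=g_i-l_i-\sum_{(i,j)\in\mathcal E_p}\hat p_{ij}+\sum_{(l,i)\in\mathcal E_p}\breve p_{li}$; $L^{(i)}[k]$ is its value at the iterates of time $k$. The initial values $g[0],\lambda[0],\hat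 p[0],\breve p[0]$ are arbitrary and $\hat y_{ij}[0]=2\,\partial L^{(i)}[0]/\partial\hat p_{ij}$, $\breve y_{ij}[0]=2\,\partial L^{(j)}[0]/\partial\breve p_{ij}$. For all $k\ge0$, $$g_i[k+1]=\Big[g_i[k]-s\tfrac{\partial L^{(i)}[k]}{\partial g_i}\Big]_{g_i^{\min}}^{g_i^{\max}},\qquad \lambda_i[k+1]=\lambda_i[k]+s\tfrac{\partial L^{(i)}[k]}{\partial\lambda_i},$$ and for each line $(i,j)\in\mathcal E_p$ $$\hat p_{ij}[k+1]=\big[(1-a_{ij}[k])\hat p_{ij}[k]+a_{ij}[k]\breve p_{ij}[k]-s\hat y_{ij}[k]\big]_{-p^{\max}_{ij}}^{p^{\max}_{ij}},$$ $$\hat y_{ij}[k+1]=(1-a_{ij}[k])\hat y_{ij}[k]+a_{ij}[k]\breve y_{ij}[k]+2\Big(\tfrac{\partial L^{(i)}[k+1]}{\partial\hat p_{ij}}-\tfrac{\partial L^{(i)}[k]}{\partial\hat p_{ij}}\Big),$$ $$\breve p_{ij}[k+1]=\big[(1-a_{ji}[k])\breve r_{ij}[k]+a_{ji}[k]\hat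 r_{ij}[k]+\breve p_{ij}[k]-\breve r_{ij}[k]-s\breve y_{ij}[k]\big]_{-p^{\max}_{ij}}^{p^{\max}_{ij}},$$ $$\breve y_{ij}[k+1]=(1-a_{ji}[k])\breve\rho_{ij}[k]+a_{ji}[k]\hat\rho_{ij}[k]+\breve y_{ij}[k]-\breve\rho_{ij}[k]+2\Big(\tfrac{\partial L^{(j)}[k+1]}{\partial\breve p_{ij}}-\tfrac{\partial L^{(j)}[k]}{\partial\breve p_{ij}}\Big).$$ The weights and stored values come from the alternating averaging protocol. Each line $(i,j)$ carries binary flags, initially $\phi_{ji}[0]=1$ and $\phi_{ij}[0]=\breve\phi_{ij}[0]=\hat\phi_{ij}[0]=0$. For each $k\ge1$, first node $i$ sets $\breve\phi_{ij}[k]=\phi_{ji}[k-1]$ if $(j,i)\in\vec{\mathcal E}_c[k]$ and $\breve\phi_{ij}[k]=\breve\phi_{ij}[k-1]$ otherwise, and takes for $\phi_{ij}[k]$ the negation of $\phi_{ij}[k-1]$ if $\breve\phi_{ij}[k]\ne\breve\phi_{ij}[k-1]$ and $\phi_{ij}[k-1]$ otherwise. Then node $j$ sets $\hat\phi_{ij}[k]=\phi_{ij}[k]$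 if $(i,j)\in\vec{\mathcal E}_c[k]$ and $\hat\phi_{ij}[k]=\hat\phi_{ij}[k-1]$ otherwise, and takes for $\phi_{ji}[k]$ the negation of $\phi_{ji}[k-1]$ if $\hat\phi_{ij}[k]\neq\hat\phi_{ij}[k-1]$ and $\phi_{ji}[k-1]$ otherwise. For $k\ge 1$, $a_{ij}[k]=\frac12$ ("node $i$ averages at time $k$") if $(j,i)\in\vec{\mathcal E}_c[k]$ and $\breve\phi_{ij}[k]\neq\breve\phi_{ij}[k-1]$, and $a_{ji}[k]=\frac12$ ("node $j$ averages at time $k$") if $(i,j)\in\vec{\mathcal E}_c[k]$ and $\hat\phi_{ij}[k]\ne\hat\phi_{ij}[k-1]$; otherwise, and at $k=0$, the weight is $0$. If node $j$ averages at time $k$, then $(\hat r_{ij},\breve r_{ij},\hat\rho_{ij},\breve\rho_{ij})[k]=(\hat p_{ij},\breve p_{ij},\hat y_{ij},\breve y_{ij})[t_k]$, where $t_k\le k$ is the latest time at which node $i$ averaged over this line; otherwise these four values are $0$. **Statement.** Let $\overline p=\frac12(\hat p+\breve p)$, $z[k]=(g[k]-g^*,\ \overline p[k]-p^*,\ \lambda[k]-\lambda^*)$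 and $\|z\|_2^{a,K}=\max_{0\le k\le K}a^{-k}\|z[k]\|_2$. There is $\bar s>0$, depending only on the problem data and $B$, such that for every stepsize $s\in(0,\bar s)$ there is $a\in(0,1)$ with the following property. For every sequence of communication graphs as above and every run of the algorithm with stepsize $s$ there is $\beta>0$ such that $$\|z\|_2^{a,K}\le\beta\qquad\text{for all }K\ge0 .$$ Moreover, for every node $i$ the vector $x^{(i)}[k]=(g_i[k],\{\hat p_{ij}[k]\}_{(i,j)\in\mathcal E_p},\{\breve p_{li}[k]\}_{(l,i)\in\mathcal E_p},\lambda_i[k])$ converges to $x^{(i)*}=(g_i^*,\{p^*_{ij}\}_{(i,j)\in\mathcal E_p},\{p^*_{li}\}_{(l,i)\in\mathcal E_p},\lambda_i^*)$ with $\|x^{(i)}[k]-x^{(i)*}\|_2=\mathcal O(a^k)$. -/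

import Mathlib

open Filter Asymptotics Topology
open scoped Matrix

noncomputable section

/-- The data of a security-constrained economic dispatch (SCED) problem on a network with bus set
`V`: minimise `∑ i, f i (g i)` subject to `g - l = M p`, `gmin ≤ g ≤ gmax`, `-pmax ≤ p ≤ pmax`.
`(i, j) ∈ lines` is a line with upstream end `i` and downstream end `j`; `root` is the substation;
`ρ` is the weight of the quadratic term of the augmented Lagrangian. -/
structure SCED (V : Type*) where
  root : V
  lines : Finset (V × V)
  f : V → ℝ → ℝ
  l : V → ℝ
  gmin : V → ℝ
  gmax : V → ℝ
  pmax : {e : V × V // e ∈ lines} → ℝ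
  ρ : ℝ

/-- The Euclidean projection of `x` onto the interval `[lo, hi]` (for `lo ≤ hi`). -/
def clip (lo hi x : ℝ) : ℝ := max lo (min hi x)

/-- `‖x‖₂^{a,K} = max_{0 ≤ k ≤ K} a^{-k} ‖x[k]‖₂`. -/
def weightedNorm {ι : Type*} [Fintype ι] (a : ℝ) (K : ℕ) (x : ℕ → EuclideanSpace ℝ ι) : ℝ :=
  (Finset.range (K + 1)).sup' Finset.nonempty_range_add_one (fun k => (a ^ k)⁻¹ * ‖x k‖)

namespace SCED

/-- The electrical lines, as a type. -/
abbrev Line {V : Type*} (D : SCED V) : Type _ := {e : V × V // e ∈ D.lines}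

/-- The upstream end of a line. -/
abbrev up {V : Type*} (D : SCED V) (e : D.Line) : V := e.1.1

/-- The downstream end of a line. -/
abbrev down {V : Type*} (D : SCED V) (e : D.Line) : V := e.1.2

/-- The undirected graph underlying the electrical network. -/
def graph {V : Type*} (D : SCED V) : SimpleGraph V :=
  SimpleGraph.fromRel (fun i j => (i, j) ∈ D.lines)

/-- The network is radial: the underlying graph is a tree, and in every line `(i, j)` the end `i`
is the one closer to the substation. -/
structure IsRadial {V : Type*} (D : SCED V) : Prop where
  isTree : D.graph.IsTree
  oriented : ∀ i j, (i, j) ∈ D.lines → D.graph.dist D.root j = D.graph.dist D.root i + 1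

/-- Each cost function is twice differentiable, with second derivative at least `m` on the
generation interval. -/
def CostAssumption {V : Type*} (D : SCED V) (m : ℝ) : Prop :=
  ∀ i, Differentiable ℝ (D.f i) ∧ Differentiable ℝ (deriv (D.f i)) ∧
    ∀ x ∈ Set.Icc (D.gmin i) (D.gmax i), m ≤ deriv (deriv (D.f i)) x

/-! ### The centralized primal-dual iteration and its equilibria -/

/-- The node-to-edge incidence matrix `M`. -/
def incidence {V : Type*} [DecidableEq V] (D : SCED V) : Matrix V D.Line ℝ :=
  Matrix.of fun i e => if D.up e = i then 1 else if D.down e = i then -1 else 0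

/-- The Lagrangian `L(g, p, λ) = f(g) + λᵀ(g - l - M p) + (ρ/2) ‖g - l - M p‖₂²`. -/
def lagrangian {V : Type*} [Fintype V] [DecidableEq V] (D : SCED V)
    (g : V → ℝ) (p : D.Line → ℝ) (lam : V → ℝ) : ℝ :=
  ∑ i, D.f i (g i) + lam ⬝ᵥ (g - D.l - D.incidence *ᵥ p)
    + D.ρ / 2 * ∑ i, (g - D.l - D.incidence *ᵥ p) i ^ 2

/-- A triple `(g, p, λ)`. -/
@[ext]
structure Triple {V : Type*} (D : SCED V) where
  g : V → ℝ
  p : D.Line → ℝ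
  lam : V → ℝ

/-- One step of the centralized projected primal-dual algorithm with stepsize `s`. -/
def centralStep {V : Type*} [Fintype V] [DecidableEq V] (D : SCED V) (s : ℝ)
    (u : D.Triple) : D.Triple where
  g := fun i => clip (D.gmin i) (D.gmax i)
    (u.g i - s * deriv (fun t => D.lagrangian (Function.update u.g i t) u.p u.lam) (u.g i))
  p := fun e => clip (-D.pmax e) (D.pmax e)
    (u.p e - s * deriv (fun t => D.lagrangian u.g (Function.update u.p e t) u.lam) (u.p e))
  lam := fun i =>
    u.lam i + s * deriv (fun t => D.lagrangian u.g u.p (Function.update u.lam i t)) (u.lam i)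

/-- `u` is an equilibrium of the centralized algorithm. (For `gmin ≤ gmax` and `0 ≤ pmax`, being
fixed for one stepsize `s > 0` is the same as being fixed for all of them.) -/
def IsEquilibrium {V : Type*} [Fintype V] [DecidableEq V] (D : SCED V) (u : D.Triple) : Prop :=
  ∀ s : ℝ, 0 < s → D.centralStep s u = u

/-! ### Local Lagrangians -/

/-- The iterates of all nodes at one time. For a line `e = (i, j)`, the upstream node `i` maintains
`phat e`, `yhat e`, the downstream node `j` maintains `pbrv e`, `ybrv e`. -/
structure Iterate {V : Type*} (D : SCED V) where
  g : V → ℝ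
  lam : V → ℝ
  phat : D.Line → ℝ
  pbrv : D.Line → ℝ
  yhat : D.Line → ℝ
  ybrv : D.Line → ℝ

/-- The local power imbalance `b_i = g_i - l_i - ∑_{(i,j)} p̂_{ij} + ∑_{(l,i)} p̆_{li}`. -/
def localImbalance {V : Type*} [DecidableEq V] (D : SCED V) (i : V) (x : D.Iterate) : ℝ :=
  x.g i - D.l i - (∑ e : D.Line, if D.up e = i then x.phat e else 0)
    + ∑ e : D.Line, if D.down e = i then x.pbrv e else 0

/-- The local Lagrangian `L⁽ⁱ⁾ = f_i(g_i) + λ_i b_i + (ρ/2) b_i²` of node `i`. -/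
def localLagrangian {V : Type*} [DecidableEq V] (D : SCED V) (i : V) (x : D.Iterate) : ℝ :=
  D.f i (x.g i) + x.lam i * D.localImbalance i x + D.ρ / 2 * D.localImbalance i x ^ 2

/-- `∂L⁽ⁱ⁾/∂g_i`. -/
def gradG {V : Type*} [DecidableEq V] (D : SCED V) (x : D.Iterate) (i : V) : ℝ :=
  deriv (fun t => D.localLagrangian i { x with g := Function.update x.g i t }) (x.g i)

/-- `∂L⁽ⁱ⁾/∂λ_i`. -/
def gradLam {V : Type*} [DecidableEq V] (D : SCED V) (x : D.Iterate) (i : V) : ℝ :=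
  deriv (fun t => D.localLagrangian i { x with lam := Function.update x.lam i t }) (x.lam i)

/-- `∂L⁽ⁱ⁾/∂p̂_{ij}` for the line `e = (i, j)`. -/
def gradPhat {V : Type*} [DecidableEq V] (D : SCED V) (x : D.Iterate) (e : D.Line) : ℝ :=
  deriv (fun t => D.localLagrangian (D.up e) { x with phat := Function.update x.phat e t })
    (x.phat e)

/-- `∂L⁽ʲ⁾/∂p̆_{ij}` for the line `e = (i, j)`. -/
def gradPbrv {V : Type*} [DecidableEq V] (D : SCED V) (x : D.Iterate) (e : D.Line) : ℝ :=
  deriv (fun t => D.localLagrangian (D.down e) { x with pbrv := Function.update x.pbrv e t })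
    (x.pbrv e)

/-! ### Communication and the alternating averaging protocol -/

/-- `Ec k` is the set of directed links active at time `k`: `(i, j) ∈ Ec k` if `j` receives
information from `i`. Links exist only along lines, in both directions, and for every line each of
the two directions is active at least once in every block `kB, …, (k+1)B - 1`. -/
structure CommAssumption {V : Type*} (D : SCED V) (B : ℕ) (Ec : ℕ → Finset (V × V)) : Prop where
  subset_links : ∀ k i j, (i, j) ∈ Ec k → (i, j) ∈ D.lines ∨ (j, i) ∈ D.lines
  forward : ∀ k i j, (i, j) ∈ D.lines → ∃ t, k * B ≤ t ∧ t < (k + 1) * B ∧ (i, j) ∈ Ec t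
  backward : ∀ k i j, (i, j) ∈ D.lines → ∃ t, k * B ≤ t ∧ t < (k + 1) * B ∧ (j, i) ∈ Ec t

/-- The flags kept for a line `(i, j)`: `φ_{ij}` and `φ̆_{ij}` (the last value of `φ_{ji}` received)
at node `i`, and `φ_{ji}` and `φ̂_{ij}` (the last value of `φ_{ij}` received) at node `j`. -/
structure Flags where
  phiIJ : Bool
  phiBrv : Bool
  phiJI : Bool
  phiHat : Bool

/-- One period of the protocol for a line `(i, j)`; `ji` and `ij` say whether the links `(j, i)` and
`(i, j)` are active. Node `i` acts first, on the flag that `j` holds at the start of the period; node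
`j` then acts on the flag that `i` holds after its own action. -/
def Flags.step (ji ij : Bool) (φ : Flags) : Flags :=
  let brv := if ji then φ.phiJI else φ.phiBrv
  let fij := if brv ≠ φ.phiBrv then !φ.phiIJ else φ.phiIJ
  let hat := if ij then fij else φ.phiHat
  let fji := if hat ≠ φ.phiHat then !φ.phiJI else φ.phiJI
  ⟨fij, brv, fji, hat⟩

/-- The flags of the line `e` at time `k`. -/
def flags {V : Type*} [DecidableEq V] (D : SCED V) (Ec : ℕ → Finset (V × V)) (e : D.Line) :
    ℕ → Flags
  | 0 => ⟨false, false, true, false⟩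
  | k + 1 => (flags D Ec e k).step (decide ((D.down e, D.up e) ∈ Ec (k + 1)))
      (decide ((D.up e, D.down e) ∈ Ec (k + 1)))

/-- Node `i` of the line `e = (i, j)` averages at time `k`. (Never at `k = 0`, as `0 - 1 = 0`.) -/
def upAverages {V : Type*} [DecidableEq V] (D : SCED V) (Ec : ℕ → Finset (V × V)) (e : D.Line)
    (k : ℕ) : Prop :=
  (D.down e, D.up e) ∈ Ec k ∧ (D.flags Ec e k).phiBrv ≠ (D.flags Ec e (k - 1)).phiBrv

/-- Node `j` of the line `e = (i, j)` averages at time `k`. -/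
def downAverages {V : Type*} [DecidableEq V] (D : SCED V) (Ec : ℕ → Finset (V × V)) (e : D.Line)
    (k : ℕ) : Prop :=
  (D.up e, D.down e) ∈ Ec k ∧ (D.flags Ec e k).phiHat ≠ (D.flags Ec e (k - 1)).phiHat

open Classical in
/-- The weight `a_{ij}[k]`. -/
def aUp {V : Type*} [DecidableEq V] (D : SCED V) (Ec : ℕ → Finset (V × V)) (e : D.Line)
    (k : ℕ) : ℝ :=
  if D.upAverages Ec e k then 1 / 2 else 0

open Classical in
/-- The weight `a_{ji}[k]`. -/
def aDown {V : Type*} [DecidableEq V] (D : SCED V) (Ec : ℕ → Finset (V × V)) (e : D.Line)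
    (k : ℕ) : ℝ :=
  if D.downAverages Ec e k then 1 / 2 else 0

open Classical in
/-- The latest time `t_k ≤ k` at which node `i` of the line `e = (i, j)` averaged. -/
def lastUp {V : Type*} [DecidableEq V] (D : SCED V) (Ec : ℕ → Finset (V × V)) (e : D.Line)
    (k : ℕ) : ℕ :=
  Nat.findGreatest (fun t => D.upAverages Ec e t) k

open Classical in
/-- The value at time `t_k` of a quantity `w` if node `j` averages at time `k`, and `0` otherwise.
It yields `r̂, r̆, ρ̂, ρ̆` for `w = p̂, p̆, ŷ, y̆`. -/
def stored {V : Type*} [DecidableEq V] (D : SCED V) (Ec : ℕ → Finset (V × V)) (e : D.Line)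
    (w : ℕ → ℝ) (k : ℕ) : ℝ :=
  if D.downAverages Ec e k then w (D.lastUp Ec e k) else 0

/-! ### The robust distributed primal-dual algorithm -/

/-- `X` is a sequence of iterates of the robust distributed algorithm with stepsize `s` over the
communication graphs `Ec`, started from arbitrary `g[0], λ[0], p̂[0], p̆[0]`. -/
structure IsRun {V : Type*} [DecidableEq V] (D : SCED V) (s : ℝ) (Ec : ℕ → Finset (V × V))
    (X : ℕ → D.Iterate) : Prop where
  yhat_zero : ∀ e, (X 0).yhat e = 2 * D.gradPhat (X 0) e
  ybrv_zero : ∀ e, (X 0).ybrv e = 2 * D.gradPbrv (X 0) e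
  g_succ : ∀ k i, (X (k + 1)).g i =
    clip (D.gmin i) (D.gmax i) ((X k).g i - s * D.gradG (X k) i)
  lam_succ : ∀ k i, (X (k + 1)).lam i = (X k).lam i + s * D.gradLam (X k) i
  phat_succ : ∀ k e, (X (k + 1)).phat e = clip (-D.pmax e) (D.pmax e)
    ((1 - D.aUp Ec e k) * (X k).phat e + D.aUp Ec e k * (X k).pbrv e - s * (X k).yhat e)
  yhat_succ : ∀ k e, (X (k + 1)).yhat e =
    (1 - D.aUp Ec e k) * (X k).yhat e + D.aUp Ec e k * (X k).ybrv e
      + 2 * (D.gradPhat (X (k + 1)) e - D.gradPhat (X k) e)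
  pbrv_succ : ∀ k e, (X (k + 1)).pbrv e = clip (-D.pmax e) (D.pmax e)
    ((1 - D.aDown Ec e k) * D.stored Ec e (fun t => (X t).pbrv e) k
      + D.aDown Ec e k * D.stored Ec e (fun t => (X t).phat e) k
      + (X k).pbrv e - D.stored Ec e (fun t => (X t).pbrv e) k - s * (X k).ybrv e)
  ybrv_succ : ∀ k e, (X (k + 1)).ybrv e =
    (1 - D.aDown Ec e k) * D.stored Ec e (fun t => (X t).ybrv e) k
      + D.aDown Ec e k * D.stored Ec e (fun t => (X t).yhat e) k
      + (X k).ybrv e - D.stored Ec e (fun t => (X t).ybrv e) k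
      + 2 * (D.gradPbrv (X (k + 1)) e - D.gradPbrv (X k) e)

/-- The convergence error `z = (g - g*, p̄ - p*, λ - λ*)`, where `p̄ = (p̂ + p̆)/2`. -/
def error {V : Type*} (D : SCED V) (u : D.Triple) (x : D.Iterate) :
    EuclideanSpace ℝ (V ⊕ D.Line ⊕ V) :=
  WithLp.toLp 2 (Sum.elim (fun i => x.g i - u.g i)
    (Sum.elim (fun e => (x.phat e + x.pbrv e) / 2 - u.p e) (fun i => x.lam i - u.lam i)))

/-- The vector `x⁽ⁱ⁾ = (g_i, {p̂_{ij}}_{(i,j)}, {p̆_{li}}_{(l,i)}, λ_i)` of the estimates held by node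
`i`, built from global vectors `g, p̂, p̆, λ`. -/
def localVec {V : Type*} (D : SCED V) (i : V) (g : V → ℝ) (phat pbrv : D.Line → ℝ)
    (lam : V → ℝ) :
    EuclideanSpace ℝ (Unit ⊕ {e : D.Line // D.up e = i} ⊕ {e : D.Line // D.down e = i} ⊕ Unit) :=
  WithLp.toLp 2 (Sum.elim (fun _ => g i) (Sum.elim (fun e => phat e.1)
    (Sum.elim (fun e => pbrv e.1) (fun _ => lam i))))

/-- The vector `x⁽ⁱ⁾` of node `i` at a given iterate. -/
def localState {V : Type*} (D : SCED V) (i : V) (x : D.Iterate) :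
    EuclideanSpace ℝ (Unit ⊕ {e : D.Line // D.up e = i} ⊕ {e : D.Line // D.down e = i} ⊕ Unit) :=
  D.localVec i x.g x.phat x.pbrv x.lam

/-- The vector `x⁽ⁱ⁾*` of the local components of `(g*, p*, λ*)`. -/
def localTarget {V : Type*} (D : SCED V) (i : V) (u : D.Triple) :
    EuclideanSpace ℝ (Unit ⊕ {e : D.Line // D.up e = i} ⊕ {e : D.Line // D.down e = i} ⊕ Unit) :=
  D.localVec i u.g u.p u.p u.lam

end SCED

end

/-! The distributed algorithm is the centralized projected primal-dual iteration with errors that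
are driven by the motion of the iterates themselves. A completed exchange over a line takes
boundedly many steps and cancels at least half of the disagreement between the two ends, so by
`SCED.averaging_bound` the disagreement is dominated by a scalar filter with a forgetting factor μ <
1 that depends only on B. For `yhat - ybrv` the forcing is the change of the augmented multipliers λ
+ ρb, and the filter is called H; for `phat - pbrv` the forcing is s times `yhat - ybrv`, and the
filter is s Q. Since `yhat + ybrv` is twice the flow gradient up to the share in transit
(`SCED.IsRun.tracking_sum`), every run consists of primal-dual steps with flow gradient error at
most H + Q (`SCED.IsRun.perturbedStep`). The communication graphs play no role after that.

Near the equilibrium the Lyapunov function is the squared distance, plus a small multiple κ of the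
augmented Lagrangian, plus H² + θQ², plus 2s times the derivative of the Lagrangian at the
equilibrium in the direction of the iterate (`SCED.slack`). The squared distance loses s‖g - g*‖² by
strong convexity and s‖b‖² by the augmentation, but nothing directly in flows and multipliers. Flows
are recovered from generations and imbalances because the incidence matrix of a tree is injective.
Multipliers are recovered from the residual of the projected step: the residual is piecewise linear
in the multiplier, and uniqueness of the equilibrium says that it vanishes only at λ*, so it bounds
the distance (`SCED.Optimal.dual_error_bound`). The residual is at most the step length divided by
s, and the step length is controlled by the descent of the augmented Lagrangian. `lyapunov_decrease`
puts these estimates together.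

The residual is bounded on the box, so this error bound holds only for bounded multipliers. Far away
another function decreases: primal variables chase the profile favoured by the current multipliers,
whose imbalance pairs negatively with λ - λ*, at a linear rate (`SCED.Optimal.far_step`). Hence λ
enters a ball whose radius depends neither on s nor on the run. The entry time depends on the run
and affects only the constant β; the rate a depends on s alone. -/

section Clip

/-! ### Projection onto an interval. -/

variable {lo hi : ℝ}

theorem clip_mem (h : lo ≤ hi) (x : ℝ) : clip lo hi x ∈ Set.Icc lo hi :=
  ⟨le_max_left _ _, max_le h (min_le_left _ _)⟩

theorem clip_of_mem {x : ℝ} (hx : x ∈ Set.Icc lo hi) : clip lo hi x = x := by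
  rw [clip, min_eq_right hx.2, max_eq_right hx.1]

theorem clip_mono : Monotone (clip lo hi) := fun x y h => by
  unfold clip
  gcongr

theorem clip_sub_le {x y : ℝ} (h : x ≤ y) : clip lo hi y - clip lo hi x ≤ y - x := by
  unfold clip
  grind

theorem continuous_clip : Continuous (clip lo hi) := by
  unfold clip
  fun_prop

/-- Monotone and nonexpansive together give a damping factor. Two values clipped to the same
interval thus keep a linear recursion for their difference. -/
theorem exists_clip_sub_eq (x y : ℝ) :
    ∃ θ : ℝ, 0 ≤ θ ∧ θ ≤ 1 ∧ clip lo hi x - clip lo hi y = θ * (x - y) := by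
  rcases eq_or_ne x y with rfl | hne
  · exact ⟨0, le_rfl, zero_le_one, by simp⟩
  refine ⟨(clip lo hi x - clip lo hi y) / (x - y), ?_, ?_, ?_⟩
  · rcases le_total x y with h | h
    · exact div_nonneg_of_nonpos (sub_nonpos.2 (clip_mono h)) (sub_nonpos.2 h)
    · exact div_nonneg (sub_nonneg.2 (clip_mono h)) (sub_nonneg.2 h)
  · rcases lt_or_gt_of_ne hne with h | h
    · rw [div_le_one_of_neg (by linarith)]
      linarith [clip_sub_le (lo := lo) (hi := hi) h.le]
    · rw [div_le_one (by linarith)]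
      exact clip_sub_le h.le
  · rw [div_mul_cancel₀ _ (sub_ne_zero.2 hne)]

theorem abs_clip_sub_clip_le (x y : ℝ) : |clip lo hi x - clip lo hi y| ≤ |x - y| := by
  obtain ⟨θ, h0, h1, h⟩ := exists_clip_sub_eq (lo := lo) (hi := hi) x y
  rw [h, abs_mul, abs_of_nonneg h0]
  exact mul_le_of_le_one_left (abs_nonneg _) h1

/-- The variational inequality of the projection, from which all descent inequalities below are
derived. -/
theorem clip_proj {z : ℝ} (hz : z ∈ Set.Icc lo hi) (x : ℝ) :
    (x - clip lo hi x) * (z - clip lo hi x) ≤ 0 := by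
  obtain ⟨h1, h2⟩ := hz
  rcases le_total x lo with h | h
  · have : clip lo hi x = lo := by
      unfold clip; grind
    rw [this]
    exact mul_nonpos_of_nonpos_of_nonneg (by linarith) (by linarith)
  rcases le_total x hi with h' | h'
  · rw [clip_of_mem ⟨h, h'⟩]
    simp
  · have : clip lo hi x = hi := by
      unfold clip; grind
    rw [this]
    exact mul_nonpos_of_nonneg_of_nonpos (by linarith) (by linarith)

/-- The displacement of a projected step grows with the length of the step. -/
theorem abs_clip_add_sub_mono {x : ℝ} (hx : x ∈ Set.Icc lo hi) (v : ℝ) {t : ℝ}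
    (ht : 1 ≤ t) : |clip lo hi (x + v) - x| ≤ |clip lo hi (x + t * v) - x| := by
  have hc := clip_of_mem hx
  rcases le_total 0 v with h | h
  · have h1 : x ≤ clip lo hi (x + v) := by
      conv_lhs => rw [← hc]
      exact clip_mono (by linarith)
    have h2 : clip lo hi (x + v) ≤ clip lo hi (x + t * v) := clip_mono (by nlinarith)
    rw [abs_of_nonneg (by linarith), abs_of_nonneg (by linarith)]
    linarith
  · have h1 : clip lo hi (x + v) ≤ x := by
      conv_rhs => rw [← hc]
      exact clip_mono (by linarith)
    have h2 : clip lo hi (x + t * v) ≤ clip lo hi (x + v) := clip_mono (by nlinarith)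
    rw [abs_of_nonpos (by linarith), abs_of_nonpos (by linarith)]
    linarith

/-- The displacement of a projected step grows at most linearly with the length of the step. -/
theorem mul_abs_clip_add_sub_le {x : ℝ} (hx : x ∈ Set.Icc lo hi) (v : ℝ) {s : ℝ} (hs : 0 ≤ s)
    (hs1 : s ≤ 1) : s * |clip lo hi (x + v) - x| ≤ |clip lo hi (x + s * v) - x| := by
  obtain ⟨h1, h2⟩ := hx
  -- The displacement is the step length cut off at the distance to the end ahead, and the cut-off
  -- does not scale with the step.
  have key : ∀ w, |clip lo hi (x + w) - x| = if 0 ≤ w then min (hi - x) w else min (x - lo) (-w) := by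
    intro w
    unfold clip
    split_ifs with h
    · rw [abs_of_nonneg] <;> grind
    · rw [abs_of_nonpos] <;> grind
  rw [key, key]
  rcases le_or_gt 0 v with h | h
  · rw [if_pos h, if_pos (mul_nonneg hs h), mul_min_of_nonneg _ _ hs]
    exact min_le_min_right _ (mul_le_of_le_one_left (by linarith) hs1)
  · rcases hs.eq_or_lt with rfl | hs
    · simp [h2]
    · rw [if_neg h.not_ge, if_neg (by nlinarith), mul_min_of_nonneg _ _ hs.le, mul_neg]
      exact min_le_min_right _ (mul_le_of_le_one_left (by linarith) hs1)

/-- The right side is the sign form of membership of `v` in the normal cone at `x`. -/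
theorem clip_add_eq_iff {x v : ℝ} (hx : x ∈ Set.Icc lo hi) :
    clip lo hi (x + v) = x ↔ (0 < v → x = hi) ∧ (v < 0 → x = lo) := by
  obtain ⟨h1, h2⟩ := hx
  unfold clip
  constructor
  · intro h
    constructor <;> intro hv <;> grind
  · rintro ⟨ha, hb⟩
    rcases lt_trichotomy v 0 with h | h | h
    · have := hb h; grind
    · grind
    · have := ha h; grind

/-- The normal cone of an interval is a cone. -/
theorem clip_add_mul_eq {x v t : ℝ} (hx : x ∈ Set.Icc lo hi) (ht : 0 ≤ t)
    (h : clip lo hi (x + v) = x) : clip lo hi (x + t * v) = x := by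
  rw [clip_add_eq_iff hx] at h ⊢
  exact ⟨fun h' => h.1 (pos_of_mul_pos_right h' ht),
    fun h' => h.2 (by by_contra! hc; exact absurd h' (not_lt.2 (mul_nonneg ht hc)))⟩

theorem clip_add_add_eq {x v w : ℝ} (hx : x ∈ Set.Icc lo hi)
    (h : clip lo hi (x + v) = x) (h' : clip lo hi (x + w) = x) :
    clip lo hi (x + (v + w)) = x := by
  rw [clip_add_eq_iff hx] at h h' ⊢
  refine ⟨fun hp => ?_, fun hn => ?_⟩
  · rcases lt_or_ge 0 v with hv | hv
    · exact h.1 hv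
    · exact h'.1 (by linarith)
  · rcases lt_or_ge v 0 with hv | hv
    · exact h.2 hv
    · exact h'.2 (by linarith)

theorem mul_clip_add_sub_eq {x : ℝ} (hx : x ∈ Set.Icc lo hi) (v : ℝ) :
    v * (clip lo hi (x + v) - x) = |v| * |clip lo hi (x + v) - x| := by
  have hc := clip_of_mem hx
  rcases le_total 0 v with h | h
  · have h1 : x ≤ clip lo hi (x + v) := by
      conv_lhs => rw [← hc]
      exact clip_mono (by linarith)
    rw [abs_of_nonneg h, abs_of_nonneg (by linarith)]
  · have h1 : clip lo hi (x + v) ≤ x := by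
      conv_rhs => rw [← hc]
      exact clip_mono (by linarith)
    rw [abs_of_nonpos h, abs_of_nonpos (by linarith)]
    ring

/-- Near a fixed point the residual of a projected step is positively homogeneous. -/
theorem exists_clip_homogeneous {x y : ℝ} (hx : x ∈ Set.Icc lo hi)
    (h : clip lo hi (x + y) = x) :
    ∃ r : ℝ, 0 < r ∧ ∀ v, |v| ≤ r → ∀ t, 0 ≤ t → t ≤ 1 →
      clip lo hi (x + (y + t * v)) - x = t * (clip lo hi (x + (y + v)) - x) := by
  obtain ⟨h1, h2⟩ := hx
  rw [clip_add_eq_iff ⟨h1, h2⟩] at h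
  -- The cases record which ends of the interval `x` touches. For small `v` the residual is 0, `max
  -- 0 v`, `min 0 v` or `v`, each positively homogeneous; `r` is the distance to the next kink.
  rcases h1.eq_or_lt with e1 | l1 <;> rcases h2.eq_or_lt with e2 | l2
  · refine ⟨1, one_pos, fun v _ t _ _ => ?_⟩
    have : ∀ z, clip lo hi z = x := fun z => by unfold clip; grind
    rw [this, this]; ring
  · have hy : y ≤ 0 := by by_contra! hc; exact l2.ne (h.1 hc)
    rcases hy.eq_or_lt with rfl | hy
    · refine ⟨hi - x, by linarith, fun v hv t h0 ht => ?_⟩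
      have hv' := abs_le.1 hv
      have htv : t * v ≤ hi - x := by nlinarith
      have : ∀ w, w ≤ hi - x → clip lo hi (x + (0 + w)) - x = max 0 w := fun w hw => by
        unfold clip; grind
      rw [this _ htv, this _ hv'.2, mul_max_of_nonneg _ _ h0, mul_zero]
    · refine ⟨-y, by linarith, fun v hv t h0 ht => ?_⟩
      have hv' := abs_le.1 hv
      have htv : t * v ≤ -y := by nlinarith
      have : ∀ w, w ≤ -y → clip lo hi (x + (y + w)) - x = 0 := fun w hw => by
        unfold clip; grind
      rw [this _ htv, this _ hv'.2, mul_zero]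
  · have hy : 0 ≤ y := by by_contra! hc; exact l1.ne' (h.2 hc)
    rcases hy.eq_or_lt with rfl | hy
    · refine ⟨x - lo, by linarith, fun v hv t h0 ht => ?_⟩
      have hv' := abs_le.1 hv
      have htv : -(x - lo) ≤ t * v := by nlinarith
      have : ∀ w, -(x - lo) ≤ w → clip lo hi (x + (0 + w)) - x = min 0 w := fun w hw => by
        unfold clip; grind
      rw [this _ htv, this _ hv'.1, mul_min_of_nonneg _ _ h0, mul_zero]
    · refine ⟨y, by linarith, fun v hv t h0 ht => ?_⟩
      have hv' := abs_le.1 hv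
      have htv : -y ≤ t * v := by nlinarith
      have : ∀ w, -y ≤ w → clip lo hi (x + (y + w)) - x = 0 := fun w hw => by
        unfold clip; grind
      rw [this _ htv, this _ hv'.1, mul_zero]
  · have hy : y = 0 := by
      rcases lt_trichotomy y 0 with hc | hc | hc
      · exact absurd (h.2 hc) l1.ne'
      · exact hc
      · exact absurd (h.1 hc) l2.ne
    subst hy
    refine ⟨min (x - lo) (hi - x), lt_min (by linarith) (by linarith), fun v hv t h0 ht => ?_⟩
    have hv' := abs_le.1 (hv.trans (min_le_left _ _))
    have hv'' := abs_le.1 (hv.trans (min_le_right _ _))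
    have htv : -(x - lo) ≤ t * v := by nlinarith
    have htv' : t * v ≤ hi - x := by nlinarith
    have : ∀ w, -(x - lo) ≤ w → w ≤ hi - x → clip lo hi (x + (0 + w)) - x = w := fun w hw hw' => by
      unfold clip; grind
    rw [this _ htv htv', this _ hv'.1 hv''.2]

end Clip

namespace SCED

/-! ### The alternating averaging protocol on one line. -/

section Protocol

variable {V : Type*} [DecidableEq V] (D : SCED V) (Ec : ℕ → Finset (V × V)) (e : D.Line)

/-- Before the actions at time `k`, the upstream node of `e` is the next to average. -/
def idle (k : ℕ) : Prop :=
  (D.flags Ec e (k - 1)).phiJI ≠ (D.flags Ec e (k - 1)).phiBrv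

/-- At every time exactly one of the two flags has not yet been seen by the other end; that end is
the next to average. -/
theorem flags_invariant (k : ℕ) :
    ((D.flags Ec e k).phiJI ≠ (D.flags Ec e k).phiBrv) ↔
      (D.flags Ec e k).phiIJ = (D.flags Ec e k).phiHat := by
  induction k with
  | zero => simp [flags]
  | succ k ih =>
    simp only [flags, Flags.step]
    revert ih
    generalize D.flags Ec e k = F
    rcases F with ⟨a, b, c, d⟩
    by_cases h1 : (D.down e, D.up e) ∈ Ec (k + 1) <;>
      by_cases h2 : (D.up e, D.down e) ∈ Ec (k + 1) <;>
      simp only [h1, h2, decide_true, decide_false] <;>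
      cases a <;> cases b <;> cases c <;> cases d <;> simp

theorem upAverages_zero : ¬ D.upAverages Ec e 0 := by simp [upAverages]

theorem downAverages_zero : ¬ D.downAverages Ec e 0 := by simp [downAverages]

theorem lastUp_eq_self {k : ℕ} (h : D.upAverages Ec e k) : D.lastUp Ec e k = k := by
  classical
  unfold lastUp
  exact le_antisymm (Nat.findGreatest_le _) (Nat.le_findGreatest le_rfl h)

theorem lastUp_eq_pred {k : ℕ} (h : ¬ D.upAverages Ec e k) :
    D.lastUp Ec e k = D.lastUp Ec e (k - 1) := by
  classical
  cases k with
  | zero => rfl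
  | succ k =>
    unfold lastUp
    rw [Nat.findGreatest_of_not h]
    rfl

theorem lastUp_le (k : ℕ) : D.lastUp Ec e k ≤ k := by
  classical
  exact Nat.findGreatest_le _

/-- The possible transitions of the alternating averaging protocol. -/
theorem protocol_cases (k : ℕ) :
    (D.idle Ec e k ∧ ¬ D.upAverages Ec e k ∧ ¬ D.downAverages Ec e k ∧ D.idle Ec e (k + 1) ∧
      (1 ≤ k → (D.down e, D.up e) ∉ Ec k)) ∨
    (D.idle Ec e k ∧ D.upAverages Ec e k ∧ D.downAverages Ec e k ∧ D.idle Ec e (k + 1)) ∨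
    (D.idle Ec e k ∧ D.upAverages Ec e k ∧ ¬ D.downAverages Ec e k ∧ ¬ D.idle Ec e (k + 1)) ∨
    (¬ D.idle Ec e k ∧ ¬ D.upAverages Ec e k ∧ ¬ D.downAverages Ec e k ∧ ¬ D.idle Ec e (k + 1) ∧
      (D.up e, D.down e) ∉ Ec k) ∨
    (¬ D.idle Ec e k ∧ ¬ D.upAverages Ec e k ∧ D.downAverages Ec e k ∧ D.idle Ec e (k + 1)) := by
  cases k with
  -- Nobody acts at time 0 even if links are active then, hence the guard `1 ≤ k` in the first
  -- alternative.
  | zero =>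
    left
    refine ⟨?_, D.upAverages_zero Ec e, D.downAverages_zero Ec e, ?_, by simp⟩ <;>
      simp [idle, flags]
  | succ k =>
    have inv := D.flags_invariant Ec e k
    simp only [idle, upAverages, downAverages, Nat.add_sub_cancel, flags, Flags.step]
    revert inv
    generalize D.flags Ec e k = F
    rcases F with ⟨a, b, c, d⟩
    by_cases h1 : (D.down e, D.up e) ∈ Ec (k + 1) <;>
      by_cases h2 : (D.up e, D.down e) ∈ Ec (k + 1) <;>
      simp only [h1, h2, decide_true, decide_false] <;>
      cases a <;> cases b <;> cases c <;> cases d <;> simp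

theorem idle_zero : D.idle Ec e 0 := by simp [idle, flags]

/-- The first block that starts after `r`, with index `r / B + 1`, ends before `r + 2 * B`. -/
theorem CommAssumption.exists_forward {D : SCED V} {Ec : ℕ → Finset (V × V)} {B : ℕ}
    (h : D.CommAssumption B Ec) (e : D.Line) (r : ℕ) :
    ∃ t, r < t ∧ t ≤ r + 2 * B ∧ (D.up e, D.down e) ∈ Ec t := by
  have hB : 0 < B := by
    rcases Nat.eq_zero_or_pos B with rfl | h'
    · obtain ⟨t, -, ht, -⟩ := h.forward 0 _ _ e.2
      simp at ht
    · exact h'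
  obtain ⟨t, h1, h2, h3⟩ := h.forward (r / B + 1) _ _ e.2
  have ha := Nat.div_add_mod r B
  have hb := Nat.mod_lt r hB
  generalize r / B = q at *
  generalize r % B = m at *
  refine ⟨t, ?_, ?_, h3⟩ <;> nlinarith

theorem CommAssumption.exists_backward {D : SCED V} {Ec : ℕ → Finset (V × V)} {B : ℕ}
    (h : D.CommAssumption B Ec) (e : D.Line) (r : ℕ) :
    ∃ t, r < t ∧ t ≤ r + 2 * B ∧ (D.down e, D.up e) ∈ Ec t := by
  have hB : 0 < B := by
    rcases Nat.eq_zero_or_pos B with rfl | h'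
    · obtain ⟨t, -, ht, -⟩ := h.forward 0 _ _ e.2
      simp at ht
    · exact h'
  obtain ⟨t, h1, h2, h3⟩ := h.backward (r / B + 1) _ _ e.2
  have ha := Nat.div_add_mod r B
  have hb := Nat.mod_lt r hB
  generalize r / B = q at *
  generalize r % B = m at *
  refine ⟨t, ?_, ?_, h3⟩ <;> nlinarith

end Protocol

/-! ### Contraction of the disagreement over a line. -/

section Averaging

theorem filter_lower_bound {μ : ℝ} (hμ0 : 0 < μ) (hμ1 : μ ≤ 1) {E ω : ℕ → ℝ} (hω : ∀ k, 0 ≤ ω k)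
    (hE : ∀ k, μ * E k + 4 * ω k ≤ E (k + 1)) (r n : ℕ) :
    μ ^ n * (E r + 4 * ∑ j ∈ Finset.Ico r (r + n), ω j) ≤ E (r + n) := by
  induction n with
  | zero => simp
  | succ n ih =>
    rw [← add_assoc, Finset.sum_Ico_succ_top (by omega)]
    have h1 := hE (r + n)
    have h2 := mul_le_mul_of_nonneg_left ih hμ0.le
    have h3 : μ ^ (n + 1) * ω (r + n) ≤ ω (r + n) :=
      mul_le_of_le_one_left (hω _) (pow_le_one₀ hμ0.le hμ1)
    have h4 : μ ^ (n + 1) * (E r + 4 * (∑ j ∈ Finset.Ico r (r + n), ω j + ω (r + n)))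
      = μ * (μ ^ n * (E r + 4 * ∑ j ∈ Finset.Ico r (r + n), ω j)) + 4 * (μ ^ (n + 1) * ω (r + n)) := by
      ring
    linarith

/-- Within a window of `N` steps the filter forgets at most half of its value and of the forcing;
the gain 4 of the recursion therefore leaves 2. -/
theorem filter_half_le {μ : ℝ} (hμ0 : 0 < μ) (hμ1 : μ ≤ 1) {N : ℕ} (hN : 1 / 2 ≤ μ ^ N)
    {E ω : ℕ → ℝ} (hω : ∀ k, 0 ≤ ω k) (hE0 : 0 ≤ E 0)
    (hE : ∀ k, μ * E k + 4 * ω k ≤ E (k + 1)) {r k : ℕ} (hrk : r ≤ k) (hk : k ≤ r + N) :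
    E r / 2 + 2 * ∑ j ∈ Finset.Ico r k, ω j ≤ E k := by
  have hEnn : ∀ k, 0 ≤ E k := fun k => by
    induction k with
    | zero => exact hE0
    | succ k ih => nlinarith [hE k, hω k, mul_nonneg hμ0.le ih]
  obtain ⟨n, rfl⟩ := Nat.exists_eq_add_of_le hrk
  have h1 := filter_lower_bound hμ0 hμ1 hω hE r n
  have h2 : 1 / 2 ≤ μ ^ n := hN.trans (pow_le_pow_of_le_one hμ0.le hμ1 (by omega))
  have h3 : 0 ≤ E r + 4 * ∑ j ∈ Finset.Ico r (r + n), ω j :=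
    add_nonneg (hEnn r) (mul_nonneg (by norm_num) (Finset.sum_nonneg fun j _ => hω j))
  nlinarith [mul_le_mul_of_nonneg_right h2 h3]

variable {V : Type*} [DecidableEq V] {D : SCED V} {Ec : ℕ → Finset (V × V)} {B : ℕ}

/-- Contraction of the disagreement `d` over a line under the alternating averaging protocol,
with disturbances `w` bounded by `ω`. -/
theorem averaging_bound (hc : D.CommAssumption B Ec) (e : D.Line)
    {μ : ℝ} (hμ0 : 0 < μ) (hμ1 : μ ≤ 1) (hN : 1 / 2 ≤ μ ^ (4 * B + 1))
    {d E ω θ w : ℕ → ℝ} (hω : ∀ k, 0 ≤ ω k)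
    (hE0 : 2 * |d 0| ≤ E 0) (hE : ∀ k, μ * E k + 4 * ω k ≤ E (k + 1))
    (hθ0 : ∀ k, 0 ≤ θ k) (hθ1 : ∀ k, θ k ≤ 1) (hw : ∀ k, |w k| ≤ ω k)
    (hd : ∀ k, d (k + 1) =
      θ k * (d k - D.aUp Ec e k * d k - D.aDown Ec e k * d (D.lastUp Ec e k)) + w k) (k : ℕ) :
    |d k| ≤ E k ∧ (¬ D.idle Ec e k → D.lastUp Ec e (k - 1) < k ∧
      k ≤ D.lastUp Ec e (k - 1) + 2 * B) := by
  have hE0' : 0 ≤ E 0 := by linarith [abs_nonneg (d 0)]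
  have half : ∀ {r k : ℕ}, r ≤ k → k ≤ r + (4 * B + 1) →
      E r / 2 + 2 * ∑ j ∈ Finset.Ico r k, ω j ≤ E k :=
    fun h1 h2 => filter_half_le hμ0 hμ1 hN hω hE0' hE h1 h2
  have Snn : ∀ r k, 0 ≤ ∑ j ∈ Finset.Ico r k, ω j :=
    fun r k => Finset.sum_nonneg fun j _ => hω j
  have Ssucc : ∀ {r k}, r ≤ k → ∑ j ∈ Finset.Ico r (k + 1), ω j
      = ∑ j ∈ Finset.Ico r k, ω j + ω k := fun h => Finset.sum_Ico_succ_top h _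
  have Sadd : ∀ {r t k}, r ≤ t → t ≤ k → ∑ j ∈ Finset.Ico r t, ω j + ∑ j ∈ Finset.Ico t k, ω j
      = ∑ j ∈ Finset.Ico r k, ω j := fun h h' => Finset.sum_Ico_consecutive _ h h'
  -- the invariant
  have inv : ∀ k, (D.idle Ec e k → ∃ r ≤ k, |d r| ≤ E r / 2 ∧
        |d k| ≤ |d r| + ∑ j ∈ Finset.Ico r k, ω j ∧
        ∀ j, r ≤ j → j < k → 1 ≤ j → (D.down e, D.up e) ∉ Ec j) ∧
      (¬ D.idle Ec e k → ∃ r t, t = D.lastUp Ec e (k - 1) ∧ r ≤ t ∧ t < k ∧ t ≤ r + 2 * B ∧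
        |d r| ≤ E r / 2 ∧ |d t| ≤ |d r| + ∑ j ∈ Finset.Ico r t, ω j ∧
        (∃ ϑ, 0 ≤ ϑ ∧ ϑ ≤ 1 ∧ |d k - ϑ * (d t / 2)| ≤ ∑ j ∈ Finset.Ico t k, ω j) ∧
        ∀ j, t < j → j < k → (D.up e, D.down e) ∉ Ec j) := by
    -- While idle, `r` is the time at which the last exchange was completed, and noise has
    -- accumulated since. While waiting, `t` is the time of the upstream averaging, which left `d t
    -- / 2`; `ϑ` is the product of the damping factors since then.
    intro k
    induction k with
    | zero =>
      refine ⟨fun _ => ⟨0, le_rfl, by linarith, by simp, by simp⟩, fun h => ?_⟩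
      exact absurd (D.idle_zero Ec e) h
    | succ k ih =>
      have hrk : ∀ r, r ≤ k → (∀ j, r ≤ j → j < k → 1 ≤ j → (D.down e, D.up e) ∉ Ec j) →
          k ≤ r + 2 * B := by
        intro r hr hj
        by_contra! hcon
        obtain ⟨t, h1, h2, h3⟩ := hc.exists_backward e r
        exact hj t h1.le (by omega) (by omega) h3
      have hdk := hd k
      rcases D.protocol_cases Ec e k with ⟨hi, hu, hdn, hi', hl⟩ | ⟨hi, hu, hdn, hi'⟩ |
        ⟨hi, hu, hdn, hi'⟩ | ⟨hi, hu, hdn, hi', hl⟩ | ⟨hi, hu, hdn, hi'⟩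
      · refine ⟨fun _ => ?_, fun h => absurd hi' h⟩
        obtain ⟨r, hr, h1, h2, h3⟩ := ih.1 hi
        refine ⟨r, by omega, h1, ?_, fun j hj1 hj2 hj3 => ?_⟩
        · rw [hdk, aUp, aDown, if_neg hu, if_neg hdn, Ssucc hr]
          have : |θ k * (d k - 0 * d k - 0 * d (D.lastUp Ec e k))| ≤ |d k| := by
            rw [abs_mul, abs_of_nonneg (hθ0 k)]
            simpa using mul_le_of_le_one_left (abs_nonneg (d k)) (hθ1 k)
          linarith [abs_add_le (θ k * (d k - 0 * d k - 0 * d (D.lastUp Ec e k))) (w k), hw k]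
        · rcases Nat.lt_succ_iff_lt_or_eq.1 hj2 with h | rfl
          · exact h3 j hj1 h hj3
          · exact hl hj3
      · refine ⟨fun _ => ?_, fun h => absurd hi' h⟩
        obtain ⟨r, hr, h1, h2, h3⟩ := ih.1 hi
        have hkB := hrk r hr h3
        refine ⟨k + 1, le_rfl, ?_, by simp, fun j hj1 hj2 => by omega⟩
        rw [hdk, aUp, aDown, if_pos hu, if_pos hdn, D.lastUp_eq_self Ec e hu]
        have h4 := half (r := r) (k := k + 1) (by omega) (by omega)
        rw [Ssucc hr] at h4
        -- When both ends average in the same period the old disagreement cancels completely.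
        have : θ k * (d k - 1 / 2 * d k - 1 / 2 * d k) + w k = w k := by ring
        rw [this]
        linarith [hw k, Snn r k, abs_nonneg (d r)]
      · refine ⟨fun h => absurd h hi', fun _ => ?_⟩
        obtain ⟨r, hr, h1, h2, h3⟩ := ih.1 hi
        have hkB := hrk r hr h3
        refine ⟨r, k, ?_, hr, by omega, hkB, h1, h2, ⟨θ k, hθ0 k, hθ1 k, ?_⟩, fun j _ _ => by omega⟩
        · rw [Nat.add_sub_cancel, D.lastUp_eq_self Ec e hu]
        · rw [hdk, aUp, aDown, if_pos hu, if_neg hdn, Ssucc le_rfl]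
          have : θ k * (d k - 1 / 2 * d k - 0 * d (D.lastUp Ec e k)) + w k - θ k * (d k / 2) = w k := by
            ring
          rw [this]
          simpa using hw k
      · refine ⟨fun h => absurd h hi', fun _ => ?_⟩
        obtain ⟨r, t, ht, hrt, htk, htr, h1, h2, ⟨ϑ, hϑ0, hϑ1, h3⟩, h4⟩ := ih.2 hi
        refine ⟨r, t, ?_, hrt, by omega, htr, h1, h2,
          ⟨θ k * ϑ, mul_nonneg (hθ0 k) hϑ0, mul_le_one₀ (hθ1 k) hϑ0 hϑ1, ?_⟩, fun j hj1 hj2 => ?_⟩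
        · rw [Nat.add_sub_cancel, D.lastUp_eq_pred Ec e hu, ht]
        · rw [hdk, aUp, aDown, if_neg hu, if_neg hdn, Ssucc htk.le]
          have h5 : θ k * (d k - 0 * d k - 0 * d (D.lastUp Ec e k)) + w k - θ k * ϑ * (d t / 2)
            = θ k * (d k - ϑ * (d t / 2)) + w k := by ring
          rw [h5]
          have : |θ k * (d k - ϑ * (d t / 2))| ≤ |d k - ϑ * (d t / 2)| := by
            rw [abs_mul, abs_of_nonneg (hθ0 k)]
            exact mul_le_of_le_one_left (abs_nonneg _) (hθ1 k)
          linarith [abs_add_le (θ k * (d k - ϑ * (d t / 2))) (w k), hw k]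
        · rcases Nat.lt_succ_iff_lt_or_eq.1 hj2 with h | rfl
          · exact h4 j hj1 h
          · exact hl
      · refine ⟨fun _ => ?_, fun h => absurd hi' h⟩
        obtain ⟨r, t, ht, hrt, htk, htr, h1, h2, ⟨ϑ, hϑ0, hϑ1, h3⟩, h4⟩ := ih.2 hi
        have hkt : k ≤ t + 2 * B := by
          by_contra! hcon
          obtain ⟨t', h1', h2', h3'⟩ := hc.exists_forward e t
          exact h4 t' h1' (by omega) h3'
        refine ⟨k + 1, le_rfl, ?_, by simp, fun j hj1 hj2 => by omega⟩
        rw [hdk, aUp, aDown, if_neg hu, if_pos hdn, D.lastUp_eq_pred Ec e hu, ← ht]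
        -- The downstream end removes `d t / 2` from what is by now `ϑ * (d t / 2)` plus noise.
        -- Damping may spoil the cancellation, but at most half of `d t` survives.
        have h5 : θ k * (d k - 0 * d k - 1 / 2 * d t) + w k
            = θ k * ((d k - ϑ * (d t / 2)) + (ϑ - 1) * (d t / 2)) + w k := by ring
        rw [h5]
        have h6 : |θ k * ((d k - ϑ * (d t / 2)) + (ϑ - 1) * (d t / 2))|
            ≤ |d k - ϑ * (d t / 2)| + |d t| / 2 := by
          rw [abs_mul, abs_of_nonneg (hθ0 k)]
          refine (mul_le_of_le_one_left (abs_nonneg _) (hθ1 k)).trans ((abs_add_le _ _).trans ?_)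
          gcongr
          rw [abs_mul, abs_div, abs_two, abs_of_nonpos (by linarith)]
          exact mul_le_of_le_one_left (by positivity) (by linarith)
        -- At most `2 * B` idle steps, `2 * B` waiting steps and the present one: the exponent `4 *
        -- B + 1`.
        have h7 := half (r := r) (k := k + 1) (by omega) (by omega)
        rw [Ssucc (by omega)] at h7
        have h8 := Sadd hrt htk.le
        linarith [abs_add_le (θ k * ((d k - ϑ * (d t / 2)) + (ϑ - 1) * (d t / 2))) (w k), hw k,
          Snn r t, Snn t k, abs_nonneg (d r), hω k]
  have hidle : ∀ k r, r ≤ k → (∀ j, r ≤ j → j < k → 1 ≤ j → (D.down e, D.up e) ∉ Ec j) →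
      k ≤ r + 2 * B := by
    intro k r hr hj
    by_contra! hcon
    obtain ⟨t, h1, h2, h3⟩ := hc.exists_backward e r
    exact hj t h1.le (by omega) (by omega) h3
  by_cases hi : D.idle Ec e k
  · obtain ⟨r, hr, h1, h2, h3⟩ := (inv k).1 hi
    have hkB := hidle k r hr h3
    have := half hr (by omega)
    exact ⟨by linarith [Snn r k], fun h => absurd hi h⟩
  · obtain ⟨r, t, ht, hrt, htk, htr, h1, h2, ⟨ϑ, hϑ0, hϑ1, h3⟩, h4⟩ := (inv k).2 hi
    have hkt : k ≤ t + 2 * B := by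
      by_contra! hcon
      obtain ⟨t', h1', h2', h3'⟩ := hc.exists_forward e t
      exact h4 t' h1' (by omega) h3'
    refine ⟨?_, fun _ => by rw [← ht]; exact ⟨htk, hkt⟩⟩
    have h7 := half (r := r) (k := k) (by omega) (by omega)
    have h8 := Sadd hrt htk.le
    have h9 : |ϑ * (d t / 2)| ≤ |d t| / 2 := by
      rw [abs_mul, abs_of_nonneg hϑ0, abs_div, abs_two]
      exact mul_le_of_le_one_left (by positivity) hϑ1
    have h10 := abs_add_le (d k - ϑ * (d t / 2)) (ϑ * (d t / 2))
    rw [sub_add_cancel] at h10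
    linarith [Snn r t, Snn t k, abs_nonneg (d r), abs_nonneg (d t)]

end Averaging

end SCED

namespace SCED

/-! ### Gradients of the local Lagrangians. -/

section Gradients

variable {V : Type*} [DecidableEq V] (D : SCED V)

theorem sum_update_ite {ι κ : Type*} [Fintype ι] [DecidableEq ι] [DecidableEq κ] (h : ι → κ)
    (w : ι → ℝ) (e : ι) (t : ℝ) (i : κ) :
    (∑ e', if h e' = i then Function.update w e t e' else 0)
      = (∑ e', if h e' = i then w e' else 0) + if h e = i then t - w e else 0 := by
  rw [← sub_eq_iff_eq_add', ← Finset.sum_sub_distrib, Finset.sum_eq_single e]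
  · split_ifs <;> simp
  · intro b _ hb
    split_ifs <;> simp [Function.update_of_ne hb]
  · simp

theorem hasDerivAt_quadratic (lam rho b c a : ℝ) :
    HasDerivAt (fun t => lam * (b + c * (t - a)) + rho / 2 * (b + c * (t - a)) ^ 2)
      (c * (lam + rho * b)) a := by
  have h1 : HasDerivAt (fun t => b + c * (t - a)) c a := by
    simpa using (((hasDerivAt_id a).sub_const a).const_mul c).const_add b
  refine ((h1.const_mul lam).fun_add ((h1.fun_pow 2).const_mul (rho / 2))).congr_deriv ?_
  norm_num
  ring

theorem gradG_eq (hf : ∀ i, Differentiable ℝ (D.f i)) (x : D.Iterate) (i : V) :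
    D.gradG x i = deriv (D.f i) (x.g i) + (x.lam i + D.ρ * D.localImbalance i x) := by
  have h : (fun t => D.localLagrangian i { x with g := Function.update x.g i t })
      = fun t => D.f i t + (x.lam i * (D.localImbalance i x + 1 * (t - x.g i))
        + D.ρ / 2 * (D.localImbalance i x + 1 * (t - x.g i)) ^ 2) := by
    funext t
    simp only [localLagrangian, localImbalance, Function.update_self]
    ring
  rw [gradG, h, deriv_fun_add (hf i _) (by fun_prop), (hasDerivAt_quadratic _ _ _ _ _).deriv, one_mul]

theorem gradLam_eq (x : D.Iterate) (i : V) : D.gradLam x i = D.localImbalance i x := by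
  have h : (fun t => D.localLagrangian i { x with lam := Function.update x.lam i t })
      = fun t => (D.f i (x.g i) + D.ρ / 2 * D.localImbalance i x ^ 2)
        + t * D.localImbalance i x := by
    funext t
    simp only [localLagrangian, localImbalance, Function.update_self]
    ring
  rw [gradLam, h]
  simp

theorem gradPhat_eq (x : D.Iterate) (e : D.Line) :
    D.gradPhat x e = -(x.lam (D.up e) + D.ρ * D.localImbalance (D.up e) x) := by
  have h : (fun t => D.localLagrangian (D.up e) { x with phat := Function.update x.phat e t })
      = fun t => D.f (D.up e) (x.g (D.up e)) +
        (x.lam (D.up e) * (D.localImbalance (D.up e) x + (-1) * (t - x.phat e))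
        + D.ρ / 2 * (D.localImbalance (D.up e) x + (-1) * (t - x.phat e)) ^ 2) := by
    funext t
    simp only [localLagrangian, localImbalance, sum_update_ite, if_true]
    ring
  rw [gradPhat, h, ((hasDerivAt_quadratic _ _ _ _ _).const_add _).deriv]
  ring

theorem gradPbrv_eq (x : D.Iterate) (e : D.Line) :
    D.gradPbrv x e = x.lam (D.down e) + D.ρ * D.localImbalance (D.down e) x := by
  have h : (fun t => D.localLagrangian (D.down e) { x with pbrv := Function.update x.pbrv e t })
      = fun t => D.f (D.down e) (x.g (D.down e)) +
        (x.lam (D.down e) * (D.localImbalance (D.down e) x + 1 * (t - x.pbrv e))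
        + D.ρ / 2 * (D.localImbalance (D.down e) x + 1 * (t - x.pbrv e)) ^ 2) := by
    funext t
    simp only [localLagrangian, localImbalance, sum_update_ite, if_true]
    ring
  rw [gradPbrv, h, ((hasDerivAt_quadratic _ _ _ _ _).const_add _).deriv]
  ring

end Gradients

/-! ### Net outflow of a bus and summation by parts. -/

section Divergence

variable {V : Type*} [DecidableEq V] (D : SCED V)

/-- The net power `M w` sent out by each bus under the line flows `w`. -/
def div (w : D.Line → ℝ) (i : V) : ℝ :=
  (∑ e : D.Line, if D.up e = i then w e else 0) - ∑ e : D.Line, if D.down e = i then w e else 0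

variable {D}

theorem IsRadial.up_ne_down (h : D.IsRadial) (e : D.Line) : D.up e ≠ D.down e := by
  intro he
  have := h.oriented _ _ e.2
  change _ = D.graph.dist D.root (D.up e) + 1 at this
  rw [he] at this
  exact absurd this (Nat.lt_succ_self _).ne

theorem sum_mul_ite [Fintype V] (c : V → ℝ) (h : D.Line → V) (w : D.Line → ℝ) :
    ∑ i, c i * (∑ e : D.Line, if h e = i then w e else 0) = ∑ e : D.Line, c (h e) * w e := by
  simp_rw [Finset.mul_sum]
  rw [Finset.sum_comm]
  simp

theorem sum_mul_div [Fintype V] (c : V → ℝ) (w : D.Line → ℝ) :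
    ∑ i, c i * D.div w i = ∑ e : D.Line, (c (D.up e) - c (D.down e)) * w e := by
  simp_rw [div, mul_sub, Finset.sum_sub_distrib, sum_mul_ite, sub_mul, Finset.sum_sub_distrib]

theorem incidence_mulVec (h : D.IsRadial) (w : D.Line → ℝ) : D.incidence *ᵥ w = D.div w := by
  funext i
  simp only [Matrix.mulVec, dotProduct, incidence, Matrix.of_apply, div]
  rw [← Finset.sum_sub_distrib]
  refine Finset.sum_congr rfl fun e _ => ?_
  have := h.up_ne_down e
  by_cases h1 : D.up e = i
  · have h2 : D.down e ≠ i := fun h' => this (h1.trans h'.symm)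
    simp only [h1, h2, if_true, if_false]; ring
  · by_cases h2 : D.down e = i
    · simp only [h1, h2, if_true, if_false]; ring
    · simp only [h1, h2, if_false]; ring

theorem div_update (w : D.Line → ℝ) (e : D.Line) (t : ℝ) (i : V) :
    D.div (Function.update w e t) i =
      D.div w i + (t - w e) * ((if D.up e = i then 1 else 0) - if D.down e = i then 1 else 0) := by
  simp only [div, sum_update_ite]
  split_ifs <;> ring

theorem div_sub (v w : D.Line → ℝ) (i : V) :
    D.div (fun e => v e - w e) i = D.div v i - D.div w i := by
  have : ∀ h : D.Line → V, (∑ e : D.Line, if h e = i then v e - w e else 0)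
      = (∑ e : D.Line, if h e = i then v e else 0) - ∑ e : D.Line, if h e = i then w e else 0 := by
    intro h
    rw [← Finset.sum_sub_distrib]
    refine Finset.sum_congr rfl fun e _ => ?_
    split_ifs <;> simp
  simp only [div, this]
  ring

theorem abs_sum_ite_le {h : D.Line → V} {i : V} {w : D.Line → ℝ} {r : ℝ} (hr : 0 ≤ r)
    (hw : ∀ e, |w e| ≤ r) :
    |∑ e : D.Line, if h e = i then w e else 0| ≤ Fintype.card D.Line * r := by
  refine (Finset.abs_sum_le_sum_abs _ _).trans ?_
  have : ∀ e ∈ (Finset.univ : Finset D.Line), |if h e = i then w e else 0| ≤ r := by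
    intro e _
    split_ifs
    · exact hw e
    · simpa using hr
  simpa using Finset.sum_le_card_nsmul _ _ _ this

theorem abs_div_le {i : V} {w : D.Line → ℝ} {r : ℝ} (hr : 0 ≤ r) (hw : ∀ e, |w e| ≤ r) :
    |D.div w i| ≤ 2 * Fintype.card D.Line * r := by
  have h1 := abs_sum_ite_le (h := D.up) (i := i) hr hw
  have h2 := abs_sum_ite_le (h := D.down) (i := i) hr hw
  unfold div
  refine (abs_sub _ _).trans ?_
  linarith

end Divergence

/-! ### Equilibria and first-order optimality conditions. -/

section Equilibrium

variable {V : Type*} [Fintype V] [DecidableEq V] {D : SCED V}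

theorem lagrangian_eq (h : D.IsRadial) (g : V → ℝ) (p : D.Line → ℝ) (lam : V → ℝ) :
    D.lagrangian g p lam = ∑ i, D.f i (g i) + ∑ i, (lam i * (g i - D.l i - D.div p i)
      + D.ρ / 2 * (g i - D.l i - D.div p i) ^ 2) := by
  simp only [lagrangian, incidence_mulVec h, dotProduct, Pi.sub_apply, Finset.sum_add_distrib,
    Finset.mul_sum]
  ring

theorem hasDerivAt_sum_quadratic (lam b c : V → ℝ) (rho a : ℝ) :
    HasDerivAt (fun t => ∑ i, (lam i * (b i + c i * (t - a)) + rho / 2 * (b i + c i * (t - a)) ^ 2))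
      (∑ i, c i * (lam i + rho * b i)) a := by
  exact HasDerivAt.fun_sum fun i _ => hasDerivAt_quadratic _ _ _ _ _

theorem deriv_lagrangian_g (h : D.IsRadial) (hf : ∀ i, Differentiable ℝ (D.f i))
    (u : D.Triple) (i : V) :
    deriv (fun t => D.lagrangian (Function.update u.g i t) u.p u.lam) (u.g i)
      = deriv (D.f i) (u.g i) + (u.lam i + D.ρ * (u.g i - D.l i - D.div u.p i)) := by
  have e1 : (fun t => D.lagrangian (Function.update u.g i t) u.p u.lam) = fun t =>
      ∑ j, D.f j (Function.update u.g i t j) + ∑ j, (u.lam j * ((u.g j - D.l j - D.div u.p j)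
        + (if j = i then 1 else 0) * (t - u.g i)) + D.ρ / 2 * ((u.g j - D.l j - D.div u.p j)
        + (if j = i then 1 else 0) * (t - u.g i)) ^ 2) := by
    funext t
    rw [lagrangian_eq h]
    congr 1
    refine Finset.sum_congr rfl fun j _ => ?_
    rcases eq_or_ne j i with rfl | hj
    · simp only [Function.update_self, if_true]; ring
    · simp only [Function.update_of_ne hj, if_neg hj]; ring
  have e2 : HasDerivAt (fun t => ∑ j, D.f j (Function.update u.g i t j))
      (∑ j, if j = i then deriv (D.f i) (u.g i) else 0) (u.g i) := by
    refine HasDerivAt.fun_sum fun j _ => ?_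
    rcases eq_or_ne j i with rfl | hj
    · simpa using (hf j _).hasDerivAt
    · simpa [Function.update_of_ne hj, hj] using hasDerivAt_const _ _
  rw [e1, (e2.fun_add (hasDerivAt_sum_quadratic _ _ _ _ _)).deriv]
  simp

theorem deriv_lagrangian_p (h : D.IsRadial) (u : D.Triple) (e : D.Line) :
    deriv (fun t => D.lagrangian u.g (Function.update u.p e t) u.lam) (u.p e)
      = -(u.lam (D.up e) + D.ρ * (u.g (D.up e) - D.l (D.up e) - D.div u.p (D.up e)))
        + (u.lam (D.down e) + D.ρ * (u.g (D.down e) - D.l (D.down e) - D.div u.p (D.down e))) := by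
  have e1 : (fun t => D.lagrangian u.g (Function.update u.p e t) u.lam) = fun t =>
      ∑ j, D.f j (u.g j) + ∑ j, (u.lam j * ((u.g j - D.l j - D.div u.p j)
        + ((if D.down e = j then 1 else 0) - if D.up e = j then 1 else 0) * (t - u.p e))
        + D.ρ / 2 * ((u.g j - D.l j - D.div u.p j)
        + ((if D.down e = j then 1 else 0) - if D.up e = j then 1 else 0) * (t - u.p e)) ^ 2) := by
    funext t
    rw [lagrangian_eq h]
    congr 1
    refine Finset.sum_congr rfl fun j _ => ?_
    rw [div_update]
    ring
  rw [e1, ((hasDerivAt_sum_quadratic _ _ _ _ _).const_add _).deriv]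
  simp only [sub_mul, ite_mul, one_mul, zero_mul, Finset.sum_sub_distrib, Finset.sum_ite_eq,
    Finset.mem_univ, if_true]
  ring

theorem deriv_lagrangian_lam (h : D.IsRadial) (u : D.Triple) (i : V) :
    deriv (fun t => D.lagrangian u.g u.p (Function.update u.lam i t)) (u.lam i)
      = u.g i - D.l i - D.div u.p i := by
  have e1 : (fun t => D.lagrangian u.g u.p (Function.update u.lam i t)) = fun t =>
      D.lagrangian u.g u.p u.lam + (t - u.lam i) * (u.g i - D.l i - D.div u.p i) := by
    funext t
    rw [lagrangian_eq h, lagrangian_eq h, add_assoc]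
    congr 1
    rw [← sub_eq_iff_eq_add', ← Finset.sum_sub_distrib, Finset.sum_eq_single i]
    · simp only [Function.update_self]; ring
    · intro j _ hj
      simp [Function.update_of_ne hj]
    · simp
  rw [e1]
  simp

/-- The optimality conditions satisfied by an equilibrium. -/
structure Optimal (D : SCED V) (u : D.Triple) : Prop where
  balance : ∀ i, u.g i - D.l i - D.div u.p i = 0
  g_mem : ∀ i, u.g i ∈ Set.Icc (D.gmin i) (D.gmax i)
  p_mem : ∀ e, u.p e ∈ Set.Icc (-D.pmax e) (D.pmax e)
  g_fixed : ∀ i, clip (D.gmin i) (D.gmax i) (u.g i + -(deriv (D.f i) (u.g i) + u.lam i)) = u.g i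
  p_fixed : ∀ e, clip (-D.pmax e) (D.pmax e) (u.p e + (u.lam (D.up e) - u.lam (D.down e))) = u.p e

theorem IsEquilibrium.optimal (h : D.IsRadial) (hf : ∀ i, Differentiable ℝ (D.f i))
    (hg : ∀ i, D.gmin i ≤ D.gmax i) (hp : ∀ e, 0 ≤ D.pmax e) {u : D.Triple}
    (hu : D.IsEquilibrium u) : D.Optimal u := by
  have h1 := hu 1 one_pos
  -- A fixed multiplier forces zero imbalance, which removes every ρ-term from the other two
  -- conditions.
  have hl : ∀ i, u.g i - D.l i - D.div u.p i = 0 := fun i => by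
    have := congrFun (congrArg Triple.lam h1) i
    simp only [centralStep, deriv_lagrangian_lam h] at this
    linarith
  have hgf : ∀ i, clip (D.gmin i) (D.gmax i) (u.g i + -(deriv (D.f i) (u.g i) + u.lam i)) = u.g i :=
    fun i => by
      have := congrFun (congrArg Triple.g h1) i
      simp only [centralStep, deriv_lagrangian_g h hf, hl] at this
      convert this using 2
      ring
  have hpf : ∀ e, clip (-D.pmax e) (D.pmax e) (u.p e + (u.lam (D.up e) - u.lam (D.down e)))
      = u.p e := fun e => by
      have := congrFun (congrArg Triple.p h1) e
      simp only [centralStep, deriv_lagrangian_p h, hl] at this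
      convert this using 2
      ring
  refine ⟨hl, fun i => ?_, fun e => ?_, hgf, hpf⟩
  · rw [← hgf i]
    exact clip_mem (hg i) _
  · rw [← hpf e]
    exact clip_mem (by linarith [hp e]) _

/-- The converse serves to exploit uniqueness: any point satisfying the optimality conditions must
be the given equilibrium. All stepsizes are covered because normal cones are cones. -/
theorem Optimal.isEquilibrium (h : D.IsRadial) (hf : ∀ i, Differentiable ℝ (D.f i))
    {u : D.Triple} (hu : D.Optimal u) : D.IsEquilibrium u := by
  intro s hs
  ext i
  · simp only [centralStep, deriv_lagrangian_g h hf, hu.balance]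
    have := clip_add_mul_eq (hu.g_mem i) hs.le (hu.g_fixed i)
    convert this using 2
    ring
  · simp only [centralStep, deriv_lagrangian_p h, hu.balance]
    have := clip_add_mul_eq (hu.p_mem i) hs.le (hu.p_fixed i)
    convert this using 2
    ring
  · simp only [centralStep, deriv_lagrangian_lam h, hu.balance]
    ring

end Equilibrium

end SCED

/-! ### Reduction of a run to perturbed primal-dual steps. -/

namespace SCED

/-- The local augmented multipliers `λ_i + ρ b_i`. -/
def multiplier {V : Type*} [DecidableEq V] (D : SCED V) (x : D.Iterate) (i : V) : ℝ :=
  x.lam i + D.ρ * D.localImbalance i x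

/-- A projected primal-dual step from `x` to `x'` in which the two copies of every line flow differ
by at most `s * Q` and the flow gradients are known up to an error of at most `h`. -/
structure PerturbedStep {V : Type*} [DecidableEq V] (D : SCED V) (s h Q : ℝ)
    (x x' : D.Iterate) : Prop where
  g_step : ∀ i, x'.g i = clip (D.gmin i) (D.gmax i)
    (x.g i - s * (deriv (D.f i) (x.g i) + D.multiplier x i))
  lam_step : ∀ i, x'.lam i = x.lam i + s * D.localImbalance i x
  disagreement : ∀ e, |x.phat e - x.pbrv e| ≤ s * Q
  phat_step : ∀ e, ∃ y, |y - (D.multiplier x (D.down e) - D.multiplier x (D.up e))| ≤ h ∧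
    x'.phat e = clip (-D.pmax e) (D.pmax e) (x.phat e - s * y)
  pbrv_step : ∀ e, ∃ y, |y - (D.multiplier x (D.down e) - D.multiplier x (D.up e))| ≤ h ∧
    x'.pbrv e = clip (-D.pmax e) (D.pmax e) (x.pbrv e - s * y)

section Runs

variable {V : Type*} [DecidableEq V] {D : SCED V} {Ec : ℕ → Finset (V × V)} {s : ℝ}
  {X : ℕ → D.Iterate}

/-- After cancellation the stored values enter the updates only with this weight, so their default 0
is harmless. -/
theorem aDown_mul_stored (e : D.Line) (w : ℕ → ℝ) (k : ℕ) :
    D.aDown Ec e k * D.stored Ec e w k = D.aDown Ec e k * w (D.lastUp Ec e k) := by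
  unfold aDown stored
  split_ifs <;> simp

theorem aUp_nonneg (e : D.Line) (k : ℕ) : 0 ≤ D.aUp Ec e k := by
  unfold aUp; split_ifs <;> norm_num

theorem aUp_le (e : D.Line) (k : ℕ) : D.aUp Ec e k ≤ 1 / 2 := by
  unfold aUp; split_ifs <;> norm_num

theorem aDown_nonneg (e : D.Line) (k : ℕ) : 0 ≤ D.aDown Ec e k := by
  unfold aDown; split_ifs <;> norm_num

theorem aDown_le (e : D.Line) (k : ℕ) : D.aDown Ec e k ≤ 1 / 2 := by
  unfold aDown; split_ifs <;> norm_num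

namespace IsRun

theorem phat_step (hX : D.IsRun s Ec X) (k : ℕ) (e : D.Line) :
    (X (k + 1)).phat e = clip (-D.pmax e) (D.pmax e) ((X k).phat e
      - D.aUp Ec e k * ((X k).phat e - (X k).pbrv e) - s * (X k).yhat e) := by
  rw [hX.phat_succ]
  congr 1
  ring

theorem pbrv_step (hX : D.IsRun s Ec X) (k : ℕ) (e : D.Line) :
    (X (k + 1)).pbrv e = clip (-D.pmax e) (D.pmax e) ((X k).pbrv e
      + D.aDown Ec e k * ((X (D.lastUp Ec e k)).phat e - (X (D.lastUp Ec e k)).pbrv e)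
      - s * (X k).ybrv e) := by
  rw [hX.pbrv_succ, mul_sub]
  have h1 := aDown_mul_stored (Ec := Ec) e (fun t => (X t).phat e) k
  have h2 := aDown_mul_stored (Ec := Ec) e (fun t => (X t).pbrv e) k
  congr 1
  linear_combination h1 - h2

theorem yhat_step (hX : D.IsRun s Ec X) (k : ℕ) (e : D.Line) :
    (X (k + 1)).yhat e = (X k).yhat e - D.aUp Ec e k * ((X k).yhat e - (X k).ybrv e)
      - 2 * (D.multiplier (X (k + 1)) (D.up e) - D.multiplier (X k) (D.up e)) := by
  rw [hX.yhat_succ, gradPhat_eq, gradPhat_eq, multiplier, multiplier]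
  ring

theorem ybrv_step (hX : D.IsRun s Ec X) (k : ℕ) (e : D.Line) :
    (X (k + 1)).ybrv e = (X k).ybrv e
      + D.aDown Ec e k * ((X (D.lastUp Ec e k)).yhat e - (X (D.lastUp Ec e k)).ybrv e)
      + 2 * (D.multiplier (X (k + 1)) (D.down e) - D.multiplier (X k) (D.down e)) := by
  rw [hX.ybrv_succ, gradPbrv_eq, gradPbrv_eq, multiplier, multiplier, mul_sub]
  have h1 := aDown_mul_stored (Ec := Ec) e (fun t => (X t).yhat e) k
  have h2 := aDown_mul_stored (Ec := Ec) e (fun t => (X t).ybrv e) k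
  linear_combination h1 - h2

/-- The sum of the two tracking variables of a line equals twice the flow gradient, up to the
transfer that is still to be completed. -/
theorem tracking_sum (hX : D.IsRun s Ec X) (e : D.Line) (k : ℕ) :
    (X k).yhat e + (X k).ybrv e
      - 2 * (D.multiplier (X k) (D.down e) - D.multiplier (X k) (D.up e)) =
      open Classical in if D.idle Ec e k then 0 else
        -((X (D.lastUp Ec e (k - 1))).yhat e - (X (D.lastUp Ec e (k - 1))).ybrv e) / 2 := by
  induction k with
  | zero =>
    rw [if_pos (D.idle_zero Ec e), hX.yhat_zero, hX.ybrv_zero, gradPhat_eq, gradPbrv_eq,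
      multiplier, multiplier]
    ring
  | succ k ih =>
    have h1 := hX.yhat_step k e
    have h2 := hX.ybrv_step k e
    rw [Nat.add_sub_cancel]
    -- The upstream averaging takes half of the disagreement out of the sum and the downstream
    -- averaging puts the same amount back; in between it is in transit.
    rcases D.protocol_cases Ec e k with ⟨hi, hu, hd, hi', -⟩ | ⟨hi, hu, hd, hi'⟩ |
      ⟨hi, hu, hd, hi'⟩ | ⟨hi, hu, hd, hi', -⟩ | ⟨hi, hu, hd, hi'⟩
    · rw [if_pos hi] at ih
      rw [if_pos hi']
      rw [aUp, if_neg hu] at h1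
      rw [aDown, if_neg hd] at h2
      linear_combination ih + h1 + h2
    · rw [if_pos hi] at ih
      rw [if_pos hi']
      rw [aUp, if_pos hu] at h1
      rw [aDown, if_pos hd, D.lastUp_eq_self Ec e hu] at h2
      linear_combination ih + h1 + h2
    · rw [if_pos hi] at ih
      rw [if_neg hi', D.lastUp_eq_self Ec e hu]
      rw [aUp, if_pos hu] at h1
      rw [aDown, if_neg hd] at h2
      linear_combination ih + h1 + h2
    · rw [if_neg hi] at ih
      rw [if_neg hi', D.lastUp_eq_pred Ec e hu]
      rw [aUp, if_neg hu] at h1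
      rw [aDown, if_neg hd] at h2
      linear_combination ih + h1 + h2
    · rw [if_neg hi] at ih
      rw [if_pos hi']
      rw [aUp, if_neg hu] at h1
      rw [aDown, if_pos hd, D.lastUp_eq_pred Ec e hu] at h2
      linear_combination ih + h1 + h2

/-- A run of the distributed algorithm is a sequence of perturbed steps, with perturbations that
are filtered versions of the increments of the multipliers. -/
theorem perturbedStep [Fintype V] {B : ℕ} (hX : D.IsRun s Ec X) (hc : D.CommAssumption B Ec)
    (hf : ∀ i, Differentiable ℝ (D.f i)) (hs : 0 < s)
    {μ : ℝ} (hμ0 : 0 < μ) (hμ1 : μ ≤ 1) (hN : 1 / 2 ≤ μ ^ (4 * B + 1)) :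
    ∃ H Q : ℕ → ℝ, (∀ k, 0 ≤ H k) ∧ (∀ k, 0 ≤ Q k) ∧
      (∀ k, H (k + 1) = μ * H k + 16 * ‖D.multiplier (X (k + 1)) - D.multiplier (X k)‖) ∧
      (∀ k, Q (k + 1) = μ * Q k + 4 * H k) ∧
      ∀ k, D.PerturbedStep s (H k + Q k) (Q k) (X k) (X (k + 1)) := by
  -- Twice the multiplier increments at the two ends of a line amount to at most four times the
  -- norm; the gain 4 of the filter turns this into 16.
  set ω : ℕ → ℝ := fun k => 4 * ‖D.multiplier (X (k + 1)) - D.multiplier (X k)‖ with hωdef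
  have hω : ∀ k, 0 ≤ ω k := fun k => by positivity
  let H : ℕ → ℝ := fun k => Nat.rec (2 * ∑ e, |(X 0).yhat e - (X 0).ybrv e|)
    (fun k h => μ * h + 4 * ω k) k
  have hH : ∀ k, H (k + 1) = μ * H k + 4 * ω k := fun k => rfl
  -- `Q` bounds the flow disagreement divided by `s`, since its forcing is `s * (yhat - ybrv)`.
  let Q : ℕ → ℝ := fun k => Nat.rec (2 * (∑ e, |(X 0).phat e - (X 0).pbrv e|) / s)
    (fun k h => μ * h + 4 * H k) k
  have hQ : ∀ k, Q (k + 1) = μ * Q k + 4 * H k := fun k => rfl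
  have hHnn : ∀ k, 0 ≤ H k := fun k => by
    induction k with
    | zero =>
      change 0 ≤ 2 * ∑ e, |(X 0).yhat e - (X 0).ybrv e|
      positivity
    | succ k ih =>
      rw [hH]
      exact add_nonneg (mul_nonneg hμ0.le ih) (by linarith [hω k])
  have hQnn : ∀ k, 0 ≤ Q k := fun k => by
    induction k with
    | zero =>
      change 0 ≤ 2 * (∑ e, |(X 0).phat e - (X 0).pbrv e|) / s
      positivity
    | succ k ih =>
      rw [hQ]
      exact add_nonneg (mul_nonneg hμ0.le ih) (by linarith [hHnn k])
  have hδ : ∀ e k, |(X k).yhat e - (X k).ybrv e| ≤ H k ∧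
      (¬ D.idle Ec e k → D.lastUp Ec e (k - 1) < k ∧ k ≤ D.lastUp Ec e (k - 1) + 2 * B) := by
    intro e k
    refine averaging_bound hc e hμ0 hμ1 hN (d := fun k => (X k).yhat e - (X k).ybrv e)
      (θ := fun _ => 1) (w := fun k =>
        -2 * ((D.multiplier (X (k + 1)) (D.up e) - D.multiplier (X k) (D.up e)) +
        (D.multiplier (X (k + 1)) (D.down e) - D.multiplier (X k) (D.down e)))) hω ?_
        (fun k => (hH k).ge) (fun _ => zero_le_one) (fun _ => le_rfl) (fun k => ?_) (fun k => ?_) k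
    · change _ ≤ 2 * ∑ e, |(X 0).yhat e - (X 0).ybrv e|
      gcongr
      exact Finset.single_le_sum (f := fun e => |(X 0).yhat e - (X 0).ybrv e|)
        (fun _ _ => abs_nonneg _) (Finset.mem_univ e)
    · rw [abs_mul]
      have h1 := norm_le_pi_norm (D.multiplier (X (k + 1)) - D.multiplier (X k)) (D.up e)
      have h2 := norm_le_pi_norm (D.multiplier (X (k + 1)) - D.multiplier (X k)) (D.down e)
      simp only [Pi.sub_apply, Real.norm_eq_abs] at h1 h2
      have h3 := abs_add_le (D.multiplier (X (k + 1)) (D.up e) - D.multiplier (X k) (D.up e))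
        (D.multiplier (X (k + 1)) (D.down e) - D.multiplier (X k) (D.down e))
      have h4 : |(-2 : ℝ)| = 2 := by norm_num
      rw [h4, hωdef]
      linarith
    · rw [hX.yhat_step, hX.ybrv_step]
      ring
  have hE : ∀ k, μ * (s * Q k) + 4 * (s * H k) ≤ s * Q (k + 1) := fun k => by
    rw [hQ]
    exact le_of_eq (by ring)
  have hed : ∀ e k, |(X k).phat e - (X k).pbrv e| ≤ s * Q k := by
    intro e k
    -- Both copies are clipped to the same interval, so the projection appears only as a damping
    -- factor.
    choose θ hθ0 hθ1 hθ using fun k => exists_clip_sub_eq (lo := -D.pmax e) (hi := D.pmax e)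
      ((X k).phat e - D.aUp Ec e k * ((X k).phat e - (X k).pbrv e) - s * (X k).yhat e)
      ((X k).pbrv e
      + D.aDown Ec e k * ((X (D.lastUp Ec e k)).phat e - (X (D.lastUp Ec e k)).pbrv e)
      - s * (X k).ybrv e)
    refine (averaging_bound hc e hμ0 hμ1 hN (d := fun k => (X k).phat e - (X k).pbrv e)
      (E := fun k => s * Q k) (ω := fun k => s * H k) (θ := θ)
      (w := fun k => -(θ k * (s * ((X k).yhat e - (X k).ybrv e))))
      (fun k => mul_nonneg hs.le (hHnn k)) ?_ hE hθ0 hθ1 (fun k => ?_) (fun k => ?_) k).1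
    · change _ ≤ s * (2 * (∑ e, |(X 0).phat e - (X 0).pbrv e|) / s)
      rw [mul_div_cancel₀ _ hs.ne']
      gcongr
      exact Finset.single_le_sum (f := fun e => |(X 0).phat e - (X 0).pbrv e|)
        (fun _ _ => abs_nonneg _) (Finset.mem_univ e)
    · rw [abs_neg, abs_mul, abs_mul, abs_of_nonneg (hθ0 k), abs_of_pos hs]
      exact (mul_le_of_le_one_left (by positivity) (hθ1 k)).trans
        (mul_le_mul_of_nonneg_left (hδ e k).1 hs.le)
    · rw [hX.phat_step, hX.pbrv_step, hθ]
      ring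
  -- Quantities stored at the last upstream averaging are at most `2 * B` steps old, and a filter
  -- cannot lose more than half in that time.
  have hback : ∀ {E ω : ℕ → ℝ}, (∀ k, 0 ≤ ω k) → 0 ≤ E 0 →
      (∀ k, μ * E k + 4 * ω k ≤ E (k + 1)) → ∀ t k, t ≤ k → k ≤ t + 2 * B → E t ≤ 2 * E k := by
    intro E ω h1 h2 h3 t k h4 h5
    have := filter_half_le hμ0 hμ1 hN h1 h2 h3 h4 (by omega)
    have h6 : 0 ≤ ∑ j ∈ Finset.Ico t k, ω j := Finset.sum_nonneg fun j _ => h1 j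
    linarith
  have hσ : ∀ e k, |(X k).yhat e + (X k).ybrv e
      - 2 * (D.multiplier (X k) (D.down e) - D.multiplier (X k) (D.up e))| ≤ H k := by
    intro e k
    rw [hX.tracking_sum]
    split_ifs with hi
    · simpa using hHnn k
    · obtain ⟨h1, h2⟩ := (hδ e k).2 hi
      have h3 := (hδ e (D.lastUp Ec e (k - 1))).1
      have h4 := hback hω (hHnn 0) (fun k => (hH k).ge) _ _ h1.le h2
      rw [abs_div, abs_neg, abs_two]
      linarith
  -- Half the sum plus or minus half the difference of the two tracking variables.
  have hY : ∀ e k, |(X k).yhat e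
      - (D.multiplier (X k) (D.down e) - D.multiplier (X k) (D.up e))| ≤ H k ∧
      |(X k).ybrv e - (D.multiplier (X k) (D.down e) - D.multiplier (X k) (D.up e))| ≤ H k := by
    intro e k
    have h1 := abs_le.1 (hσ e k)
    have h2 := abs_le.1 (hδ e k).1
    constructor <;> rw [abs_le] <;> constructor <;> linarith
  have hlast : ∀ e k, D.downAverages Ec e k → k ≤ D.lastUp Ec e k + 2 * B := by
    intro e k hk
    by_cases hu : D.upAverages Ec e k
    · rw [D.lastUp_eq_self Ec e hu]
      omega
    · rw [D.lastUp_eq_pred Ec e hu]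
      refine ((hδ e k).2 fun hi => ?_).2
      rcases D.protocol_cases Ec e k with h | h | h | h | h <;> tauto
  refine ⟨H, Q, hHnn, hQnn, fun k => ?_, hQ, fun k => ⟨fun i => ?_, fun i => ?_, fun e => hed e k,
    fun e => ?_, fun e => ?_⟩⟩
  · rw [hH, hωdef]
    ring
  · rw [hX.g_succ, gradG_eq _ hf, multiplier]
  · rw [hX.lam_succ, gradLam_eq]
  -- The averaging move, divided by `s`, is counted as part of the gradient; it contributes the
  -- error `Q`.
  · refine ⟨(X k).yhat e + D.aUp Ec e k * ((X k).phat e - (X k).pbrv e) / s, ?_, ?_⟩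
    · have h1 : |D.aUp Ec e k * ((X k).phat e - (X k).pbrv e) / s| ≤ Q k := by
        rw [abs_div, abs_of_pos hs, div_le_iff₀ hs, abs_mul, abs_of_nonneg (aUp_nonneg e k)]
        refine (mul_le_of_le_one_left (abs_nonneg _) ((aUp_le e k).trans (by norm_num))).trans ?_
        rw [mul_comm]
        exact hed e k
      have h2 := abs_le.1 h1
      have h3 := abs_le.1 (hY e k).1
      rw [abs_le]
      constructor <;> linarith
    · rw [hX.phat_step]
      congr 1
      field_simp
      ring
  · refine ⟨(X k).ybrv e - D.aDown Ec e k *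
      ((X (D.lastUp Ec e k)).phat e - (X (D.lastUp Ec e k)).pbrv e) / s, ?_, ?_⟩
    · have h1 : |D.aDown Ec e k *
          ((X (D.lastUp Ec e k)).phat e - (X (D.lastUp Ec e k)).pbrv e) / s| ≤ Q k := by
        by_cases hd : D.downAverages Ec e k
        · have h4 := hback (E := fun k => s * Q k) (ω := fun k => s * H k)
            (fun k => mul_nonneg hs.le (hHnn k)) (mul_nonneg hs.le (hQnn 0)) hE _ _
            (D.lastUp_le Ec e k) (hlast e k hd)
          have h5 := hed e (D.lastUp Ec e k)
          rw [abs_div, abs_of_pos hs, div_le_iff₀ hs, abs_mul, abs_of_nonneg (aDown_nonneg e k)]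
          have h6 := mul_le_mul_of_nonneg_right (aDown_le (Ec := Ec) e k)
            (abs_nonneg ((X (D.lastUp Ec e k)).phat e - (X (D.lastUp Ec e k)).pbrv e))
          linarith
        · rw [aDown, if_neg hd]
          simpa using hQnn k
      have h2 := abs_le.1 h1
      have h3 := abs_le.1 (hY e k).2
      rw [abs_le]
      constructor <;> linarith
    · rw [hX.pbrv_step]
      congr 1
      field_simp
      ring

end IsRun

end Runs

end SCED

/-! ### Error bounds from compactness and piecewise linearity. -/

section ErrorBounds

variable {ι E : Type*} [Fintype ι] [NormedAddCommGroup E] [NormedSpace ℝ E]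
  [FiniteDimensional ℝ E] {lo hi x y : ι → ℝ}

/-- Local error bound for the zero of a piecewise linear residual. -/
theorem exists_norm_le_residual (hx : ∀ i, x i ∈ Set.Icc (lo i) (hi i))
    (hxy : ∀ i, clip (lo i) (hi i) (x i + y i) = x i) (A : E →ₗ[ℝ] (ι → ℝ))
    (hA : ∀ v, (∀ i, clip (lo i) (hi i) (x i + (y i + A v i)) = x i) → v = 0) (R : ℝ) :
    ∃ C : ℝ, 0 ≤ C ∧ ∀ v, ‖v‖ ≤ R →
      ‖v‖ ≤ C * ∑ i, |clip (lo i) (hi i) (x i + (y i + A v i)) - x i| := by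
  classical
  have hAc : Continuous A := A.continuous_of_finiteDimensional
  set F : E → ℝ := fun v => ∑ i, |clip (lo i) (hi i) (x i + (y i + A v i)) - x i| with hF
  have hFc : Continuous F := by
    refine continuous_finsetSum _ fun i _ => ?_
    have h1 : Continuous fun v => A v i := (continuous_apply i).comp hAc
    have h2 := (continuous_clip (lo := lo i) (hi := hi i)).comp
      ((h1.const_add (y i)).const_add (x i))
    exact (h2.sub continuous_const).abs
  have hFpos : ∀ v, v ≠ 0 → 0 < F v := by
    intro v hv
    by_contra! hcon
    have h0 : F v = 0 := le_antisymm hcon (Finset.sum_nonneg fun i _ => abs_nonneg _)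
    rw [hF, Finset.sum_eq_zero_iff_of_nonneg (fun i _ => abs_nonneg _)] at h0
    exact hv (hA v fun i => sub_eq_zero.1 (abs_eq_zero.1 (h0 i (Finset.mem_univ i))))
  -- Near 0 the residual is positively homogeneous, so its minimum on a small sphere yields a linear
  -- bound inside. The rest of the ball of radius `R` is compact, and the residual has a positive
  -- minimum there.
  choose r hr hhom using fun i => exists_clip_homogeneous (hx i) (hxy i)
  obtain ⟨r1, hr1, hr1'⟩ : ∃ r1 > 0, ∀ i, r1 ≤ r i := by
    rcases isEmpty_or_nonempty ι with h | h
    · exact ⟨1, one_pos, fun i => h.elim i⟩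
    · obtain ⟨i, hi⟩ := Finite.exists_min r
      exact ⟨r i, hr i, hi⟩
  obtain ⟨r0, hr0, hr0'⟩ : ∃ r0 > 0, ∀ v, ‖v‖ ≤ r0 → ∀ i, |A v i| ≤ r1 := by
    obtain ⟨r0, h1, h2⟩ := Metric.continuousAt_iff.1 (hAc.continuousAt (x := 0)) r1 hr1
    refine ⟨r0 / 2, by linarith, fun v hv i => ?_⟩
    have h3 := h2 (x := v) (by rw [dist_zero_right]; linarith)
    rw [map_zero, dist_zero_right] at h3
    exact (norm_le_pi_norm (A v) i).trans h3.le
  have hsphere : ∀ v, v ∈ Metric.sphere (0 : E) r0 → 0 < F v := fun v hv => hFpos v fun h0 => by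
    rw [h0] at hv
    simp at hv
    linarith
  have := FiniteDimensional.proper_real E
  obtain ⟨c0, hc0, hc0'⟩ := (isCompact_sphere (0 : E) r0).exists_forall_le' hFc.continuousOn hsphere
  have hann : ∀ v, v ∈ Metric.closedBall (0 : E) R \ Metric.ball 0 r0 → 0 < F v :=
    fun v hv => hFpos v fun h0 => hv.2 (by rw [h0]; exact Metric.mem_ball_self hr0)
  obtain ⟨c1, hc1, hc1'⟩ := ((isCompact_closedBall (0 : E) R).diff
    Metric.isOpen_ball).exists_forall_le' hFc.continuousOn hann
  have hFnn : ∀ v, 0 ≤ F v := fun v => Finset.sum_nonneg fun i _ => abs_nonneg _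
  refine ⟨r0 / c0 + |R| / c1, by positivity, fun v hv => ?_⟩
  change _ ≤ _ * F v
  rw [add_mul]
  rcases le_or_gt ‖v‖ r0 with h | h
  · rcases eq_or_ne v 0 with rfl | hv0
    · rw [norm_zero]
      have := hFnn 0
      positivity
    have hvn : 0 < ‖v‖ := norm_pos_iff.2 hv0
    set u : E := (r0 / ‖v‖) • v with hu
    have hun : ‖u‖ = r0 := by
      rw [hu, norm_smul, Real.norm_of_nonneg (by positivity), div_mul_cancel₀ _ hvn.ne']
    have hvu : v = (‖v‖ / r0) • u := by
      rw [hu, smul_smul, div_mul_div_cancel₀ hr0.ne', div_self hvn.ne', one_smul]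
    have h1 : F v = (‖v‖ / r0) * F u := by
      rw [hF]
      simp only
      rw [Finset.mul_sum]
      refine Finset.sum_congr rfl fun i _ => ?_
      conv_lhs => rw [hvu]
      rw [map_smul, Pi.smul_apply, smul_eq_mul, hhom i _ ((hr0' u hun.le i).trans (hr1' i)) _
        (by positivity) (by rw [div_le_one hr0]; exact h), abs_mul, abs_of_nonneg (by positivity)]
    have h2 := hc0' u (by simp [hun])
    have h3 : ‖v‖ ≤ r0 / c0 * F v := by
      rw [h1]
      calc ‖v‖ = r0 / c0 * (‖v‖ / r0 * c0) := by field_simp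
        _ ≤ _ := by gcongr
    have h4 : 0 ≤ |R| / c1 * F v := mul_nonneg (by positivity) (hFnn v)
    linarith
  · have h2 := hc1' v ⟨by simpa using hv, by simpa using h.le⟩
    have h3 : ‖v‖ ≤ |R| / c1 * F v :=
      calc ‖v‖ ≤ |R| := hv.trans (le_abs_self R)
        _ = |R| / c1 * c1 := by field_simp
        _ ≤ _ := by gcongr
    have h4 : 0 ≤ r0 / c0 * F v := mul_nonneg (by positivity) (hFnn v)
    linarith

/-- Linear growth of the residual gap away from the unit ball. -/
theorem exists_mul_norm_le_gap (hx : ∀ i, x i ∈ Set.Icc (lo i) (hi i))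
    (A : E →ₗ[ℝ] (ι → ℝ))
    (hA : ∀ v, (∀ i, clip (lo i) (hi i) (x i + A v i) = x i) → v = 0) :
    ∃ c : ℝ, 0 < c ∧ ∀ v, 1 ≤ ‖v‖ →
      c * ‖v‖ ≤ ∑ i, |A v i| * |clip (lo i) (hi i) (x i + A v i) - x i| := by
  have hAc : Continuous A := A.continuous_of_finiteDimensional
  set F : E → ℝ := fun v => ∑ i, |A v i| * |clip (lo i) (hi i) (x i + A v i) - x i| with hF
  have hnn : ∀ v i, 0 ≤ |A v i| * |clip (lo i) (hi i) (x i + A v i) - x i| :=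
    fun v i => by positivity
  have hFc : Continuous F := by
    refine continuous_finsetSum _ fun i _ => ?_
    have h1 : Continuous fun v => A v i := (continuous_apply i).comp hAc
    have h2 := (continuous_clip (lo := lo i) (hi := hi i)).comp (h1.const_add (x i))
    exact h1.abs.mul (h2.sub continuous_const).abs
  have hsphere : ∀ v, v ∈ Metric.sphere (0 : E) 1 → 0 < F v := by
    intro v hv
    by_contra! hcon
    have h0 : F v = 0 := le_antisymm hcon (Finset.sum_nonneg fun i _ => hnn v i)
    rw [hF, Finset.sum_eq_zero_iff_of_nonneg (fun i _ => hnn v i)] at h0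
    have : v = 0 := hA v fun i => by
      rcases mul_eq_zero.1 (h0 i (Finset.mem_univ i)) with h | h
      · rw [abs_eq_zero.1 h, add_zero]
        exact clip_of_mem (hx i)
      · exact sub_eq_zero.1 (abs_eq_zero.1 h)
    rw [this] at hv
    simp at hv
  have := FiniteDimensional.proper_real E
  obtain ⟨c, hc, hc'⟩ := (isCompact_sphere (0 : E) 1).exists_forall_le' hFc.continuousOn hsphere
  refine ⟨c, hc, fun v hv => ?_⟩
  have hvn : 0 < ‖v‖ := by linarith
  set u : E := ‖v‖⁻¹ • v with hu
  have hun : ‖u‖ = 1 := by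
    rw [hu, norm_smul, norm_inv, norm_norm, inv_mul_cancel₀ hvn.ne']
  have hvu : v = ‖v‖ • u := by
    rw [hu, smul_smul, mul_inv_cancel₀ hvn.ne', one_smul]
  -- Along a ray outwards from the unit sphere the first factor scales linearly and the displacement
  -- does not shrink.
  have h1 : ‖v‖ * F u ≤ F v := by
    rw [hF]
    simp only
    rw [Finset.mul_sum]
    refine Finset.sum_le_sum fun i _ => ?_
    have h2 : A v i = ‖v‖ * A u i := by
      conv_lhs => rw [hvu]
      rw [map_smul, Pi.smul_apply, smul_eq_mul]
    rw [h2, abs_mul, abs_norm, mul_assoc]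
    have := abs_clip_add_sub_mono (hx i) (A u i) hv
    gcongr
  calc c * ‖v‖ = ‖v‖ * c := mul_comm _ _
    _ ≤ ‖v‖ * F u := by gcongr; exact hc' u (by simp [hun])
    _ ≤ _ := h1

end ErrorBounds

namespace SCED

/-! ### Flows on a tree. -/

section Network

variable {V : Type*} {D : SCED V}

theorem IsRadial.adj (h : D.IsRadial) (e : D.Line) : D.graph.Adj (D.up e) (D.down e) := by
  classical
  rw [graph, SimpleGraph.fromRel_adj]
  exact ⟨h.up_ne_down e, Or.inl e.2⟩

theorem IsRadial.dist_down (h : D.IsRadial) (e : D.Line) :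
    D.graph.dist D.root (D.down e) = D.graph.dist D.root (D.up e) + 1 :=
  h.oriented _ _ e.2

/-- In a radial network no two lines end in the same bus. -/
theorem IsRadial.down_injective (h : D.IsRadial) : Function.Injective D.down := by
  classical
  intro e e' hee
  obtain ⟨p, hp, -⟩ := h.isTree.existsUnique_path D.root (D.down e)
  -- A shortest path to `up e'` avoids the bus `down e'`, which is farther from the root. In a tree
  -- `up e'` then lies on the root path of that bus, as its last but one vertex.
  have key : ∀ e' : D.Line, D.down e' = D.down e → D.up e' = p.penultimate := by
    intro e' he'
    have hadj : D.graph.Adj (D.down e) (D.up e') := he' ▸ (h.adj e').symm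
    refine h.isTree.isAcyclic.eq_penultimate_of_adj_end hp hadj ?_
    obtain ⟨q, hq⟩ := h.isTree.connected.exists_walk_length_eq_dist D.root (D.up e')
    refine h.isTree.isAcyclic.mem_support_of_ne_mem_support_of_adj_of_isPath hp
      (q.isPath_of_length_eq_dist hq) hadj fun hmem => ?_
    have h1 := SimpleGraph.dist_le (q.takeUntil _ hmem)
    have h2 := q.length_takeUntil_le_length hmem
    have h3 := h.dist_down e'
    rw [he'] at h3
    omega
  exact Subtype.ext (Prod.ext ((key e rfl).trans (key e' hee.symm).symm) hee)

variable [DecidableEq V]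

/-- Consider a loaded line whose downstream end is farthest from the root. No loaded line leaves
that bus and no other line enters it, so its balance fails. -/
theorem IsRadial.div_eq_zero [Finite V] (h : D.IsRadial) {w : D.Line → ℝ} (hw : ∀ i, D.div w i = 0)
    (e : D.Line) : w e = 0 := by
  by_contra hne
  obtain ⟨e0, he0, hmax⟩ := Set.exists_max_image {e | w e ≠ 0}
    (fun e => D.graph.dist D.root (D.down e)) (Set.toFinite _) ⟨e, hne⟩
  have h1 := hw (D.down e0)
  rw [div, Finset.sum_eq_zero, zero_sub, neg_eq_zero, Finset.sum_eq_single e0] at h1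
  · rw [if_pos rfl] at h1
    exact he0 h1
  · intro e' _ hne'
    rw [if_neg fun h' => hne' (h.down_injective h')]
  · simp
  · intro e' _
    split_ifs with h'
    · by_contra hne'
      have h2 := hmax e' hne'
      have h3 := h.dist_down e'
      rw [h'] at h3
      omega
    · rfl

/-- The net outflow as a linear map. -/
def divLinear (D : SCED V) : (D.Line → ℝ) →ₗ[ℝ] (V → ℝ) where
  toFun := D.div
  map_add' v w := by
    funext i
    have := div_sub v (fun e => -w e) i
    have h2 := div_sub (fun _ => 0) w i
    have h3 : D.div (fun _ => (0 : ℝ)) i = 0 := by simp [div]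
    simp only [sub_neg_eq_add, zero_sub] at this h2
    rw [Pi.add_apply]
    change D.div (fun e => v e + w e) i = _
    linarith
  map_smul' c w := by
    funext i
    simp only [div, Pi.smul_apply, smul_eq_mul, RingHom.id_apply, mul_sub, Finset.mul_sum, mul_ite,
      mul_zero]

theorem IsRadial.exists_norm_le_div [Fintype V] (h : D.IsRadial) :
    ∃ C : ℝ, 0 ≤ C ∧ ∀ w : D.Line → ℝ, ‖w‖ ≤ C * ‖D.div w‖ := by
  obtain ⟨K, -, hK⟩ := D.divLinear.exists_antilipschitzWith (by
    rw [LinearMap.ker_eq_bot']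
    intro w hw
    exact funext fun e => h.div_eq_zero (fun i => congrFun hw i) e)
  refine ⟨K, K.2, fun w => ?_⟩
  have := hK.le_mul_dist w 0
  rwa [map_zero, dist_zero_right, dist_zero_right] at this

end Network

/-! ### Uniqueness of the multipliers in quantitative form. -/

section Dual

variable {V : Type*} [Fintype V] [DecidableEq V] {D : SCED V}

/-- The primal direction associated with a multiplier. -/
def dualMap (D : SCED V) : (V → ℝ) →ₗ[ℝ] (V ⊕ D.Line → ℝ) where
  toFun v := Sum.elim (fun i => -v i) (fun e => v (D.up e) - v (D.down e))
  map_add' v w := by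
    funext i
    rcases i with i | e <;> simp <;> ring
  map_smul' c w := by
    funext i
    rcases i with i | e <;> simp
    ring

/-- The primal part of the equilibrium with multiplier λ* + v satisfies the optimality conditions,
so uniqueness of the equilibrium applies. -/
theorem Optimal.dualMap_injective (h : D.IsRadial) (hf : ∀ i, Differentiable ℝ (D.f i))
    {u : D.Triple} (hu : D.Optimal u) (hunique : ∀ u', D.IsEquilibrium u' → u' = u) (v : V → ℝ)
    (hg : ∀ i, clip (D.gmin i) (D.gmax i)
      (u.g i + (-(deriv (D.f i) (u.g i) + u.lam i) + -v i)) = u.g i)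
    (hp : ∀ e, clip (-D.pmax e) (D.pmax e)
      (u.p e + ((u.lam (D.up e) - u.lam (D.down e)) + (v (D.up e) - v (D.down e)))) = u.p e) :
    v = 0 := by
  have : (⟨u.g, u.p, u.lam + v⟩ : D.Triple) = u := by
    refine hunique _ (Optimal.isEquilibrium h hf ⟨hu.balance, hu.g_mem, hu.p_mem, fun i => ?_,
      fun e => ?_⟩)
    · convert hg i using 2
      simp only [Pi.add_apply]
      ring
    · convert hp e using 2
      simp only [Pi.add_apply]
      ring
  have := congrArg Triple.lam this
  simpa using this

theorem Optimal.exists_norm_le_residual (h : D.IsRadial) (hf : ∀ i, Differentiable ℝ (D.f i))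
    {u : D.Triple} (hu : D.Optimal u) (hunique : ∀ u', D.IsEquilibrium u' → u' = u) (R : ℝ) :
    ∃ C : ℝ, 0 ≤ C ∧ ∀ v : V → ℝ, ‖v‖ ≤ R → ∀ r : ℝ,
      (∀ i, |clip (D.gmin i) (D.gmax i)
        (u.g i + (-(deriv (D.f i) (u.g i) + u.lam i) + -v i)) - u.g i| ≤ r) →
      (∀ e, |clip (-D.pmax e) (D.pmax e) (u.p e + ((u.lam (D.up e) - u.lam (D.down e))
        + (v (D.up e) - v (D.down e)))) - u.p e| ≤ r) → ‖v‖ ≤ C * r := by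
  obtain ⟨C, hC, hC'⟩ := _root_.exists_norm_le_residual
    (lo := Sum.elim D.gmin fun e => -D.pmax e) (hi := Sum.elim D.gmax D.pmax)
    (x := Sum.elim u.g u.p) (y := Sum.elim (fun i => -(deriv (D.f i) (u.g i) + u.lam i))
      (fun e => u.lam (D.up e) - u.lam (D.down e)))
    (by rintro (i | e); exacts [hu.g_mem i, hu.p_mem e])
    (by rintro (i | e); exacts [hu.g_fixed i, hu.p_fixed e]) D.dualMap
    (fun v hv => hu.dualMap_injective h hf hunique v (fun i => hv (Sum.inl i))
      (fun e => hv (Sum.inr e))) R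
  refine ⟨C * Fintype.card (V ⊕ D.Line), by positivity, fun v hv r h1 h2 => ?_⟩
  refine (hC' v hv).trans ?_
  rw [mul_assoc]
  gcongr
  rw [← nsmul_eq_mul, ← Finset.card_univ]
  refine Finset.sum_le_card_nsmul _ _ _ fun i _ => ?_
  rcases i with i | e
  exacts [h1 i, h2 e]

/-- The left side is the pairing of `v` with the imbalance of the profile that a deviation `v` of
the multipliers favours. Its negativity is the drift in the far regime. -/
theorem Optimal.exists_mul_norm_le_gap (h : D.IsRadial) (hf : ∀ i, Differentiable ℝ (D.f i))
    {u : D.Triple} (hu : D.Optimal u) (hunique : ∀ u', D.IsEquilibrium u' → u' = u) :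
    ∃ c : ℝ, 0 < c ∧ ∀ v : V → ℝ,
      ∑ i, v i * (clip (D.gmin i) (D.gmax i) (u.g i + -v i) - u.g i)
      - ∑ e : D.Line, (v (D.up e) - v (D.down e)) *
        (clip (-D.pmax e) (D.pmax e) (u.p e + (v (D.up e) - v (D.down e))) - u.p e)
      ≤ c - c * ‖v‖ := by
  obtain ⟨c, hc, hc'⟩ := _root_.exists_mul_norm_le_gap
    (lo := Sum.elim D.gmin fun e => -D.pmax e) (hi := Sum.elim D.gmax D.pmax)
    (x := Sum.elim u.g u.p) (by rintro (i | e); exacts [hu.g_mem i, hu.p_mem e]) D.dualMap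
    (fun v hv => hu.dualMap_injective h hf hunique v
      (fun i => clip_add_add_eq (hu.g_mem i) (hu.g_fixed i) (hv (Sum.inl i)))
      (fun e => clip_add_add_eq (hu.p_mem e) (hu.p_fixed e) (hv (Sum.inr e))))
  refine ⟨c, hc, fun v => ?_⟩
  have h2 : ∀ i, v i * (clip (D.gmin i) (D.gmax i) (u.g i + -v i) - u.g i)
      = -(|-v i| * |clip (D.gmin i) (D.gmax i) (u.g i + -v i) - u.g i|) := fun i => by
    rw [← mul_clip_add_sub_eq (hu.g_mem i)]
    ring
  have h3 := fun e : D.Line => mul_clip_add_sub_eq (hu.p_mem e) (v (D.up e) - v (D.down e))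
  simp only [h2, h3, Finset.sum_neg_distrib]
  -- The additive `c` covers the unit ball, where only the sign of the left side is known.
  rcases le_or_gt 1 ‖v‖ with hv | hv
  · have h1 := hc' v hv
    rw [Fintype.sum_sum_type] at h1
    simp only [Sum.elim_inl, Sum.elim_inr, dualMap, LinearMap.coe_mk, AddHom.coe_mk] at h1
    linarith
  · have h4 : 0 ≤ ∑ i, |-v i| * |clip (D.gmin i) (D.gmax i) (u.g i + -v i) - u.g i| :=
      Finset.sum_nonneg fun i _ => by positivity
    have h5 : 0 ≤ ∑ e : D.Line, |v (D.up e) - v (D.down e)| * |clip (-D.pmax e) (D.pmax e)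
        (u.p e + (v (D.up e) - v (D.down e))) - u.p e| :=
      Finset.sum_nonneg fun e _ => by positivity
    nlinarith

end Dual

/-! ### Convexity of the costs. -/

section Costs

variable {V : Type*} {D : SCED V} {m : ℝ}

theorem CostAssumption.strongly_monotone (hc : D.CostAssumption m) (i : V) {x y : ℝ}
    (hx : x ∈ Set.Icc (D.gmin i) (D.gmax i)) (hy : y ∈ Set.Icc (D.gmin i) (D.gmax i)) :
    m * (x - y) ^ 2 ≤ (deriv (D.f i) x - deriv (D.f i) y) * (x - y) := by
  have key : ∀ {x y : ℝ}, x ∈ Set.Icc (D.gmin i) (D.gmax i) → y ∈ Set.Icc (D.gmin i) (D.gmax i) →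
      x ≤ y → m * (y - x) ≤ deriv (D.f i) y - deriv (D.f i) x := fun {x y} hx hy hxy =>
    (convex_Icc _ _).mul_sub_le_image_sub_of_le_deriv (hc i).2.1.continuous.continuousOn
      (hc i).2.1.differentiableOn (fun z hz => (hc i).2.2 z (interior_subset hz)) x hx y hy hxy
  rcases le_total x y with h | h
  · nlinarith [key hx hy h]
  · nlinarith [key hy hx h]

theorem CostAssumption.sub_le (hc : D.CostAssumption m) (hm : 0 ≤ m) (i : V) {x y : ℝ}
    (hx : x ∈ Set.Icc (D.gmin i) (D.gmax i)) (hy : y ∈ Set.Icc (D.gmin i) (D.gmax i)) :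
    D.f i y - D.f i x ≤ deriv (D.f i) y * (y - x) := by
  have mono : MonotoneOn (deriv (D.f i)) (Set.Icc (D.gmin i) (D.gmax i)) := by
    intro x hx y hy hxy
    rcases hxy.eq_or_lt with rfl | h
    · exact le_rfl
    · by_contra! hlt
      have := hc.strongly_monotone i hx hy
      nlinarith [mul_nonneg hm (sq_nonneg (x - y)),
        mul_pos (sub_pos.2 hlt) (sub_pos.2 h)]
  rcases lt_trichotomy x y with h | rfl | h
  · obtain ⟨z, hz, hz'⟩ := exists_deriv_eq_slope (D.f i) h (hc i).1.continuous.continuousOn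
      (hc i).1.differentiableOn
    have h1 := mono ⟨hx.1.trans hz.1.le, hz.2.le.trans hy.2⟩ hy hz.2.le
    rw [hz', div_le_iff₀ (sub_pos.2 h)] at h1
    exact h1
  · simp
  · obtain ⟨z, hz, hz'⟩ := exists_deriv_eq_slope (D.f i) h (hc i).1.continuous.continuousOn
      (hc i).1.differentiableOn
    have h1 := mono hy ⟨hy.1.trans hz.1.le, hz.2.le.trans hx.2⟩ hz.1.le
    rw [hz', le_div_iff₀ (sub_pos.2 h)] at h1
    linarith

/-- The second derivative may be unbounded, so the derivative need not be Lipschitz on the interval.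
Its slope from one fixed point is continuous, hence bounded on a compact interval. -/
theorem CostAssumption.exists_abs_deriv_sub_le [Finite V] (hc : D.CostAssumption m) (g : V → ℝ) :
    ∃ C : ℝ, 0 ≤ C ∧ ∀ i, ∀ x ∈ Set.Icc (D.gmin i) (D.gmax i),
      |deriv (D.f i) x - deriv (D.f i) (g i)| ≤ C * |x - g i| := by
  have h1 : ∀ i, ∃ C : ℝ, 0 ≤ C ∧ ∀ x ∈ Set.Icc (D.gmin i) (D.gmax i),
      |deriv (D.f i) x - deriv (D.f i) (g i)| ≤ C * |x - g i| := by
    intro i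
    have h2 : ContinuousOn (dslope (deriv (D.f i)) (g i)) Set.univ :=
      (continuousOn_dslope univ_mem).2 ⟨(hc i).2.1.continuous.continuousOn, (hc i).2.1 _⟩
    obtain ⟨C, hC⟩ := isCompact_Icc.exists_bound_of_continuousOn
      (h2.mono (Set.subset_univ (Set.Icc (D.gmin i) (D.gmax i))))
    refine ⟨|C|, abs_nonneg _, fun x hx => ?_⟩
    have h3 := sub_smul_dslope (deriv (D.f i)) (g i) x
    rw [← h3, smul_eq_mul, abs_mul, mul_comm]
    exact mul_le_mul_of_nonneg_right ((hC x hx).trans (le_abs_self C)) (abs_nonneg _)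
  choose C hC0 hC using h1
  have := Fintype.ofFinite V
  refine ⟨∑ i, C i, Finset.sum_nonneg fun i _ => hC0 i, fun i x hx => (hC i x hx).trans ?_⟩
  gcongr
  exact Finset.single_le_sum (fun i _ => hC0 i) (Finset.mem_univ i)

end Costs

end SCED

/-! ### Sums against the maximum norm. -/

section Sums

variable {ι : Type*} [Fintype ι]

theorem abs_sum_mul_le {v w : ι → ℝ} {a b : ℝ} (hv : ∀ i, |v i| ≤ a) (hw : ∀ i, |w i| ≤ b) :
    |∑ i, v i * w i| ≤ Fintype.card ι * (a * b) := by
  refine (Finset.abs_sum_le_sum_abs _ _).trans ?_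
  rw [← nsmul_eq_mul, ← Finset.card_univ]
  refine Finset.sum_le_card_nsmul _ _ _ fun i _ => ?_
  rw [abs_mul]
  exact mul_le_mul (hv i) (hw i) (abs_nonneg _) ((abs_nonneg _).trans (hv i))

theorem norm_sq_le_sum (v : ι → ℝ) : ‖v‖ ^ 2 ≤ ∑ i, v i ^ 2 := by
  have h0 : 0 ≤ ∑ i, v i ^ 2 := Finset.sum_nonneg fun i _ => sq_nonneg _
  refine Real.le_sqrt (norm_nonneg _) h0 |>.1 ?_
  refine (pi_norm_le_iff_of_nonneg (Real.sqrt_nonneg _)).2 fun i => ?_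
  rw [Real.norm_eq_abs]
  refine Real.abs_le_sqrt ?_
  exact Finset.single_le_sum (f := fun i => v i ^ 2) (fun i _ => sq_nonneg _) (Finset.mem_univ i)

theorem sum_sq_le_norm_sq {v : ι → ℝ} {a : ℝ} (hv : ∀ i, |v i| ≤ a) :
    ∑ i, v i ^ 2 ≤ Fintype.card ι * a ^ 2 := by
  rw [← nsmul_eq_mul, ← Finset.card_univ]
  refine Finset.sum_le_card_nsmul _ _ _ fun i _ => ?_
  rw [← sq_abs]
  exact pow_le_pow_left₀ (abs_nonneg _) (hv i) 2

end Sums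

namespace SCED

/-! ### Elementary estimates for one perturbed step. -/

section Step

variable {V : Type*} {D : SCED V}

/-- The generations and both copies of the line flows respect their bounds. -/
structure InBox (D : SCED V) (x : D.Iterate) : Prop where
  g_mem : ∀ i, x.g i ∈ Set.Icc (D.gmin i) (D.gmax i)
  phat_mem : ∀ e, x.phat e ∈ Set.Icc (-D.pmax e) (D.pmax e)
  pbrv_mem : ∀ e, x.pbrv e ∈ Set.Icc (-D.pmax e) (D.pmax e)

/-- The mean of the two copies of the line flows. -/
noncomputable def meanFlow (D : SCED V) (x : D.Iterate) (e : D.Line) : ℝ := (x.phat e + x.pbrv e) / 2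

variable [DecidableEq V]

/-- The power imbalance computed with the mean line flows. -/
noncomputable def meanImbalance (D : SCED V) (x : D.Iterate) (i : V) : ℝ :=
  x.g i - D.l i - D.div (D.meanFlow x) i

theorem localImbalance_sub_meanImbalance (x : D.Iterate) (i : V) :
    D.localImbalance i x - D.meanImbalance x i =
      -((∑ e : D.Line, if D.up e = i then (x.phat e - x.pbrv e) / 2 else 0)
      + ∑ e : D.Line, if D.down e = i then (x.phat e - x.pbrv e) / 2 else 0) := by
  simp only [localImbalance, meanImbalance, div, meanFlow]
  have h1 : (∑ e : D.Line, if D.up e = i then x.phat e else 0)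
      = (∑ e : D.Line, if D.up e = i then (x.phat e + x.pbrv e) / 2 else 0)
      + ∑ e : D.Line, if D.up e = i then (x.phat e - x.pbrv e) / 2 else 0 := by
    rw [← Finset.sum_add_distrib]
    refine Finset.sum_congr rfl fun e _ => ?_
    split_ifs <;> ring
  have h2 : (∑ e : D.Line, if D.down e = i then x.pbrv e else 0)
      = (∑ e : D.Line, if D.down e = i then (x.phat e + x.pbrv e) / 2 else 0)
      - ∑ e : D.Line, if D.down e = i then (x.phat e - x.pbrv e) / 2 else 0 := by
    rw [← Finset.sum_sub_distrib]
    refine Finset.sum_congr rfl fun e _ => ?_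
    split_ifs <;> ring
  rw [h1, h2]
  ring

theorem abs_localImbalance_sub_le {x : D.Iterate} {r : ℝ} (hr : 0 ≤ r)
    (hx : ∀ e, |x.phat e - x.pbrv e| ≤ r) (i : V) :
    |D.localImbalance i x - D.meanImbalance x i| ≤ Fintype.card D.Line * r := by
  have h : ∀ e, |(x.phat e - x.pbrv e) / 2| ≤ r / 2 := fun e => by
    rw [abs_div, abs_two]
    linarith [hx e]
  rw [localImbalance_sub_meanImbalance, abs_neg]
  refine (abs_add_le _ _).trans ?_
  have h1 := abs_sum_ite_le (h := D.up) (i := i) (by linarith : 0 ≤ r / 2) h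
  have h2 := abs_sum_ite_le (h := D.down) (i := i) (by linarith : 0 ≤ r / 2) h
  linarith

/-- The largest change of a primal variable in a step from `x` to `x'`. -/
noncomputable def stepSize [Fintype V] (D : SCED V) (x x' : D.Iterate) : ℝ :=
  max ‖x'.g - x.g‖ (max ‖x'.phat - x.phat‖ ‖x'.pbrv - x.pbrv‖)

section StepSize

variable [Fintype V] (x x' : D.Iterate)

theorem stepSize_nonneg : 0 ≤ D.stepSize x x' := (norm_nonneg _).trans (le_max_left _ _)

theorem abs_g_sub_le (i : V) : |x'.g i - x.g i| ≤ D.stepSize x x' :=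
  (norm_le_pi_norm (x'.g - x.g) i).trans (le_max_left _ _)

theorem abs_phat_sub_le (e : D.Line) : |x'.phat e - x.phat e| ≤ D.stepSize x x' :=
  (norm_le_pi_norm (x'.phat - x.phat) e).trans ((le_max_left _ _).trans (le_max_right _ _))

theorem abs_pbrv_sub_le (e : D.Line) : |x'.pbrv e - x.pbrv e| ≤ D.stepSize x x' :=
  (norm_le_pi_norm (x'.pbrv - x.pbrv) e).trans ((le_max_right _ _).trans (le_max_right _ _))

theorem abs_meanFlow_sub_le (e : D.Line) :
    |D.meanFlow x' e - D.meanFlow x e| ≤ D.stepSize x x' := by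
  have h1 := abs_le.1 (abs_phat_sub_le x x' e)
  have h2 := abs_le.1 (abs_pbrv_sub_le x x' e)
  unfold meanFlow
  rw [abs_le]
  constructor <;> linarith

theorem abs_meanImbalance_sub_le (i : V) :
    |D.meanImbalance x' i - D.meanImbalance x i|
      ≤ (1 + 2 * Fintype.card D.Line) * D.stepSize x x' := by
  have h1 := abs_g_sub_le x x' i
  have h2 := abs_div_le (i := i) (stepSize_nonneg x x') (abs_meanFlow_sub_le x x')
  rw [div_sub] at h2
  unfold meanImbalance
  have h3 : x'.g i - D.l i - D.div (D.meanFlow x') i - (x.g i - D.l i - D.div (D.meanFlow x) i)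
      = (x'.g i - x.g i) - (D.div (D.meanFlow x') i - D.div (D.meanFlow x) i) := by ring
  rw [h3]
  refine (abs_sub _ _).trans ?_
  linarith

theorem abs_localImbalance_step_le (i : V) :
    |D.localImbalance i x' - D.localImbalance i x|
      ≤ (1 + 2 * Fintype.card D.Line) * D.stepSize x x' := by
  have h1 := abs_g_sub_le x x' i
  have h2 := abs_sum_ite_le (h := D.up) (i := i) (stepSize_nonneg x x') (abs_phat_sub_le x x')
  have h3 := abs_sum_ite_le (h := D.down) (i := i) (stepSize_nonneg x x') (abs_pbrv_sub_le x x')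
  have h4 : ∀ (h : D.Line → V) (v w : D.Line → ℝ), (∑ e : D.Line, if h e = i then v e - w e else 0)
      = (∑ e : D.Line, if h e = i then v e else 0) - ∑ e : D.Line, if h e = i then w e else 0 := by
    intro h v w
    rw [← Finset.sum_sub_distrib]
    refine Finset.sum_congr rfl fun e _ => ?_
    split_ifs <;> simp
  rw [h4] at h2 h3
  rw [abs_le] at *
  unfold localImbalance
  constructor <;> linarith

/-- Half of the squared step size is at most the squared Euclidean length of the step. -/
theorem stepSize_sq_le : D.stepSize x x' ^ 2 / 2 ≤ ∑ i, (x'.g i - x.g i) ^ 2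
    + (∑ e, ((x'.phat e - x.phat e) ^ 2 + (x'.pbrv e - x.pbrv e) ^ 2)) / 2 := by
  have h1 := norm_sq_le_sum (x'.g - x.g)
  have h2 := norm_sq_le_sum (x'.phat - x.phat)
  have h3 := norm_sq_le_sum (x'.pbrv - x.pbrv)
  have h4 := sq_nonneg ‖x'.g - x.g‖
  have h5 := sq_nonneg ‖x'.phat - x.phat‖
  have h6 := sq_nonneg ‖x'.pbrv - x.pbrv‖
  simp only [Pi.sub_apply] at h1 h2 h3
  rw [Finset.sum_add_distrib]
  unfold stepSize
  rcases max_cases ‖x'.phat - x.phat‖ ‖x'.pbrv - x.pbrv‖ with ⟨h, -⟩ | ⟨h, -⟩ <;> rw [h]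
  · rcases max_cases ‖x'.g - x.g‖ ‖x'.phat - x.phat‖ with ⟨h, -⟩ | ⟨h, -⟩ <;> rw [h] <;> linarith
  · rcases max_cases ‖x'.g - x.g‖ ‖x'.pbrv - x.pbrv‖ with ⟨h, -⟩ | ⟨h, -⟩ <;> rw [h] <;> linarith

end StepSize

variable [Fintype V]

/-- Squared distance of the primal variables to the point `(a, w)`, the two copies of the line
flows being counted with weight one half. -/
noncomputable def primalDist (D : SCED V) (a : V → ℝ) (w : D.Line → ℝ) (x : D.Iterate) : ℝ :=
  ∑ i, (x.g i - a i) ^ 2 + (∑ e, ((x.phat e - w e) ^ 2 + (x.pbrv e - w e) ^ 2)) / 2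

/-- Summation by parts: a potential on the buses acts on generations and line flows together through
the imbalance alone. -/
theorem sum_multiplier_mul (c a : V → ℝ) (w : D.Line → ℝ) (x : D.Iterate) :
    ∑ i, c i * (x.g i - a i) - ∑ e : D.Line, (c (D.up e) - c (D.down e)) * (D.meanFlow x e - w e)
      = ∑ i, c i * (D.meanImbalance x i - (a i - D.l i - D.div w i)) := by
  rw [← sum_mul_div c (fun e => D.meanFlow x e - w e), ← Finset.sum_sub_distrib]
  refine Finset.sum_congr rfl fun i _ => ?_
  rw [div_sub, meanImbalance]
  ring

theorem clip_step_sq_le {lo hi x x' a F : ℝ} (ha : a ∈ Set.Icc lo hi) (hx : x' = clip lo hi (x - F)) :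
    (x' - a) ^ 2 ≤ (x - a) ^ 2 - (x' - x) ^ 2 - 2 * (F * (x' - a)) := by
  have := clip_proj ha (x - F)
  rw [← hx] at this
  nlinarith

/-- The basic inequality for a projected step, relative to an arbitrary feasible point. -/
theorem PerturbedStep.primalDist_le {s h Q : ℝ} {x x' : D.Iterate} (hst : D.PerturbedStep s h Q x x')
    (hs : 0 ≤ s) {a : V → ℝ} {w : D.Line → ℝ} (ha : ∀ i, a i ∈ Set.Icc (D.gmin i) (D.gmax i))
    (hw : ∀ e, w e ∈ Set.Icc (-D.pmax e) (D.pmax e)) :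
    D.primalDist a w x' ≤ D.primalDist a w x
      - 2 * s * ∑ i, deriv (D.f i) (x.g i) * (x'.g i - a i)
      - 2 * s * ∑ i, D.multiplier x i * (D.meanImbalance x' i - (a i - D.l i - D.div w i))
      + s * ∑ e, h * (|x'.phat e - w e| + |x'.pbrv e - w e|) := by
  rw [← sum_multiplier_mul]
  have hg : ∀ i, (x'.g i - a i) ^ 2 ≤ (x.g i - a i) ^ 2
      - 2 * s * (deriv (D.f i) (x.g i) * (x'.g i - a i))
      - 2 * s * (D.multiplier x i * (x'.g i - a i)) := fun i => by
    have := clip_step_sq_le (ha i) (hst.g_step i)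
    nlinarith [sq_nonneg (x'.g i - x.g i)]
  have hgen : ∀ {e : D.Line} {p p' y : ℝ},
      |y - (D.multiplier x (D.down e) - D.multiplier x (D.up e))| ≤ h →
      p' = clip (-D.pmax e) (D.pmax e) (p - s * y) →
      (p' - w e) ^ 2 ≤ (p - w e) ^ 2
        + 2 * s * ((D.multiplier x (D.up e) - D.multiplier x (D.down e)) * (p' - w e))
        + 2 * s * (h * |p' - w e|) := by
    intro e p p' y hy hp
    have h1 := clip_step_sq_le (hw e) hp
    have h2 : -((y - (D.multiplier x (D.down e) - D.multiplier x (D.up e))) * (p' - w e))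
        ≤ h * |p' - w e| := by
      refine (neg_le_abs _).trans ?_
      rw [abs_mul]
      gcongr
    nlinarith [sq_nonneg (p' - p), mul_le_mul_of_nonneg_left h2 hs]
  -- Both copies see the same gradient up to `h`, so adding them leaves the mean flow; the weight
  -- one half in `primalDist` restores the factor `2 * s`.
  have hp : ∀ e, (x'.phat e - w e) ^ 2 + (x'.pbrv e - w e) ^ 2 ≤
      (x.phat e - w e) ^ 2 + (x.pbrv e - w e) ^ 2
      + 4 * s * ((D.multiplier x (D.up e) - D.multiplier x (D.down e)) * (D.meanFlow x' e - w e))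
      + 2 * s * (h * (|x'.phat e - w e| + |x'.pbrv e - w e|)) := fun e => by
    obtain ⟨y, hy, hy'⟩ := hst.phat_step e
    obtain ⟨z, hz, hz'⟩ := hst.pbrv_step e
    have h1 := hgen hy hy'
    have h2 := hgen hz hz'
    unfold meanFlow
    linarith
  have hg' := Finset.sum_le_sum fun i (_ : i ∈ Finset.univ) => hg i
  have hp' := Finset.sum_le_sum fun e (_ : e ∈ Finset.univ) => hp e
  simp only [Finset.sum_sub_distrib, Finset.sum_add_distrib, ← Finset.mul_sum] at hg' hp'
  simp only [primalDist, Finset.sum_add_distrib, ← Finset.mul_sum]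
  linarith

end Step

end SCED

namespace SCED

/-! ### One step measured against the equilibrium. -/

section Near

variable {V : Type*} [Fintype V] [DecidableEq V] {D : SCED V} {u : D.Triple} {m : ℝ}

/-- The vector of local power imbalances. -/
noncomputable def imbalance (D : SCED V) (x : D.Iterate) (i : V) : ℝ := D.localImbalance i x

/-- The distance of the two copies of the line flows from the equilibrium flows. -/
noncomputable def flowDist (u : D.Triple) (x : D.Iterate) : ℝ :=
  max ‖x.phat - u.p‖ ‖x.pbrv - u.p‖

/-- The squared distance to the equilibrium. -/
noncomputable def energy (u : D.Triple) (x : D.Iterate) : ℝ :=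
  D.primalDist u.g u.p x + ∑ i, (x.lam i - u.lam i) ^ 2

/-- The augmented Lagrangian, computed with the mean line flows. -/
noncomputable def potential (D : SCED V) (x : D.Iterate) : ℝ :=
  ∑ i, D.f i (x.g i)
    + ∑ i, (x.lam i * D.meanImbalance x i + D.ρ / 2 * D.meanImbalance x i ^ 2)

/-- The derivative of the Lagrangian at the equilibrium in the direction of `x`. -/
noncomputable def slack (u : D.Triple) (x : D.Iterate) : ℝ :=
  ∑ i, deriv (D.f i) (u.g i) * (x.g i - u.g i) + ∑ i, u.lam i * D.meanImbalance x i

theorem flowDist_nonneg (x : D.Iterate) : 0 ≤ flowDist u x :=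
  (norm_nonneg _).trans (le_max_left _ _)

theorem abs_phat_sub_le_flowDist (x : D.Iterate) (e : D.Line) :
    |x.phat e - u.p e| ≤ flowDist u x :=
  (norm_le_pi_norm (x.phat - u.p) e).trans (le_max_left _ _)

theorem abs_pbrv_sub_le_flowDist (x : D.Iterate) (e : D.Line) :
    |x.pbrv e - u.p e| ≤ flowDist u x :=
  (norm_le_pi_norm (x.pbrv - u.p) e).trans (le_max_right _ _)

theorem abs_meanFlow_sub_le_flowDist (x : D.Iterate) (e : D.Line) :
    |D.meanFlow x e - u.p e| ≤ flowDist u x := by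
  have h1 := abs_le.1 (abs_phat_sub_le_flowDist (u := u) x e)
  have h2 := abs_le.1 (abs_pbrv_sub_le_flowDist (u := u) x e)
  unfold meanFlow
  rw [abs_le]
  constructor <;> linarith

theorem Optimal.meanImbalance_eq (hu : D.Optimal u) (x : D.Iterate) (i : V) :
    D.meanImbalance x i = (x.g i - u.g i) - D.div (fun e => D.meanFlow x e - u.p e) i := by
  rw [div_sub, meanImbalance]
  linarith [hu.balance i]

theorem Optimal.abs_meanImbalance_le (hu : D.Optimal u) (x : D.Iterate) (i : V) :
    |D.meanImbalance x i| ≤ (1 + 2 * Fintype.card D.Line) * (‖x.g - u.g‖ + flowDist u x) := by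
  rw [hu.meanImbalance_eq]
  have h1 := norm_le_pi_norm (x.g - u.g) i
  have h2 := abs_div_le (i := i) (flowDist_nonneg x) (abs_meanFlow_sub_le_flowDist (u := u) x)
  rw [Pi.sub_apply, Real.norm_eq_abs] at h1
  have h3 := norm_nonneg (x.g - u.g)
  have h4 := flowDist_nonneg (u := u) x
  refine (abs_sub _ _).trans ?_
  have h5 : (0 : ℝ) ≤ Fintype.card D.Line := by positivity
  nlinarith [mul_nonneg h5 h3]

/-- The imbalances after a step are close to the local imbalances before the step. -/
theorem PerturbedStep.abs_meanImbalance_sub_le {s h Q : ℝ} {x x' : D.Iterate}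
    (hst : D.PerturbedStep s h Q x x') (hs : 0 ≤ s) (hQ : 0 ≤ Q) (i : V) :
    |D.meanImbalance x' i - D.localImbalance i x|
      ≤ (1 + 2 * Fintype.card D.Line) * (D.stepSize x x' + s * Q) := by
  have h1 := SCED.abs_meanImbalance_sub_le x x' i
  have h2 := abs_localImbalance_sub_le (mul_nonneg hs hQ) hst.disagreement i
  have h5 : (0 : ℝ) ≤ Fintype.card D.Line := by positivity
  have h6 : 0 ≤ s * Q := mul_nonneg hs hQ
  rw [abs_le] at *
  constructor <;> nlinarith [mul_nonneg h5 h6]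

/-- First-order optimality of the equilibrium, tested against a feasible point. -/
theorem Optimal.slack_nonneg (hu : D.Optimal u) {x : D.Iterate} (hx : D.InBox x) :
    0 ≤ slack u x := by
  have h1 := sum_multiplier_mul u.lam u.g u.p x
  simp only [hu.balance, sub_zero] at h1
  rw [slack, ← h1, ← add_sub_assoc, ← Finset.sum_add_distrib]
  have h2 : 0 ≤ ∑ i, (deriv (D.f i) (u.g i) * (x.g i - u.g i) + u.lam i * (x.g i - u.g i)) :=
    Finset.sum_nonneg fun i _ => by
      have := clip_proj (hx.g_mem i) (u.g i + -(deriv (D.f i) (u.g i) + u.lam i))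
      rw [hu.g_fixed] at this
      linarith
  have h3 : ∑ e : D.Line, (u.lam (D.up e) - u.lam (D.down e)) * (D.meanFlow x e - u.p e) ≤ 0 :=
    Finset.sum_nonpos fun e _ => by
      have h4 := clip_proj (hx.phat_mem e) (u.p e + (u.lam (D.up e) - u.lam (D.down e)))
      have h5 := clip_proj (hx.pbrv_mem e) (u.p e + (u.lam (D.up e) - u.lam (D.down e)))
      rw [hu.p_fixed] at h4 h5
      unfold meanFlow
      linarith
  linarith

/-- The pairing of λ - λ* with the local imbalance occurs with opposite signs in the primal and the
dual part and cancels. Strong convexity, the augmentation and the slack at the new point remain as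
gains; the losses come from using old gradients, from disagreement and from `h`. -/
theorem Optimal.energy_step (hu : D.Optimal u) (hc : D.CostAssumption m) (hm : 0 ≤ m)
    (hρ : 0 ≤ D.ρ) :
    ∃ K : ℝ, 0 ≤ K ∧ ∀ s h Q : ℝ, 0 ≤ s → 0 ≤ h → 0 ≤ Q → ∀ x x' : D.Iterate, D.InBox x →
      D.PerturbedStep s h Q x x' →
      energy u x' - energy u x ≤
        s * (-2 * (slack u x' + m * ‖x.g - u.g‖ ^ 2 + D.ρ * ‖D.imbalance x‖ ^ 2)
        + K * (‖x.g - u.g‖ * D.stepSize x x'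
          + (‖x.lam - u.lam‖ + ‖D.imbalance x‖) * (D.stepSize x x' + s * Q)
          + h * (flowDist u x + D.stepSize x x') + s * ‖D.imbalance x‖ ^ 2)) := by
  obtain ⟨Cf, hCf0, hCf⟩ := hc.exists_abs_deriv_sub_le u.g
  set N : ℝ := (Fintype.card V : ℝ) with hN
  set n : ℝ := (Fintype.card D.Line : ℝ) with hn
  have hN0 : 0 ≤ N := by positivity
  have hn0 : 0 ≤ n := by positivity
  refine ⟨2 * N * Cf + 2 * N * (1 + 2 * n) * (1 + D.ρ) + 2 * n + N, by positivity, ?_⟩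
  intro s h Q hs hh hQ x x' hx hst
  set γ := ‖x.g - u.g‖
  set Λ := ‖x.lam - u.lam‖
  set b := ‖D.imbalance x‖ with hb
  set δ := D.stepSize x x'
  have hγ0 : 0 ≤ γ := norm_nonneg _
  have hΛ0 : 0 ≤ Λ := norm_nonneg _
  have hb0 : 0 ≤ b := norm_nonneg _
  have hδ0 : 0 ≤ δ := stepSize_nonneg x x'
  have hπ0 := flowDist_nonneg (u := u) x
  have hγi : ∀ i, |x.g i - u.g i| ≤ γ := fun i => norm_le_pi_norm (x.g - u.g) i
  have hΛi : ∀ i, |x.lam i - u.lam i| ≤ Λ := fun i => norm_le_pi_norm (x.lam - u.lam) i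
  have hbi : ∀ i, |D.localImbalance i x| ≤ b := fun i => norm_le_pi_norm (D.imbalance x) i
  have hsQ : 0 ≤ s * Q := mul_nonneg hs hQ
  have hprim := hst.primalDist_le hs hu.g_mem hu.p_mem
  simp only [hu.balance, sub_zero] at hprim
  have hlam : ∑ i, (x'.lam i - u.lam i) ^ 2 = ∑ i, (x.lam i - u.lam i) ^ 2
      + 2 * s * ∑ i, (x.lam i - u.lam i) * D.localImbalance i x
      + s ^ 2 * ∑ i, D.localImbalance i x ^ 2 := by
    rw [Finset.mul_sum, Finset.mul_sum, ← Finset.sum_add_distrib, ← Finset.sum_add_distrib]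
    refine Finset.sum_congr rfl fun i _ => ?_
    rw [hst.lam_step]
    ring
  -- The new imbalance is split around the old local one: the pairing with λ - λ* cancels against
  -- `hlam`, and the ρ-term produces the gain in `b`.
  have hq : ∑ i, D.multiplier x i * D.meanImbalance x' i = ∑ i, u.lam i * D.meanImbalance x' i
      + ∑ i, (x.lam i - u.lam i) * (D.meanImbalance x' i - D.localImbalance i x)
      + ∑ i, (x.lam i - u.lam i) * D.localImbalance i x
      + D.ρ * (∑ i, D.localImbalance i x * (D.meanImbalance x' i - D.localImbalance i x)
      + ∑ i, D.localImbalance i x ^ 2) := by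
    simp only [← Finset.sum_add_distrib, Finset.mul_sum]
    refine Finset.sum_congr rfl fun i _ => ?_
    rw [multiplier]
    ring
  have hf : ∑ i, deriv (D.f i) (x.g i) * (x'.g i - u.g i)
      = ∑ i, deriv (D.f i) (u.g i) * (x'.g i - u.g i)
      + ∑ i, (deriv (D.f i) (x.g i) - deriv (D.f i) (u.g i)) * (x.g i - u.g i)
      + ∑ i, (deriv (D.f i) (x.g i) - deriv (D.f i) (u.g i)) * (x'.g i - x.g i) := by
    rw [← Finset.sum_add_distrib, ← Finset.sum_add_distrib]
    refine Finset.sum_congr rfl fun i _ => ?_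
    ring
  have hf1 : m * γ ^ 2
      ≤ ∑ i, (deriv (D.f i) (x.g i) - deriv (D.f i) (u.g i)) * (x.g i - u.g i) := by
    refine (mul_le_mul_of_nonneg_left (norm_sq_le_sum (x.g - u.g)) hm).trans ?_
    rw [Finset.mul_sum]
    exact Finset.sum_le_sum fun i _ => hc.strongly_monotone i (hx.g_mem i) (hu.g_mem i)
  have hf2 := abs_le.1 (abs_sum_mul_le (v := fun i => deriv (D.f i) (x.g i) - deriv (D.f i) (u.g i))
    (w := fun i => x'.g i - x.g i) (a := Cf * γ)
    (fun i => (hCf i _ (hx.g_mem i)).trans (mul_le_mul_of_nonneg_left (hγi i) hCf0))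
    (abs_g_sub_le x x'))
  have hmi := hst.abs_meanImbalance_sub_le hs hQ
  have h2 := abs_le.1 (abs_sum_mul_le hΛi hmi)
  have h3 := abs_le.1 (abs_sum_mul_le hbi hmi)
  have h4 : b ^ 2 ≤ ∑ i, D.localImbalance i x ^ 2 := norm_sq_le_sum (D.imbalance x)
  have h5 : ∑ i, D.localImbalance i x ^ 2 ≤ N * b ^ 2 := sum_sq_le_norm_sq hbi
  have h6 : ∑ e, h * (|x'.phat e - u.p e| + |x'.pbrv e - u.p e|)
      ≤ n * (h * (2 * (flowDist u x + δ))) := by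
    rw [hn, ← nsmul_eq_mul, ← Finset.card_univ]
    refine Finset.sum_le_card_nsmul _ _ _ fun e _ => ?_
    have h7 := abs_phat_sub_le_flowDist (u := u) x e
    have h8 := abs_pbrv_sub_le_flowDist (u := u) x e
    have h9 := abs_phat_sub_le x x' e
    have h10 := abs_pbrv_sub_le x x' e
    have h11 := abs_sub_le (x'.phat e) (x.phat e) (u.p e)
    have h12 := abs_sub_le (x'.pbrv e) (x.pbrv e) (u.p e)
    refine mul_le_mul_of_nonneg_left ?_ hh
    linarith
  rw [energy, energy, hlam]
  simp only [← hN, ← hn] at h2 h3 hf2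
  have e1 : (0:ℝ) ≤ N * (1 + 2 * n) * (Λ * (δ + s * Q)) := by positivity
  have e2 : (0:ℝ) ≤ N * (1 + 2 * n) * (b * (δ + s * Q)) := by positivity
  have e3 : (0:ℝ) ≤ n * (h * (flowDist u x + δ)) := by positivity
  have e4 : (0:ℝ) ≤ N * Cf * (γ * δ) := by positivity
  have e5 : (0:ℝ) ≤ N * (s * b ^ 2) := by positivity
  -- collect the terms
  have hmain : slack u x' + m * γ ^ 2 + D.ρ * b ^ 2 - N * Cf * (γ * δ)
      - N * (1 + 2 * n) * (Λ * (δ + s * Q)) - D.ρ * (N * (1 + 2 * n) * (b * (δ + s * Q)))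
      + ∑ i, (x.lam i - u.lam i) * D.localImbalance i x
      ≤ ∑ i, deriv (D.f i) (x.g i) * (x'.g i - u.g i)
        + ∑ i, D.multiplier x i * D.meanImbalance x' i := by
    rw [hf, hq, slack]
    have h7 := mul_le_mul_of_nonneg_left h3.1 hρ
    have h8 := mul_le_mul_of_nonneg_left h4 hρ
    have h9 := hf2.1
    have h10 := h2.1
    linarith
  have hmain' := mul_le_mul_of_nonneg_left hmain (by linarith : (0:ℝ) ≤ 2 * s)
  have h6' := mul_le_mul_of_nonneg_left h6 hs
  have h5' := mul_le_mul_of_nonneg_left h5 (sq_nonneg s)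
  have hK : s * (2 * (N * Cf * (γ * δ) + N * (1 + 2 * n) * (Λ * (δ + s * Q))
      + D.ρ * (N * (1 + 2 * n) * (b * (δ + s * Q)))) + 2 * (n * (h * (flowDist u x + δ)))
      + N * (s * b ^ 2)) ≤ s * ((2 * N * Cf + 2 * N * (1 + 2 * n) * (1 + D.ρ) + 2 * n + N) *
        (γ * δ + (Λ + b) * (δ + s * Q) + h * (flowDist u x + δ) + s * b ^ 2)) := by
    refine mul_le_mul_of_nonneg_left ?_ hs
    have a1 : 0 ≤ γ * δ := by positivity
    have a2 : 0 ≤ Λ * (δ + s * Q) := by positivity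
    have a3 : 0 ≤ b * (δ + s * Q) := by positivity
    have a4 : 0 ≤ h * (flowDist u x + δ) := by positivity
    have a5 : 0 ≤ s * b ^ 2 := by positivity
    have k1 : 0 ≤ N * Cf := by positivity
    have k2 : 0 ≤ N * (1 + 2 * n) := by positivity
    have k3 : 0 ≤ N * (1 + 2 * n) * D.ρ := by positivity
    rw [add_mul Λ b]
    generalize γ * δ = A1 at *
    generalize Λ * (δ + s * Q) = A2 at *
    generalize b * (δ + s * Q) = A3 at *
    generalize h * (flowDist u x + δ) = A4 at *
    generalize s * b ^ 2 = A5 at *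
    have : (2 * N * Cf + 2 * N * (1 + 2 * n) * (1 + D.ρ) + 2 * n + N) = 2 * (N * Cf)
      + 2 * (N * (1 + 2 * n)) + 2 * (N * (1 + 2 * n) * D.ρ) + 2 * n + N := by ring
    rw [this]
    have : D.ρ * (N * (1 + 2 * n) * A3) = (N * (1 + 2 * n) * D.ρ) * A3 := by ring
    rw [this]
    generalize N * Cf = k1' at *
    generalize N * (1 + 2 * n) * D.ρ = k3' at *
    generalize N * (1 + 2 * n) = k2' at *
    have p : ∀ {a b : ℝ}, 0 ≤ a → 0 ≤ b → 0 ≤ a * b := fun h h' => mul_nonneg h h'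
    linarith [p k1 a2, p k1 a3, p k1 a4, p k1 a5, p k2 a1, p k2 a3, p k2 a4, p k2 a5,
      p k3 a1, p k3 a2, p k3 a4, p k3 a5, p hn0 a1, p hn0 a2, p hn0 a3, p hn0 a5,
      p hN0 a1, p hN0 a2, p hN0 a3, p hN0 a4]
  linarith

end Near

end SCED

namespace SCED

section Near

variable {V : Type*} [Fintype V] [DecidableEq V] {D : SCED V} {u : D.Triple} {m : ℝ}

/-- The primal step is a projected gradient step for the augmented Lagrangian and lowers it in
proportion to the squared step length, which the energy does not control. The dual ascent raises it
by terms of order `s`. As f' is compared only with its value at `u.g`, the curvature costs (‖g -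
u.g‖ + δ)δ instead of δ². -/
theorem CostAssumption.potential_step (u : D.Triple) (hc : D.CostAssumption m) (hm : 0 ≤ m)
    (hρ : 0 ≤ D.ρ) :
    ∃ K : ℝ, 0 ≤ K ∧ ∀ s h Q : ℝ, 0 ≤ s → 0 ≤ h → 0 ≤ Q → ∀ x x' : D.Iterate, D.InBox x →
      D.InBox x' → D.PerturbedStep s h Q x x' →
      s * (D.potential x' - D.potential x) ≤ -(D.stepSize x x' ^ 2 / 2)
        + s * (K * ((‖x.g - u.g‖ + D.stepSize x x' + h + s * Q) * D.stepSize x x'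
          + s * ‖D.imbalance x‖ ^ 2 + s * (‖D.imbalance x‖ * (D.stepSize x x' + s * Q)))) := by
  obtain ⟨Cf, hCf0, hCf⟩ := hc.exists_abs_deriv_sub_le u.g
  set N : ℝ := (Fintype.card V : ℝ) with hN
  set n : ℝ := (Fintype.card D.Line : ℝ) with hn
  have hN0 : 0 ≤ N := by positivity
  have hn0 : 0 ≤ n := by positivity
  refine ⟨2 * (N * Cf) + n + N * (1 + 2 * n) + N + 2 * (D.ρ * (N * (1 + 2 * n) ^ 2)), by positivity, ?_⟩
  intro s h Q hs hh hQ x x' hx hx' hst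
  set γ := ‖x.g - u.g‖
  set b := ‖D.imbalance x‖ with hb
  set δ := D.stepSize x x'
  have hγ0 : 0 ≤ γ := norm_nonneg _
  have hb0 : 0 ≤ b := norm_nonneg _
  have hδ0 : 0 ≤ δ := stepSize_nonneg x x'
  have hγi : ∀ i, |x.g i - u.g i| ≤ γ := fun i => norm_le_pi_norm (x.g - u.g) i
  have hbi : ∀ i, |D.localImbalance i x| ≤ b := fun i => norm_le_pi_norm (D.imbalance x) i
  have hsQ : 0 ≤ s * Q := mul_nonneg hs hQ
  -- the generation part
  have hg : ∀ i, s * (D.f i (x'.g i) - D.f i (x.g i) + D.multiplier x i * (x'.g i - x.g i))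
      ≤ -(x'.g i - x.g i) ^ 2 + s * (Cf * (2 * γ + δ) * δ) := fun i => by
    have h1 := clip_proj (hx.g_mem i)
      (x.g i - s * (deriv (D.f i) (x.g i) + D.multiplier x i))
    rw [← hst.g_step] at h1
    have h2 := hc.sub_le hm i (hx.g_mem i) (hx'.g_mem i)
    have h3 : (deriv (D.f i) (x'.g i) - deriv (D.f i) (x.g i)) * (x'.g i - x.g i)
        ≤ Cf * (2 * γ + δ) * δ := by
      refine (le_abs_self _).trans ?_
      rw [abs_mul]
      have h4 := hCf i _ (hx.g_mem i)
      have h5 := hCf i _ (hx'.g_mem i)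
      have h6 := abs_sub_le (x'.g i) (x.g i) (u.g i)
      have h7 := abs_sub_le (deriv (D.f i) (x'.g i)) (deriv (D.f i) (u.g i)) (deriv (D.f i) (x.g i))
      rw [abs_sub_comm (deriv (D.f i) (u.g i))] at h7
      have h8 := abs_g_sub_le x x' i
      have h9 := mul_le_mul_of_nonneg_left (hγi i) hCf0
      have h10 : Cf * |x'.g i - u.g i| ≤ Cf * (γ + δ) :=
        mul_le_mul_of_nonneg_left (by linarith [hγi i]) hCf0
      exact mul_le_mul (by linarith) h8 (abs_nonneg _) (by positivity)
    have h4 := mul_le_mul_of_nonneg_left h2 hs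
    have h5 := mul_le_mul_of_nonneg_left h3 hs
    linarith
  -- the flow part
  have hgen : ∀ {e : D.Line} {p p' y : ℝ}, p ∈ Set.Icc (-D.pmax e) (D.pmax e) → |p' - p| ≤ δ →
      |y - (D.multiplier x (D.down e) - D.multiplier x (D.up e))| ≤ h →
      p' = clip (-D.pmax e) (D.pmax e) (p - s * y) →
      -(s * ((D.multiplier x (D.up e) - D.multiplier x (D.down e)) * (p' - p)))
        ≤ -(p' - p) ^ 2 + s * (h * δ) := by
    intro e p p' y hmem hδ hy hp
    have h1 := clip_proj hmem (p - s * y)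
    rw [← hp] at h1
    have h2 : -((y - (D.multiplier x (D.down e) - D.multiplier x (D.up e))) * (p' - p))
        ≤ h * δ := by
      refine (neg_le_abs _).trans ?_
      rw [abs_mul]
      gcongr
    have h3 := mul_le_mul_of_nonneg_left h2 hs
    linarith
  have hp : ∀ e, -(s * ((D.multiplier x (D.up e) - D.multiplier x (D.down e))
      * (D.meanFlow x' e - D.meanFlow x e)))
      ≤ -((x'.phat e - x.phat e) ^ 2 + (x'.pbrv e - x.pbrv e) ^ 2) / 2 + s * (h * δ) := fun e => by
    obtain ⟨y, hy, hy'⟩ := hst.phat_step e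
    obtain ⟨z, hz, hz'⟩ := hst.pbrv_step e
    have h1 := hgen (hx.phat_mem e) (abs_phat_sub_le x x' e) hy hy'
    have h2 := hgen (hx.pbrv_mem e) (abs_pbrv_sub_le x x' e) hz hz'
    unfold meanFlow
    linarith
  have hg' : s * ∑ i, (D.f i (x'.g i) - D.f i (x.g i)) +
      s * ∑ i, D.multiplier x i * (x'.g i - x.g i)
      ≤ -∑ i, (x'.g i - x.g i) ^ 2 + N * (s * (Cf * (2 * γ + δ) * δ)) := by
    have := Finset.sum_le_sum fun i (_ : i ∈ Finset.univ) => hg i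
    simp only [Finset.sum_add_distrib, Finset.sum_neg_distrib, mul_add, ← Finset.mul_sum,
      Finset.sum_const, Finset.card_univ, nsmul_eq_mul, ← hN] at this ⊢
    linarith
  have hp' : -(s * ∑ e : D.Line, (D.multiplier x (D.up e) - D.multiplier x (D.down e))
      * (D.meanFlow x' e - D.meanFlow x e)) ≤
      -(∑ e, ((x'.phat e - x.phat e) ^ 2 + (x'.pbrv e - x.pbrv e) ^ 2)) / 2
        + n * (s * (h * δ)) := by
    have := Finset.sum_le_sum fun e (_ : e ∈ Finset.univ) => hp e
    rw [Finset.sum_add_distrib, ← Finset.sum_div, Finset.sum_neg_distrib, Finset.sum_neg_distrib,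
      ← Finset.mul_sum, Finset.sum_const, Finset.card_univ, nsmul_eq_mul, ← hn] at this
    exact this
  have hsize := stepSize_sq_le x x'
  have hmul := sum_multiplier_mul (D.multiplier x) x.g (D.meanFlow x) x'
  have hmul' : ∑ i, D.multiplier x i * (D.meanImbalance x' i - (x.g i - D.l i
      - D.div (D.meanFlow x) i)) = ∑ i, D.multiplier x i *
      (D.meanImbalance x' i - D.meanImbalance x i) := rfl
  rw [hmul'] at hmul
  have hpot : D.potential x' - D.potential x = ∑ i, (D.f i (x'.g i) - D.f i (x.g i))
      + ∑ i, D.multiplier x i * (D.meanImbalance x' i - D.meanImbalance x i)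
      + s * (∑ i, D.localImbalance i x * (D.meanImbalance x' i - D.localImbalance i x)
        + ∑ i, D.localImbalance i x ^ 2)
      + D.ρ * (∑ i, (D.meanImbalance x i - D.localImbalance i x)
        * (D.meanImbalance x' i - D.meanImbalance x i))
      + D.ρ / 2 * ∑ i, (D.meanImbalance x' i - D.meanImbalance x i) ^ 2 := by
    simp only [potential, ← Finset.sum_add_distrib, ← Finset.sum_sub_distrib, Finset.mul_sum]
    refine Finset.sum_congr rfl fun i _ => ?_
    rw [hst.lam_step, multiplier]
    ring
  have hmi := hst.abs_meanImbalance_sub_le hs hQ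
  have hmi2 := SCED.abs_meanImbalance_sub_le x x'
  have hmi3 : ∀ i, |D.meanImbalance x i - D.localImbalance i x| ≤ n * (s * Q) := fun i => by
    rw [abs_sub_comm]
    exact abs_localImbalance_sub_le hsQ hst.disagreement i
  have h1 := (abs_le.1 (abs_sum_mul_le hbi hmi)).2
  have h2 := (abs_le.1 (abs_sum_mul_le hmi3 hmi2)).2
  have h3 := sum_sq_le_norm_sq hmi2
  have h4 : ∑ i, D.localImbalance i x ^ 2 ≤ N * b ^ 2 := sum_sq_le_norm_sq hbi
  simp only [← hN, ← hn] at h1 h2 h3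
  have h1' := mul_le_mul_of_nonneg_left h1 (mul_nonneg hs hs)
  have h4' := mul_le_mul_of_nonneg_left h4 (mul_nonneg hs hs)
  have h2' := mul_le_mul_of_nonneg_left h2 (mul_nonneg hs hρ)
  have h3' := mul_le_mul_of_nonneg_left h3 (mul_nonneg hs (by linarith : 0 ≤ D.ρ / 2))
  have key : s * (D.potential x' - D.potential x) ≤ -(δ ^ 2 / 2)
      + s * (N * (Cf * (2 * γ + δ) * δ) + n * (h * δ)
        + s * (N * (b * ((1 + 2 * n) * (δ + s * Q)))) + s * (N * b ^ 2)
        + D.ρ * (N * (n * (s * Q) * ((1 + 2 * n) * δ)))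
        + D.ρ / 2 * (N * ((1 + 2 * n) * δ) ^ 2)) := by
    rw [hpot, ← hmul]
    linarith
  refine key.trans ?_
  gcongr _ + s * ?_
  have a1 : 0 ≤ γ * δ := by positivity
  have a2 : 0 ≤ δ * δ := by positivity
  have a3 : 0 ≤ h * δ := by positivity
  have a4 : 0 ≤ s * Q * δ := by positivity
  have a5 : 0 ≤ s * b ^ 2 := by positivity
  have a6 : 0 ≤ s * (b * (δ + s * Q)) := by positivity
  have k1 : 0 ≤ N * Cf := by positivity
  have k2 : 0 ≤ N * (1 + 2 * n) := by positivity
  have k3 : 0 ≤ D.ρ * (N * (1 + 2 * n) ^ 2) := by positivity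
  have e1 : N * (Cf * (2 * γ + δ) * δ) = (N * Cf) * (2 * (γ * δ) + δ * δ) := by ring
  have e2 : s * (N * (b * ((1 + 2 * n) * (δ + s * Q)))) = (N * (1 + 2 * n)) * (s * (b * (δ + s * Q))) := by
    ring
  have e3 : D.ρ * (N * (n * (s * Q) * ((1 + 2 * n) * δ)))
      ≤ (D.ρ * (N * (1 + 2 * n) ^ 2)) * (s * Q * δ) := by
    have : D.ρ * (N * (n * (s * Q) * ((1 + 2 * n) * δ))) = D.ρ * (N * (n * (1 + 2 * n))) * (s * Q * δ) := by
      ring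
    rw [this, sq]
    gcongr
    linarith
  have e4 : D.ρ / 2 * (N * ((1 + 2 * n) * δ) ^ 2) = (D.ρ * (N * (1 + 2 * n) ^ 2)) * (δ * δ) / 2 := by ring
  have e5 : s * (N * b ^ 2) = N * (s * b ^ 2) := by ring
  have e6 : (γ + δ + h + s * Q) * δ = γ * δ + δ * δ + h * δ + s * Q * δ := by ring
  rw [e1, e2, e4, e5, e6]
  generalize D.ρ * (N * (1 + 2 * n) ^ 2) = k3' at *
  generalize N * (1 + 2 * n) = k2' at *
  generalize N * Cf = k1' at *
  generalize D.ρ * (N * (n * (s * Q) * ((1 + 2 * n) * δ))) = z at *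
  generalize s * (b * (δ + s * Q)) = A6 at *
  generalize s * b ^ 2 = A5 at *
  generalize s * Q * δ = A4 at *
  generalize h * δ = A3 at *
  generalize γ * δ = A1 at *
  generalize δ * δ = A2 at *
  obtain ⟨K, hK⟩ : ∃ K, K = 2 * k1' + n + k2' + N + 2 * k3' := ⟨_, rfl⟩
  rw [← hK]
  have t1 : (2 * k1') * A1 ≤ K * A1 := mul_le_mul_of_nonneg_right (by linarith) a1
  have t2 : (k1' + k3' / 2) * A2 ≤ K * A2 := mul_le_mul_of_nonneg_right (by linarith) a2
  have t3 : n * A3 ≤ K * A3 := mul_le_mul_of_nonneg_right (by linarith) a3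
  have t4 : k3' * A4 ≤ K * A4 := mul_le_mul_of_nonneg_right (by linarith) a4
  have t5 : N * A5 ≤ K * A5 := mul_le_mul_of_nonneg_right (by linarith) a5
  have t6 : k2' * A6 ≤ K * A6 := mul_le_mul_of_nonneg_right (by linarith) a6
  clear_value N n
  clear hK
  linarith

theorem Optimal.flowDist_le (h : D.IsRadial) (hu : D.Optimal u) :
    ∃ K : ℝ, 0 ≤ K ∧ ∀ (x : D.Iterate) (r : ℝ), 0 ≤ r → (∀ e, |x.phat e - x.pbrv e| ≤ r) →
      flowDist u x ≤ K * (‖x.g - u.g‖ + ‖D.imbalance x‖ + r) := by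
  obtain ⟨C, hC, hC'⟩ := h.exists_norm_le_div
  set n : ℝ := (Fintype.card D.Line : ℝ) with hn
  have hn0 : 0 ≤ n := by positivity
  refine ⟨C * (1 + n) + 1, by positivity, fun x r hr hx => ?_⟩
  have hγ0 : 0 ≤ ‖x.g - u.g‖ := norm_nonneg _
  have hb0 : 0 ≤ ‖D.imbalance x‖ := norm_nonneg _
  have h1 : ‖D.div fun e => D.meanFlow x e - u.p e‖ ≤ (1 + n) * (‖x.g - u.g‖ + ‖D.imbalance x‖ + r) := by
    refine (pi_norm_le_iff_of_nonneg (by positivity)).2 fun i => ?_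
    have h2 := hu.meanImbalance_eq x i
    have h3 := abs_localImbalance_sub_le hr hx i
    have h4 := norm_le_pi_norm (x.g - u.g) i
    have h5 : |D.localImbalance i x| ≤ _ := norm_le_pi_norm (D.imbalance x) i
    rw [Pi.sub_apply] at h4
    rw [Real.norm_eq_abs] at h4 ⊢
    rw [← hn] at h3
    have h6 : 0 ≤ n * ‖x.g - u.g‖ := by positivity
    have h7 : 0 ≤ n * ‖D.imbalance x‖ := by positivity
    rw [abs_le] at *
    constructor <;> linarith
  have h2 := (hC' fun e => D.meanFlow x e - u.p e).trans (mul_le_mul_of_nonneg_left h1 hC)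
  have h3 : ∀ e, |D.meanFlow x e - u.p e| ≤ _ := fun e =>
    (norm_le_pi_norm (fun e => D.meanFlow x e - u.p e) e).trans h2
  have h4 : 0 ≤ C * ((1 + n) * (‖x.g - u.g‖ + ‖D.imbalance x‖ + r)) + r := by positivity
  have h5 : C * ((1 + n) * (‖x.g - u.g‖ + ‖D.imbalance x‖ + r)) + r
      ≤ (C * (1 + n) + 1) * (‖x.g - u.g‖ + ‖D.imbalance x‖ + r) := by linarith
  refine max_le ?_ ?_ <;> refine ((pi_norm_le_iff_of_nonneg h4).2 fun e => ?_).trans h5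
  all_goals
    have h6 := h3 e
    have h7 := hx e
    unfold meanFlow at h6
    simp only [Pi.sub_apply, Real.norm_eq_abs]
    rw [abs_le] at *
    constructor <;> linarith

theorem PerturbedStep.norm_multiplier_sub_le (hρ : 0 ≤ D.ρ) {s h Q : ℝ} {x x' : D.Iterate}
    (hs : 0 ≤ s) (hst : D.PerturbedStep s h Q x x') :
    ‖D.multiplier x' - D.multiplier x‖
      ≤ s * ‖D.imbalance x‖ + D.ρ * (1 + 2 * Fintype.card D.Line) * D.stepSize x x' := by
  have hδ := stepSize_nonneg x x'
  refine (pi_norm_le_iff_of_nonneg (by positivity)).2 fun i => ?_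
  have h5 : |D.localImbalance i x| ≤ _ := norm_le_pi_norm (D.imbalance x) i
  have h1 := abs_localImbalance_step_le x x' i
  rw [Pi.sub_apply, Real.norm_eq_abs, multiplier, multiplier, hst.lam_step]
  have h2 : x.lam i + s * D.localImbalance i x + D.ρ * D.localImbalance i x' -
      (x.lam i + D.ρ * D.localImbalance i x)
      = s * D.localImbalance i x + D.ρ * (D.localImbalance i x' - D.localImbalance i x) := by ring
  rw [h2]
  refine (abs_add_le _ _).trans ?_
  rw [abs_mul, abs_mul, abs_of_nonneg hs, abs_of_nonneg hρ, mul_assoc]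
  gcongr

/-- The distance of the multipliers to equilibrium is controlled by the primal quantities. -/
theorem Optimal.dual_error_bound (h : D.IsRadial) (hu : D.Optimal u) (hc : D.CostAssumption m)
    (hunique : ∀ u', D.IsEquilibrium u' → u' = u) (hρ : 0 ≤ D.ρ) (R : ℝ) :
    ∃ K : ℝ, 0 ≤ K ∧ ∀ s h Q : ℝ, 0 ≤ s → s ≤ 1 → 0 ≤ h → ∀ x x' : D.Iterate,
      D.InBox x → D.PerturbedStep s h Q x x' → ‖x.lam - u.lam‖ ≤ R →
      s * ‖x.lam - u.lam‖ ≤ K * (D.stepSize x x'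
        + s * (‖x.g - u.g‖ + flowDist u x + ‖D.imbalance x‖ + h)) := by
  obtain ⟨Cf, hCf0, hCf⟩ := hc.exists_abs_deriv_sub_le u.g
  obtain ⟨C, hC, hC'⟩ := hu.exists_norm_le_residual h (fun i => (hc i).1) hunique R
  refine ⟨C * (2 + Cf + 2 * D.ρ), by positivity, fun s hh Q hs hs1 hh0 x x' hx hst hR => ?_⟩
  set γ := ‖x.g - u.g‖
  set b := ‖D.imbalance x‖ with hb
  set δ := D.stepSize x x'
  have hγ0 : 0 ≤ γ := norm_nonneg _
  have hb0 : 0 ≤ b := norm_nonneg _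
  have hδ0 : 0 ≤ δ := stepSize_nonneg x x'
  have hπ0 := flowDist_nonneg (u := u) x
  have hγi : ∀ i, |x.g i - u.g i| ≤ γ := fun i => norm_le_pi_norm (x.g - u.g) i
  have hbi : ∀ i, |D.localImbalance i x| ≤ b := fun i => norm_le_pi_norm (D.imbalance x) i
  rcases hs.eq_or_lt with rfl | hs0
  · rw [zero_mul, zero_mul, add_zero]
    positivity
  -- `δ / s` bounds the residual of a unit step at `x`; the second summand is the price of replacing
  -- primal variables, derivatives and imbalances by their equilibrium values.
  set r : ℝ := δ / s + (2 + Cf + 2 * D.ρ) * (γ + flowDist u x + b + hh) with hr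
  have hscale : ∀ {lo hi p v q : ℝ}, p ∈ Set.Icc lo hi → q = clip lo hi (p + s * v) → |q - p| ≤ δ →
      |clip lo hi (p + v) - p| ≤ δ / s := by
    intro lo hi p v q hp hq hδ
    rw [le_div_iff₀ hs0, mul_comm]
    refine (mul_abs_clip_add_sub_le hp v hs hs1).trans ?_
    rwa [← hq]
  have hpert : ∀ {lo hi p v p' v' d d' : ℝ}, |clip lo hi (p + v) - p| ≤ d → |p - p'| + |p + v - (p' + v')| ≤ d' →
      |clip lo hi (p' + v') - p'| ≤ d + d' := by
    intro lo hi p v p' v' d d' h1 h2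
    have h3 := abs_clip_sub_clip_le (lo := lo) (hi := hi) (p + v) (p' + v')
    have h4 : clip lo hi (p' + v') - p' = (clip lo hi (p + v) - p)
        - (clip lo hi (p + v) - clip lo hi (p' + v')) + (p - p') := by ring
    rw [h4]
    refine (abs_add_le _ _).trans ?_
    linarith [abs_sub (clip lo hi (p + v) - p) (clip lo hi (p + v) - clip lo hi (p' + v'))]
  have hmain : ‖x.lam - u.lam‖ ≤ C * r := by
    refine hC' _ hR r (fun i => ?_) (fun e => ?_)
    · have h1 := hscale (v := -(deriv (D.f i) (x.g i) + D.multiplier x i)) (hx.g_mem i)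
        (by rw [hst.g_step]; congr 1; ring) (abs_g_sub_le x x' i)
      refine hpert h1 ?_
      have h2 := hγi i
      have h3 := hCf i _ (hx.g_mem i)
      have h4 := mul_le_mul_of_nonneg_left h2 hCf0
      have h5 := mul_le_mul_of_nonneg_left (hbi i) hρ
      rw [← abs_of_nonneg hρ, ← abs_mul] at h5
      have h6 : x.g i + -(deriv (D.f i) (x.g i) + D.multiplier x i) -
          (u.g i + (-(deriv (D.f i) (u.g i) + u.lam i) + -(x.lam - u.lam) i))
          = (x.g i - u.g i) - (deriv (D.f i) (x.g i) - deriv (D.f i) (u.g i))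
            - D.ρ * D.localImbalance i x := by
        rw [multiplier, Pi.sub_apply]
        ring
      rw [h6]
      have h7 := abs_sub ((x.g i - u.g i) - (deriv (D.f i) (x.g i) - deriv (D.f i) (u.g i)))
        (D.ρ * D.localImbalance i x)
      have h8 := abs_sub (x.g i - u.g i) (deriv (D.f i) (x.g i) - deriv (D.f i) (u.g i))
      rw [abs_of_nonneg hρ] at h5
      have p : ∀ {a b : ℝ}, 0 ≤ a → 0 ≤ b → 0 ≤ a * b := fun h h' => mul_nonneg h h'
      linarith [p hCf0 hπ0, p hCf0 hb0, p hCf0 hh0, p hρ hγ0, p hρ hπ0, p hρ hh0, p hρ hb0]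
    · obtain ⟨y, hy, hy'⟩ := hst.phat_step e
      have h1 := hscale (v := -y) (hx.phat_mem e)
        (by rw [hy']; congr 1; ring) (abs_phat_sub_le x x' e)
      refine hpert h1 ?_
      have h2 := abs_phat_sub_le_flowDist (u := u) x e
      have h5 := mul_le_mul_of_nonneg_left (hbi (D.up e)) hρ
      have h5' := mul_le_mul_of_nonneg_left (hbi (D.down e)) hρ
      rw [← abs_of_nonneg hρ, ← abs_mul] at h5 h5'
      have h6 : x.phat e + -y - (u.p e + (u.lam (D.up e) - u.lam (D.down e) +
          ((x.lam - u.lam) (D.up e) - (x.lam - u.lam) (D.down e))))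
          = (x.phat e - u.p e) - (y - (D.multiplier x (D.down e) - D.multiplier x (D.up e)))
          - (D.ρ * D.localImbalance (D.down e) x - D.ρ * D.localImbalance (D.up e) x) := by
        simp only [multiplier, Pi.sub_apply]
        ring
      rw [h6]
      have h7 := abs_sub ((x.phat e - u.p e)
        - (y - (D.multiplier x (D.down e) - D.multiplier x (D.up e))))
        (D.ρ * D.localImbalance (D.down e) x - D.ρ * D.localImbalance (D.up e) x)
      have h8 := abs_sub (x.phat e - u.p e)
        (y - (D.multiplier x (D.down e) - D.multiplier x (D.up e)))
      have h9 := abs_sub (D.ρ * D.localImbalance (D.down e) x) (D.ρ * D.localImbalance (D.up e) x)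
      rw [abs_of_nonneg hρ] at h5 h5'
      have p : ∀ {a b : ℝ}, 0 ≤ a → 0 ≤ b → 0 ≤ a * b := fun h h' => mul_nonneg h h'
      linarith [p hCf0 hγ0, p hCf0 hπ0, p hCf0 hb0, p hCf0 hh0, p hρ hγ0, p hρ hπ0, p hρ hh0,
        p hρ hb0]
  have h1 := mul_le_mul_of_nonneg_left hmain hs
  have h2 : s * (C * r) = C * (δ + (2 + Cf + 2 * D.ρ) * (s * (γ + flowDist u x + b + hh))) := by
    rw [hr]
    field_simp
  rw [h2] at h1
  refine h1.trans ?_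
  rw [mul_assoc]
  gcongr
  have : 1 * δ ≤ (2 + Cf + 2 * D.ρ) * δ := by gcongr; linarith
  linarith

theorem energy_lower (x : D.Iterate) :
    ‖x.g - u.g‖ ^ 2 + flowDist u x ^ 2 / 2 + ‖x.lam - u.lam‖ ^ 2 ≤ energy u x := by
  have h1 := norm_sq_le_sum (x.g - u.g)
  have h2 := norm_sq_le_sum (x.phat - u.p)
  have h3 := norm_sq_le_sum (x.pbrv - u.p)
  have h4 := norm_sq_le_sum (x.lam - u.lam)
  have h5 := sq_nonneg ‖x.phat - u.p‖
  have h6 := sq_nonneg ‖x.pbrv - u.p‖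
  simp only [Pi.sub_apply] at h1 h2 h3 h4
  rw [energy, primalDist, Finset.sum_add_distrib]
  unfold flowDist
  rcases max_cases ‖x.phat - u.p‖ ‖x.pbrv - u.p‖ with ⟨h, -⟩ | ⟨h, -⟩ <;> rw [h] <;> linarith

theorem energy_upper (x : D.Iterate) :
    energy u x ≤ (Fintype.card V + Fintype.card D.Line) *
      (‖x.g - u.g‖ ^ 2 + flowDist u x ^ 2 + ‖x.lam - u.lam‖ ^ 2) := by
  have h1 := sum_sq_le_norm_sq (fun i => norm_le_pi_norm (x.g - u.g) i)
  have h2 := sum_sq_le_norm_sq (abs_phat_sub_le_flowDist (u := u) x)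
  have h3 := sum_sq_le_norm_sq (abs_pbrv_sub_le_flowDist (u := u) x)
  have h4 := sum_sq_le_norm_sq (fun i => norm_le_pi_norm (x.lam - u.lam) i)
  simp only [Pi.sub_apply] at h1 h4
  rw [energy, primalDist, Finset.sum_add_distrib]
  have hN0 : (0 : ℝ) ≤ Fintype.card V := by positivity
  have hn0 : (0 : ℝ) ≤ Fintype.card D.Line := by positivity
  linarith [mul_nonneg hN0 (sq_nonneg (flowDist u x)), mul_nonneg hn0 (sq_nonneg ‖x.g - u.g‖),
    mul_nonneg hn0 (sq_nonneg ‖x.lam - u.lam‖)]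

/-- Expansion of the augmented Lagrangian at the equilibrium. The linear part is the slack, which
has a sign but need not be quadratically small, and is therefore kept apart. -/
theorem Optimal.potential_bounds (hu : D.Optimal u) (hc : D.CostAssumption m) (hm : 0 ≤ m)
    (hρ : 0 ≤ D.ρ) :
    ∃ K : ℝ, 0 ≤ K ∧ ∀ x : D.Iterate, D.InBox x →
      |D.potential x - ∑ i, D.f i (u.g i) - slack u x|
        ≤ K * (‖x.g - u.g‖ ^ 2 + flowDist u x ^ 2 + ‖x.lam - u.lam‖ ^ 2) := by
  obtain ⟨Cf, hCf0, hCf⟩ := hc.exists_abs_deriv_sub_le u.g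
  set N : ℝ := (Fintype.card V : ℝ) with hN
  set n : ℝ := (Fintype.card D.Line : ℝ) with hn
  have hN0 : 0 ≤ N := by positivity
  have hn0 : 0 ≤ n := by positivity
  refine ⟨N * Cf + N * (1 + 2 * n) * 2 + D.ρ * (N * (1 + 2 * n) ^ 2), by positivity, fun x hx => ?_⟩
  set γ := ‖x.g - u.g‖
  set Λ := ‖x.lam - u.lam‖
  set π := flowDist u x
  have hγ0 : 0 ≤ γ := norm_nonneg _
  have hΛ0 : 0 ≤ Λ := norm_nonneg _
  have hπ0 : 0 ≤ π := flowDist_nonneg (u := u) x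
  have hγi : ∀ i, |x.g i - u.g i| ≤ γ := fun i => norm_le_pi_norm (x.g - u.g) i
  have hΛi : ∀ i, |x.lam i - u.lam i| ≤ Λ := fun i => norm_le_pi_norm (x.lam - u.lam) i
  have hβ : ∀ i, |D.meanImbalance x i| ≤ (1 + 2 * n) * (γ + π) := hu.abs_meanImbalance_le x
  have heq : D.potential x - ∑ i, D.f i (u.g i) - slack u x
      = ∑ i, (D.f i (x.g i) - D.f i (u.g i) - deriv (D.f i) (u.g i) * (x.g i - u.g i))
      + ∑ i, (x.lam i - u.lam i) * D.meanImbalance x i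
      + D.ρ / 2 * ∑ i, D.meanImbalance x i ^ 2 := by
    simp only [potential, slack, ← Finset.sum_add_distrib, ← Finset.sum_sub_distrib,
      Finset.mul_sum]
    refine Finset.sum_congr rfl fun i _ => ?_
    ring
  have h1 : 0 ≤ ∑ i, (D.f i (x.g i) - D.f i (u.g i) - deriv (D.f i) (u.g i) * (x.g i - u.g i)) :=
    Finset.sum_nonneg fun i _ => by
      have := hc.sub_le hm i (hx.g_mem i) (hu.g_mem i)
      linarith
  have h2 : ∑ i, (D.f i (x.g i) - D.f i (u.g i) - deriv (D.f i) (u.g i) * (x.g i - u.g i))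
      ≤ N * (Cf * γ * γ) := by
    rw [hN, ← nsmul_eq_mul, ← Finset.card_univ]
    refine Finset.sum_le_card_nsmul _ _ _ fun i _ => ?_
    have h3 := hc.sub_le hm i (hu.g_mem i) (hx.g_mem i)
    have h4 : (deriv (D.f i) (x.g i) - deriv (D.f i) (u.g i)) * (x.g i - u.g i) ≤ Cf * γ * γ := by
      refine (le_abs_self _).trans ?_
      rw [abs_mul]
      exact mul_le_mul ((hCf i _ (hx.g_mem i)).trans (mul_le_mul_of_nonneg_left (hγi i) hCf0))
        (hγi i) (abs_nonneg _) (by positivity)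
    linarith
  have h3 := abs_le.1 (abs_sum_mul_le hΛi hβ)
  have h4 := sum_sq_le_norm_sq hβ
  have h5 : 0 ≤ ∑ i, D.meanImbalance x i ^ 2 := Finset.sum_nonneg fun i _ => sq_nonneg _
  have h4' := mul_le_mul_of_nonneg_left h4 (by linarith : 0 ≤ D.ρ / 2)
  have h5' := mul_nonneg (by linarith : 0 ≤ D.ρ / 2) h5
  simp only [← hN] at h3 h4'
  set S := γ ^ 2 + π ^ 2 + Λ ^ 2 with hS
  have b1 : γ * γ ≤ S := by nlinarith [sq_nonneg π, sq_nonneg Λ]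
  have b2 : Λ * (γ + π) ≤ 2 * S := by
    nlinarith [sq_nonneg (Λ - γ), sq_nonneg (Λ - π), sq_nonneg Λ, sq_nonneg γ, sq_nonneg π]
  have b3 : (γ + π) ^ 2 ≤ 2 * S := by nlinarith [sq_nonneg (γ - π), sq_nonneg Λ]
  have c1 : N * (Cf * γ * γ) ≤ N * Cf * S := by
    have := mul_le_mul_of_nonneg_left b1 (mul_nonneg hN0 hCf0)
    linarith
  have c2 : N * (Λ * ((1 + 2 * n) * (γ + π))) ≤ N * (1 + 2 * n) * 2 * S := by
    have := mul_le_mul_of_nonneg_left b2 (by positivity : 0 ≤ N * (1 + 2 * n))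
    linarith
  have c3 : D.ρ / 2 * (N * ((1 + 2 * n) * (γ + π)) ^ 2) ≤ D.ρ * (N * (1 + 2 * n) ^ 2) * S := by
    have := mul_le_mul_of_nonneg_left b3 (by positivity : 0 ≤ D.ρ / 2 * (N * (1 + 2 * n) ^ 2))
    linarith
  have hS0 : 0 ≤ S := by positivity
  have d1 : 0 ≤ N * Cf * S := by positivity
  have d3 : 0 ≤ D.ρ * (N * (1 + 2 * n) ^ 2) * S := by positivity
  rw [heq, abs_le]
  constructor <;> linarith

end Near

end SCED

/-! ### The Lyapunov inequality for scalars. -/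

section Scalar

theorem young_le {a b ε : ℝ} (hε : 0 < ε) : a * b ≤ ε * a ^ 2 + b ^ 2 / (4 * ε) := by
  have h : ε * a ^ 2 + b ^ 2 / (4 * ε) - a * b = (2 * ε * a - b) ^ 2 / (4 * ε) := by
    field_simp
    ring
  have : 0 ≤ (2 * ε * a - b) ^ 2 / (4 * ε) := by positivity
  linarith

/-- Convexity of the square, with weights μ and 1 - μ. -/
theorem sq_filter_le {μ x w y : ℝ} (hμ0 : 0 ≤ μ) (hμ1 : μ < 1) (hy0 : 0 ≤ y)
    (hy : y ≤ μ * x + w) : y ^ 2 ≤ μ * x ^ 2 + w ^ 2 / (1 - μ) := by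
  have h1 : 0 < 1 - μ := by linarith
  have h2 : y ^ 2 ≤ (μ * x + w) ^ 2 := pow_le_pow_left₀ hy0 hy 2
  have h3 : μ * x ^ 2 + w ^ 2 / (1 - μ) - (μ * x + w) ^ 2
      = μ * ((1 - μ) * x - w) ^ 2 / (1 - μ) := by
    field_simp
    ring
  have : 0 ≤ μ * ((1 - μ) * x - w) ^ 2 / (1 - μ) := by positivity
  linarith

theorem sum_five_sq_le (a b c d e : ℝ) :
    (a + b + c + d + e) ^ 2 ≤ 5 * (a ^ 2 + b ^ 2 + c ^ 2 + d ^ 2 + e ^ 2) := by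
  nlinarith [sq_nonneg (a - b), sq_nonneg (a - c), sq_nonneg (a - d), sq_nonneg (a - e),
    sq_nonneg (b - c), sq_nonneg (b - d), sq_nonneg (b - e), sq_nonneg (c - d), sq_nonneg (c - e),
    sq_nonneg (d - e)]

/-- With the step length written as `s * D`, every error carries an extra factor `s` except `(H + Q)
* π`, which Young's inequality splits between the gain ν and the filters. -/
theorem energy_decrease {K ν s γ π Λ b D H Q dV l : ℝ} (hK : 1 ≤ K) (hν : 0 < ν)
    (hs : 0 ≤ s) (hs1 : s ≤ 1) (hγ : 0 ≤ γ) (hb : 0 ≤ b)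
    (hD : 0 ≤ D) (hH : 0 ≤ H) (hQ : 0 ≤ Q)
    (hπK : π ≤ K * (γ + b + s * Q)) (hΛK : Λ ≤ 2 * K ^ 2 * (γ + b + D + H + Q))
    (hV : dV ≤ s * (-2 * (l + ν * γ ^ 2 + ν * b ^ 2) + K * (γ * (s * D)
      + (Λ + b) * (s * D + s * Q) + (H + Q) * (π + s * D) + s * b ^ 2))) :
    dV + 2 * s * l ≤ s * (-(7 / 4) * ν * (γ ^ 2 + b ^ 2) + (4 * K ^ 4 / ν + 3 * K ^ 2) * (H ^ 2 + Q ^ 2)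
      + 30 * K ^ 3 * (s * (γ ^ 2 + b ^ 2 + D ^ 2 + H ^ 2 + Q ^ 2))) := by
  set T := γ + b + D + H + Q with hT
  set S := γ ^ 2 + b ^ 2 + D ^ 2 + H ^ 2 + Q ^ 2 with hS
  have hT0 : 0 ≤ T := by positivity
  have hTS : T ^ 2 ≤ 5 * S := sum_five_sq_le γ b D H Q
  have hK0 : 0 ≤ K := by linarith
  have t1 : γ * D ≤ T * T := mul_le_mul (by linarith) (by linarith) hD hT0
  have t2 : (Λ + b) * (D + Q) ≤ (2 * K ^ 2 * T + T) * T :=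
    mul_le_mul (by linarith) (by linarith) (by linarith) (by positivity)
  have t3 : (H + Q) * D ≤ T * T := mul_le_mul (by linarith) (by linarith) hD hT0
  have t4 : b * b ≤ T * T := mul_le_mul (by linarith) (by linarith) hb hT0
  have t5 : γ * D + (Λ + b) * (D + Q) + (H + Q) * D + b * b ≤ 6 * K ^ 2 * T ^ 2 := by
    have : T * T ≤ K ^ 2 * T ^ 2 := by
      rw [← sq]
      exact le_mul_of_one_le_left (sq_nonneg T) (one_le_pow₀ hK)
    linarith
  have t6 : K * (γ * D + (Λ + b) * (D + Q) + (H + Q) * D + b * b) ≤ 30 * K ^ 3 * S := by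
    have h1 := mul_le_mul_of_nonneg_left t5 hK0
    have h2 := mul_le_mul_of_nonneg_left hTS (by positivity : 0 ≤ 6 * K ^ 3)
    linarith
  have hsQ : s * Q ≤ Q := mul_le_of_le_one_left hQ hs1
  have t7 : K * ((H + Q) * π) ≤ ν / 4 * (γ ^ 2 + b ^ 2)
      + (4 * K ^ 4 / ν + 3 * K ^ 2) * (H ^ 2 + Q ^ 2) := by
    have h1 : K * ((H + Q) * π) ≤ K * ((H + Q) * (K * (γ + b + Q))) := by
      gcongr
      refine hπK.trans ?_
      gcongr
    have h2 := young_le (a := γ) (b := K ^ 2 * (H + Q)) (ε := ν / 4) (by positivity)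
    have h3 := young_le (a := b) (b := K ^ 2 * (H + Q)) (ε := ν / 4) (by positivity)
    have h4 : (H + Q) ^ 2 ≤ 2 * (H ^ 2 + Q ^ 2) := add_sq_le
    have h5 : (K ^ 2 * (H + Q)) ^ 2 / (4 * (ν / 4)) ≤ K ^ 4 / ν * (2 * (H ^ 2 + Q ^ 2)) := by
      have : (K ^ 2 * (H + Q)) ^ 2 / (4 * (ν / 4)) = K ^ 4 / ν * (H + Q) ^ 2 := by
        field_simp
      rw [this]
      gcongr
    have h6 : K ^ 2 * ((H + Q) * Q) ≤ 3 * K ^ 2 * (H ^ 2 + Q ^ 2) := by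
      have : (H + Q) * Q ≤ (H + Q) * (H + Q) :=
        mul_le_mul_of_nonneg_left (by linarith) (by linarith)
      have : (H + Q) * Q ≤ 3 * (H ^ 2 + Q ^ 2) := by linarith [sq_nonneg H, sq_nonneg Q]
      have := mul_le_mul_of_nonneg_left this (sq_nonneg K)
      linarith
    have h7 : K * ((H + Q) * (K * (γ + b + Q))) = γ * (K ^ 2 * (H + Q)) + b * (K ^ 2 * (H + Q))
      + K ^ 2 * ((H + Q) * Q) := by ring
    have h8 : (4 * K ^ 4 / ν + 3 * K ^ 2) * (H ^ 2 + Q ^ 2) = 2 * (K ^ 4 / ν * (2 * (H ^ 2 + Q ^ 2)))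
      + 3 * K ^ 2 * (H ^ 2 + Q ^ 2) := by ring
    linarith
  have t8 := mul_le_mul_of_nonneg_left t6 hs
  have t9 : K * (γ * (s * D) + (Λ + b) * (s * D + s * Q) + (H + Q) * (π + s * D) + s * b ^ 2)
      = K * ((H + Q) * π) + s * (K * (γ * D + (Λ + b) * (D + Q) + (H + Q) * D + b * b)) := by ring
  rw [t9] at hV
  have t10 := mul_le_mul_of_nonneg_left (add_le_add t7 t8) hs
  linarith

theorem potential_decrease {K s γ b D H Q dP : ℝ} (hK : 1 ≤ K)
    (hs : 0 < s) (hγ : 0 ≤ γ) (hb : 0 ≤ b)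
    (hD : 0 ≤ D) (hH : 0 ≤ H) (hQ : 0 ≤ Q)
    (hP : s * dP ≤ -((s * D) ^ 2 / 2) + s * (K * ((γ + s * D + (H + Q) + s * Q) * (s * D)
      + s * b ^ 2 + s * (b * (s * D + s * Q))))) :
    dP ≤ s * (-(D ^ 2 / 4) + 2 * K ^ 2 * γ ^ 2 + K * b ^ 2 + 4 * K ^ 2 * (H ^ 2 + Q ^ 2)
      + 15 * K * (s * (γ ^ 2 + b ^ 2 + D ^ 2 + H ^ 2 + Q ^ 2))) := by
  have h1 : dP ≤ s * (-(D ^ 2 / 2) + K * ((γ + (H + Q)) * D + b ^ 2)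
      + s * (K * (D * D + Q * D + b * (D + Q)))) := by
    refine le_of_mul_le_mul_left ?_ hs
    refine hP.trans (le_of_eq ?_)
    ring
  set T := γ + b + D + H + Q with hT
  set S := γ ^ 2 + b ^ 2 + D ^ 2 + H ^ 2 + Q ^ 2 with hS
  have hT0 : 0 ≤ T := by positivity
  have hTS : T ^ 2 ≤ 5 * S := sum_five_sq_le γ b D H Q
  have hK0 : 0 ≤ K := by linarith
  have t1 : D * D ≤ T * T := mul_le_mul (by linarith) (by linarith) hD hT0
  have t2 : Q * D ≤ T * T := mul_le_mul (by linarith) (by linarith) hD hT0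
  have t3 : b * (D + Q) ≤ T * T := mul_le_mul (by linarith) (by linarith) (by linarith) hT0
  have t4 : K * (D * D + Q * D + b * (D + Q)) ≤ 15 * K * S := by
    have := mul_le_mul_of_nonneg_left (by linarith : D * D + Q * D + b * (D + Q) ≤ 15 * S) hK0
    linarith
  have t5 := sq_nonneg (D - 4 * (K * γ))
  have t6 := sq_nonneg (D - 4 * (K * (H + Q)))
  have t7 : K ^ 2 * (H + Q) ^ 2 ≤ K ^ 2 * (2 * (H ^ 2 + Q ^ 2)) := by
    gcongr
    exact add_sq_le
  have t8 := mul_le_mul_of_nonneg_left t4 hs.le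
  refine h1.trans (mul_le_mul_of_nonneg_left ?_ hs.le)
  linarith

/-- The decrease of the Lyapunov function in a perturbed step close to the equilibrium. -/
theorem lyapunov_decrease {K ν μ κ₀ : ℝ} (hK : 1 ≤ K) (hν : 0 < ν) (hμ0 : 0 ≤ μ) (hμ1 : μ < 1)
    (hκ₀ : 0 < κ₀) :
    ∃ κ θ c sbar : ℝ, 0 < κ ∧ κ ≤ κ₀ ∧ 0 < θ ∧ θ ≤ 1 ∧ 0 < c ∧ 0 < sbar ∧ sbar ≤ 1 ∧
      ∀ s γ π Λ b δ H Q H' Q' dV dP l : ℝ, 0 < s → s ≤ sbar → 0 ≤ γ → 0 ≤ π → 0 ≤ Λ → 0 ≤ b →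
      0 ≤ δ → 0 ≤ H → 0 ≤ Q → 0 ≤ H' →
      dV ≤ s * (-2 * (l + ν * γ ^ 2 + ν * b ^ 2) + K * (γ * δ
        + (Λ + b) * (δ + s * Q) + (H + Q) * (π + δ) + s * b ^ 2)) →
      s * dP ≤ -(δ ^ 2 / 2) + s * (K * ((γ + δ + (H + Q) + s * Q) * δ
        + s * b ^ 2 + s * (b * (δ + s * Q)))) →
      π ≤ K * (γ + b + s * Q) → s * Λ ≤ K * (δ + s * (γ + π + b + (H + Q))) →
      H' ≤ μ * H + K * (s * b + δ) → Q' = μ * Q + 4 * H →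
      dV + κ * dP + (H' ^ 2 - H ^ 2) + θ * (Q' ^ 2 - Q ^ 2) + 2 * s * l
        ≤ -(c * s * (γ ^ 2 + π ^ 2 + Λ ^ 2 + H ^ 2 + Q ^ 2)) := by
  have hμ : 0 < 1 - μ := by linarith
  -- With this bound the growth of the potential in γ and b stays below ν / 4 times their squares.
  set κ := min κ₀ (min 1 (ν / (8 * K ^ 2))) with hκ
  have hκ0 : 0 < κ := lt_min hκ₀ (lt_min one_pos (by positivity))
  have hκ1 : κ ≤ 1 := (min_le_right _ _).trans (min_le_left _ _)
  have hκ2 : κ * (8 * K ^ 2) ≤ ν :=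
    (le_div_iff₀ (by positivity)).1 ((min_le_right _ _).trans (min_le_right _ _))
  -- The forcing of `Q` by `4 * H` then uses up exactly half of the decay of `H ^ 2`, as checked in
  -- `h6`.
  set θ := (1 - μ) ^ 2 / 32 with hθ
  have hθ0 : 0 < θ := by positivity
  have hθ1 : θ ≤ 1 := by
    have : (1 - μ) ^ 2 ≤ 1 := pow_le_one₀ hμ.le (by linarith)
    rw [hθ]
    linarith
  set η := θ * (1 - μ) with hη
  have hη0 : 0 < η := by positivity
  have hη1 : η ≤ (1 - μ) / 2 := by
    rw [hη]
    have : θ ≤ 1 / 2 := by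
      have : (1 - μ) ^ 2 ≤ 1 := pow_le_one₀ hμ.le (by linarith)
      rw [hθ]
      linarith
    have := mul_le_mul_of_nonneg_right this hμ.le
    linarith
  set C2 := 4 * K ^ 4 / ν + 3 * K ^ 2 + 4 * K ^ 2 with hC2
  have hC20 : 0 < C2 := by positivity
  set C3 := 45 * K ^ 3 + 2 * K ^ 2 / (1 - μ) with hC3
  have hC30 : 0 < C3 := by positivity
  set c0 := min ν (min (κ / 4) (η / 2)) with hc0
  have hc00 : 0 < c0 := lt_min hν (lt_min (by positivity) (by positivity))
  set c := c0 / (52 * K ^ 4) with hc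
  have hcp : 0 < c := by positivity
  -- The first threshold lets the decay of the filters absorb the `C2` terms, the second lets half
  -- of `c0 * S` absorb the terms with an extra factor `s`. The 52 in `c` is twice 26 = 5 + 20 + 1,
  -- the bounds for π², Λ² and the rest in units of `K ^ 4 * S`.
  refine ⟨κ, θ, c, min 1 (min (η / (2 * C2)) (c0 / (2 * C3))), hκ0, min_le_left _ _, hθ0, hθ1, hcp,
    lt_min one_pos (lt_min (by positivity) (by positivity)), min_le_left _ _, ?_⟩
  intro s γ π Λ b δ H Q H' Q' dV dP l hs hsb hγ hπ hΛ hb hδ hH hQ hH' hV hP hπK hΛK hHK hQK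
  have hs1 : s ≤ 1 := hsb.trans (min_le_left _ _)
  have hs2 : s * (2 * C2) ≤ η :=
    (le_div_iff₀ (by positivity)).1 (hsb.trans ((min_le_right _ _).trans (min_le_left _ _)))
  have hs3 : s * (2 * C3) ≤ c0 :=
    (le_div_iff₀ (by positivity)).1 (hsb.trans ((min_le_right _ _).trans (min_le_right _ _)))
  obtain ⟨D, rfl⟩ : ∃ D, δ = s * D := ⟨δ / s, by field_simp⟩
  have hD : 0 ≤ D := nonneg_of_mul_nonneg_right hδ hs
  have hK0 : 0 ≤ K := by linarith
  have hKK : K ≤ K ^ 2 := le_self_pow₀ hK (by norm_num)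
  set T := γ + b + D + H + Q with hT
  set S := γ ^ 2 + b ^ 2 + D ^ 2 + H ^ 2 + Q ^ 2 with hS
  have hS0 : 0 ≤ S := by positivity
  have hT0 : 0 ≤ T := by positivity
  have hTS : T ^ 2 ≤ 5 * S := sum_five_sq_le γ b D H Q
  have hsQ : s * Q ≤ Q := mul_le_of_le_one_left hQ hs1
  have hπT : π ≤ K * T := hπK.trans (mul_le_mul_of_nonneg_left (by linarith) hK0)
  have hΛ' : Λ ≤ K * (D + (γ + π + b + (H + Q))) := by
    refine le_of_mul_le_mul_left ?_ hs
    linarith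
  have hΛT : Λ ≤ 2 * K ^ 2 * T := by
    have h1 : K * (D + (γ + π + b + (H + Q))) ≤ K * (T + K * T) :=
      mul_le_mul_of_nonneg_left (by linarith) hK0
    have h2 := mul_le_mul_of_nonneg_right hKK hT0
    linarith
  have h1 := energy_decrease hK hν hs.le hs1 hγ hb hD hH hQ hπK hΛT hV
  have h2 := mul_le_mul_of_nonneg_left (potential_decrease hK hs hγ hb hD hH hQ hP) hκ0.le
  have h3 := sq_filter_le hμ0 hμ1 hH' hHK
  have h4 := sq_filter_le hμ0 hμ1 (by rw [hQK]; positivity) hQK.le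
  have h5 : (K * (s * b + s * D)) ^ 2 / (1 - μ) ≤ s * (2 * K ^ 2 / (1 - μ) * (s * S)) := by
    have h6 : (b + D) ^ 2 ≤ 2 * S := by
      have := add_sq_le (a := b) (b := D)
      linarith [sq_nonneg γ, sq_nonneg H, sq_nonneg Q]
    have h7 : (K * (s * b + s * D)) ^ 2 / (1 - μ) = s * (K ^ 2 / (1 - μ) * (s * (b + D) ^ 2)) := by
      ring
    have h8 : s * (2 * K ^ 2 / (1 - μ) * (s * S)) = s * (K ^ 2 / (1 - μ) * (s * (2 * S))) := by ring
    rw [h7, h8]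
    gcongr
  have h6 : θ * ((4 * H) ^ 2 / (1 - μ)) = (1 - μ) / 2 * H ^ 2 := by
    rw [hθ]
    field_simp
    ring
  have h7 := mul_le_mul_of_nonneg_left h4 hθ0.le
  -- the bound in terms of `S`
  have hκK1 : κ * (2 * K ^ 2 * γ ^ 2 + K * b ^ 2) ≤ ν / 4 * (γ ^ 2 + b ^ 2) := by
    have h8 : κ * (2 * K ^ 2) ≤ ν / 4 := by linarith
    have h9 : κ * K ≤ ν / 4 := by
      have := mul_le_mul_of_nonneg_left hKK hκ0.le
      have : 0 ≤ κ * K ^ 2 := by positivity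
      linarith
    have h10 := mul_le_mul_of_nonneg_right h8 (sq_nonneg γ)
    have h11 := mul_le_mul_of_nonneg_right h9 (sq_nonneg b)
    linarith
  have hκ3 : κ * (4 * K ^ 2 * (H ^ 2 + Q ^ 2)) ≤ 4 * K ^ 2 * (H ^ 2 + Q ^ 2) :=
    mul_le_of_le_one_left (by positivity) hκ1
  have hκ4 : κ * (15 * K * (s * S)) ≤ 15 * K ^ 3 * (s * S) := by
    refine (mul_le_of_le_one_left (by positivity) hκ1).trans ?_
    have : K ≤ K ^ 3 := le_self_pow₀ hK (by norm_num)
    gcongr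
  have hbr := mul_le_mul_of_nonneg_left (add_le_add (add_le_add hκK1 hκ3) hκ4) hs.le
  have e1 : dV + κ * dP + (H' ^ 2 - H ^ 2) + θ * (Q' ^ 2 - Q ^ 2) + 2 * s * l ≤
      s * (-(3 / 2) * ν * (γ ^ 2 + b ^ 2) - κ / 4 * D ^ 2 + C2 * (H ^ 2 + Q ^ 2) + C3 * (s * S))
      - η * (H ^ 2 + Q ^ 2) := by
    have h8 : (1 - μ) / 2 * H ^ 2 ≥ η * H ^ 2 := mul_le_mul_of_nonneg_right hη1 (sq_nonneg H)
    rw [hη] at h8 ⊢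
    rw [hC2, hC3]
    linarith
  have e2 : s * (C2 * (H ^ 2 + Q ^ 2)) ≤ η / 2 * (H ^ 2 + Q ^ 2) := by
    have := mul_le_mul_of_nonneg_right hs2 (by positivity : 0 ≤ H ^ 2 + Q ^ 2)
    linarith
  have e3 : s * (η / 2 * (H ^ 2 + Q ^ 2)) ≤ η / 2 * (H ^ 2 + Q ^ 2) :=
    mul_le_of_le_one_left (by positivity) hs1
  have e4 : c0 * S ≤ 3 / 2 * ν * (γ ^ 2 + b ^ 2) + κ / 4 * D ^ 2 + η / 2 * (H ^ 2 + Q ^ 2) := by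
    have f1 : c0 ≤ ν := min_le_left _ _
    have f2 : c0 ≤ κ / 4 := (min_le_right _ _).trans (min_le_left _ _)
    have f3 : c0 ≤ η / 2 := (min_le_right _ _).trans (min_le_right _ _)
    have g1 := mul_le_mul_of_nonneg_right f1 (by positivity : 0 ≤ γ ^ 2 + b ^ 2)
    have g2 := mul_le_mul_of_nonneg_right f2 (by positivity : 0 ≤ D ^ 2)
    have g3 := mul_le_mul_of_nonneg_right f3 (by positivity : 0 ≤ H ^ 2 + Q ^ 2)
    have g4 : 0 ≤ ν * (γ ^ 2 + b ^ 2) := by positivity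
    rw [hS]
    linarith
  have e5 : s * (C3 * (s * S)) ≤ s * (c0 / 2 * S) := by
    have := mul_le_mul_of_nonneg_right hs3 hS0
    refine mul_le_mul_of_nonneg_left ?_ hs.le
    linarith
  have e6 : dV + κ * dP + (H' ^ 2 - H ^ 2) + θ * (Q' ^ 2 - Q ^ 2) + 2 * s * l
      ≤ -(s * (c0 / 2 * S)) := by
    have := mul_le_mul_of_nonneg_left e4 hs.le
    linarith
  refine e6.trans (neg_le_neg ?_)
  have z1 : π ^ 2 ≤ K ^ 4 * (5 * S) := by
    have : K ^ 2 ≤ K ^ 4 := pow_le_pow_right₀ hK (by norm_num)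
    calc π ^ 2 ≤ (K * T) ^ 2 := pow_le_pow_left₀ hπ hπT 2
      _ = K ^ 2 * T ^ 2 := by ring
      _ ≤ K ^ 4 * (5 * S) := mul_le_mul this hTS (sq_nonneg _) (by positivity)
  have z2 : Λ ^ 2 ≤ 4 * K ^ 4 * (5 * S) := by
    calc Λ ^ 2 ≤ (2 * K ^ 2 * T) ^ 2 := pow_le_pow_left₀ hΛ hΛT 2
      _ = 4 * K ^ 4 * T ^ 2 := by ring
      _ ≤ _ := mul_le_mul_of_nonneg_left hTS (by positivity)
  have z3 : S ≤ K ^ 4 * S := le_mul_of_one_le_left hS0 (one_le_pow₀ hK)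
  have z4 : γ ^ 2 + π ^ 2 + Λ ^ 2 + H ^ 2 + Q ^ 2 ≤ 26 * K ^ 4 * S := by
    have : γ ^ 2 + H ^ 2 + Q ^ 2 ≤ S := by
      rw [hS]
      linarith [sq_nonneg b, sq_nonneg D]
    linarith
  have z5 : c * (26 * K ^ 4) = c0 / 2 := by
    rw [hc]
    field_simp
    norm_num
  calc c * s * (γ ^ 2 + π ^ 2 + Λ ^ 2 + H ^ 2 + Q ^ 2) ≤ c * s * (26 * K ^ 4 * S) := by gcongr
    _ = s * (c * (26 * K ^ 4) * S) := by ring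
    _ = _ := by rw [z5]

end Scalar

namespace SCED

/-! ### Drift of the multipliers far from the equilibrium. -/

section Far

variable {V : Type*} [Fintype V] [DecidableEq V] {D : SCED V} {u : D.Triple} {m : ℝ}

/-- The generation profile favoured by the multipliers of `x`. -/
noncomputable def targetG (u : D.Triple) (x : D.Iterate) (i : V) : ℝ :=
  clip (D.gmin i) (D.gmax i) (u.g i + -(x.lam - u.lam) i)

/-- The flow profile favoured by the multipliers of `x`. -/
noncomputable def targetP (u : D.Triple) (x : D.Iterate) (e : D.Line) : ℝ :=
  clip (-D.pmax e) (D.pmax e)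
    (u.p e + ((x.lam - u.lam) (D.up e) - (x.lam - u.lam) (D.down e)))

/-- A Lyapunov function for multipliers that are far from the equilibrium. -/
noncomputable def farEnergy (u : D.Triple) (s : ℝ) (x : D.Iterate) : ℝ :=
  ∑ i, (x.lam i - u.lam i) ^ 2 + D.primalDist (targetG u x) (targetP u x) x
    + 2 * s * ∑ i, (x.lam i - u.lam i) * D.meanImbalance x i

theorem exists_box_width (D : SCED V) :
    ∃ M : ℝ, 0 ≤ M ∧ (∀ i, ∀ a ∈ Set.Icc (D.gmin i) (D.gmax i),
      ∀ b ∈ Set.Icc (D.gmin i) (D.gmax i), |a - b| ≤ M) ∧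
      ∀ e, ∀ a ∈ Set.Icc (-D.pmax e) (D.pmax e), ∀ b ∈ Set.Icc (-D.pmax e) (D.pmax e),
        |a - b| ≤ M := by
  refine ⟨∑ i, |D.gmax i - D.gmin i| + ∑ e, |2 * D.pmax e|, by positivity,
    fun i a ha b hb => ?_, fun e a ha b hb => ?_⟩
  · have h1 := Finset.single_le_sum (f := fun i => |D.gmax i - D.gmin i|)
      (fun i _ => abs_nonneg _) (Finset.mem_univ i)
    have h2 : 0 ≤ ∑ e, |2 * D.pmax e| := by positivity
    have h3 := le_abs_self (D.gmax i - D.gmin i)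
    rw [abs_le]
    constructor <;> linarith [ha.1, ha.2, hb.1, hb.2]
  · have h1 := Finset.single_le_sum (f := fun e => |2 * D.pmax e|)
      (fun i _ => abs_nonneg _) (Finset.mem_univ e)
    have h2 : 0 ≤ ∑ i, |D.gmax i - D.gmin i| := by positivity
    have h3 := le_abs_self (2 * D.pmax e)
    rw [abs_le]
    constructor <;> linarith [ha.1, ha.2, hb.1, hb.2]

theorem Optimal.localImbalance_eq (hu : D.Optimal u) (x : D.Iterate) (i : V) :
    D.localImbalance i x = (x.g i - u.g i)
      - (∑ e : D.Line, if D.up e = i then x.phat e - u.p e else 0)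
      + ∑ e : D.Line, if D.down e = i then x.pbrv e - u.p e else 0 := by
  have h1 : ∀ (h : D.Line → V) (v w : D.Line → ℝ), (∑ e : D.Line, if h e = i then v e - w e else 0)
      = (∑ e : D.Line, if h e = i then v e else 0) - ∑ e : D.Line, if h e = i then w e else 0 := by
    intro h v w
    rw [← Finset.sum_sub_distrib]
    refine Finset.sum_congr rfl fun e _ => ?_
    split_ifs <;> simp
  have h2 := hu.balance i
  unfold div at h2
  rw [h1, h1, localImbalance]
  linarith

theorem Optimal.abs_localImbalance_le (hu : D.Optimal u) (x : D.Iterate) (i : V) :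
    |D.localImbalance i x| ≤ (1 + 2 * Fintype.card D.Line) * (‖x.g - u.g‖ + flowDist u x) := by
  have h1 := norm_le_pi_norm (x.g - u.g) i
  have h2 := abs_sum_ite_le (h := D.up) (i := i) (flowDist_nonneg x)
    (abs_phat_sub_le_flowDist (u := u) x)
  have h3 := abs_sum_ite_le (h := D.down) (i := i) (flowDist_nonneg x)
    (abs_pbrv_sub_le_flowDist (u := u) x)
  have h4 := norm_nonneg (x.g - u.g)
  have h5 := flowDist_nonneg (u := u) x
  have h6 : (0 : ℝ) ≤ Fintype.card D.Line := by positivity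
  have h7 := mul_nonneg h6 h4
  rw [Pi.sub_apply, Real.norm_eq_abs] at h1
  rw [hu.localImbalance_eq]
  rw [abs_le] at *
  constructor <;> linarith

theorem primalDist_sub_le {x : D.Iterate} {a a' : V → ℝ} {w w' : D.Line → ℝ} {M r : ℝ}
    (ha : ∀ i, |a' i - a i| ≤ r) (hw : ∀ e, |w' e - w e| ≤ r)
    (h1 : ∀ i, |x.g i - a i| ≤ M) (h1' : ∀ i, |x.g i - a' i| ≤ M)
    (h2 : ∀ e, |x.phat e - w e| ≤ M) (h2' : ∀ e, |x.phat e - w' e| ≤ M)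
    (h3 : ∀ e, |x.pbrv e - w e| ≤ M) (h3' : ∀ e, |x.pbrv e - w' e| ≤ M) :
    D.primalDist a' w' x - D.primalDist a w x
      ≤ (Fintype.card V + Fintype.card D.Line) * (r * (2 * M)) := by
  have key : ∀ {z a a' : ℝ}, |a' - a| ≤ r → |z - a| ≤ M → |z - a'| ≤ M →
      (z - a') ^ 2 - (z - a) ^ 2 ≤ r * (2 * M) := by
    intro z a a' h h' h''
    have e1 : (z - a') ^ 2 - (z - a) ^ 2 = (a - a') * ((z - a) + (z - a')) := by ring
    rw [e1]
    refine (le_abs_self _).trans ?_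
    rw [abs_mul, abs_sub_comm]
    refine mul_le_mul h ((abs_add_le _ _).trans (by linarith)) (abs_nonneg _)
      ((abs_nonneg _).trans h)
  have s1 : ∑ i, ((x.g i - a' i) ^ 2 - (x.g i - a i) ^ 2) ≤ Fintype.card V * (r * (2 * M)) := by
    rw [← nsmul_eq_mul, ← Finset.card_univ]
    exact Finset.sum_le_card_nsmul _ _ _ fun i _ => key (ha i) (h1 i) (h1' i)
  have s2 : ∑ e, (((x.phat e - w' e) ^ 2 + (x.pbrv e - w' e) ^ 2)
      - ((x.phat e - w e) ^ 2 + (x.pbrv e - w e) ^ 2))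
      ≤ Fintype.card D.Line * (2 * (r * (2 * M))) := by
    rw [← nsmul_eq_mul, ← Finset.card_univ]
    refine Finset.sum_le_card_nsmul _ _ _ fun e _ => ?_
    linarith [key (hw e) (h2 e) (h2' e), key (hw e) (h3 e) (h3' e)]
  rw [Finset.sum_sub_distrib] at s1 s2
  unfold primalDist
  linarith

/-- Bounds that hold for all iterates within the box constraints. -/
theorem Optimal.exists_box_bounds (hu : D.Optimal u) (hc : D.CostAssumption m) :
    ∃ M : ℝ, 0 ≤ M ∧ (∀ i, ∀ a ∈ Set.Icc (D.gmin i) (D.gmax i),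
      ∀ b ∈ Set.Icc (D.gmin i) (D.gmax i), |a - b| ≤ M) ∧
      (∀ e, ∀ a ∈ Set.Icc (-D.pmax e) (D.pmax e), ∀ b ∈ Set.Icc (-D.pmax e) (D.pmax e),
        |a - b| ≤ M) ∧ (∀ i, |u.lam i| ≤ M) ∧ ∀ x : D.Iterate, D.InBox x → ∀ i,
      |deriv (D.f i) (x.g i)| ≤ M ∧ |D.localImbalance i x| ≤ M ∧ |D.meanImbalance x i| ≤ M := by
  obtain ⟨Cf, hCf0, hCf⟩ := hc.exists_abs_deriv_sub_le u.g
  obtain ⟨M, hM, hMg, hMp⟩ := D.exists_box_width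
  set n : ℝ := (Fintype.card D.Line : ℝ) with hn
  have hn0 : 0 ≤ n := by positivity
  set F : ℝ := ‖fun i => deriv (D.f i) (u.g i)‖ with hF
  have hF0 : 0 ≤ F := norm_nonneg _
  have hCM : 0 ≤ Cf * M := by positivity
  have hnM : 0 ≤ (1 + 2 * n) * (2 * M) := by positivity
  refine ⟨M + F + Cf * M + (1 + 2 * n) * (2 * M) + ‖u.lam‖, by positivity,
    fun i a ha b hb => (hMg i a ha b hb).trans ?_, fun e a ha b hb => (hMp e a ha b hb).trans ?_,
    fun i => (norm_le_pi_norm u.lam i).trans ?_, fun x hx i => ?_⟩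
  · linarith [norm_nonneg u.lam]
  · linarith [norm_nonneg u.lam]
  · linarith
  · have hγ : ‖x.g - u.g‖ ≤ M :=
      (pi_norm_le_iff_of_nonneg hM).2 fun i => hMg i _ (hx.g_mem i) _ (hu.g_mem i)
    have hπ : flowDist u x ≤ M := max_le
      ((pi_norm_le_iff_of_nonneg hM).2 fun e => hMp e _ (hx.phat_mem e) _ (hu.p_mem e))
      ((pi_norm_le_iff_of_nonneg hM).2 fun e => hMp e _ (hx.pbrv_mem e) _ (hu.p_mem e))
    have h1 : (1 + 2 * n) * (‖x.g - u.g‖ + flowDist u x) ≤ (1 + 2 * n) * (2 * M) := by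
      gcongr
      linarith
    have h2 := hu.abs_localImbalance_le x i
    have h3 := hu.abs_meanImbalance_le x i
    rw [← hn] at h2 h3
    have h4 := hCf i _ (hx.g_mem i)
    have h5 := mul_le_mul_of_nonneg_left (hMg i _ (hx.g_mem i) _ (hu.g_mem i)) hCf0
    have h6 : |deriv (D.f i) (u.g i)| ≤ F := norm_le_pi_norm (fun i => deriv (D.f i) (u.g i)) i
    have h7 := abs_add_le (deriv (D.f i) (x.g i) - deriv (D.f i) (u.g i)) (deriv (D.f i) (u.g i))
    rw [sub_add_cancel] at h7
    have h8 := norm_nonneg u.lam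
    refine ⟨?_, ?_, ?_⟩ <;> linarith

/-- The box is bounded, so everything besides the squared multiplier distance grows at most linearly
in that distance. -/
theorem Optimal.farEnergy_bounds (hu : D.Optimal u) (hc : D.CostAssumption m)
    (hg : ∀ i, D.gmin i ≤ D.gmax i) (hp : ∀ e, 0 ≤ D.pmax e) :
    ∃ K : ℝ, 0 ≤ K ∧ ∀ s : ℝ, 0 ≤ s → s ≤ 1 → ∀ x : D.Iterate, D.InBox x →
      ‖x.lam - u.lam‖ ^ 2 - K * ‖x.lam - u.lam‖ ≤ farEnergy u s x ∧
      farEnergy u s x ≤ Fintype.card V * ‖x.lam - u.lam‖ ^ 2 + K * ‖x.lam - u.lam‖ + K := by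
  obtain ⟨M, hM, hMg, hMp, -, hMx⟩ := hu.exists_box_bounds hc
  set N : ℝ := (Fintype.card V : ℝ) with hN
  set n : ℝ := (Fintype.card D.Line : ℝ) with hn
  have hN0 : 0 ≤ N := by positivity
  have hn0 : 0 ≤ n := by positivity
  refine ⟨2 * N * M + (N + n) * M ^ 2, by positivity, fun s hs hs1 x hx => ?_⟩
  set Λ := ‖x.lam - u.lam‖
  have hΛ0 : 0 ≤ Λ := norm_nonneg _
  have hΛi : ∀ i, |x.lam i - u.lam i| ≤ Λ := fun i => norm_le_pi_norm (x.lam - u.lam) i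
  have h1 : Λ ^ 2 ≤ ∑ i, (x.lam i - u.lam i) ^ 2 := norm_sq_le_sum (x.lam - u.lam)
  have h2 := sum_sq_le_norm_sq hΛi
  have h3 := abs_le.1 (abs_sum_mul_le hΛi fun i => (hMx x hx i).2.2)
  have htg : ∀ i, targetG u x i ∈ Set.Icc (D.gmin i) (D.gmax i) := fun i => clip_mem (hg i) _
  have htp : ∀ e, targetP u x e ∈ Set.Icc (-D.pmax e) (D.pmax e) :=
    fun e => clip_mem (by linarith [hp e]) _
  have h4 : 0 ≤ D.primalDist (targetG u x) (targetP u x) x := by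
    unfold primalDist
    positivity
  have h5 := sum_sq_le_norm_sq (v := fun i => x.g i - targetG u x i)
    fun i => hMg i _ (hx.g_mem i) _ (htg i)
  have h6 := sum_sq_le_norm_sq (v := fun e => x.phat e - targetP u x e)
    fun e => hMp e _ (hx.phat_mem e) _ (htp e)
  have h7 := sum_sq_le_norm_sq (v := fun e => x.pbrv e - targetP u x e)
    fun e => hMp e _ (hx.pbrv_mem e) _ (htp e)
  simp only [← hN, ← hn] at h2 h3 h5 h6 h7
  have h8 : D.primalDist (targetG u x) (targetP u x) x ≤ (N + n) * M ^ 2 := by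
    unfold primalDist
    rw [Finset.sum_add_distrib]
    linarith
  have h9 : s * (N * (Λ * M)) ≤ N * (Λ * M) := mul_le_of_le_one_left (by positivity) hs1
  have h10 := mul_le_mul_of_nonneg_left h3.1 hs
  have h11 := mul_le_mul_of_nonneg_left h3.2 hs
  have h12 : 0 ≤ (N + n) * M ^ 2 * Λ := by positivity
  have h13 : 0 ≤ N * M := by positivity
  unfold farEnergy
  constructor <;> linarith

theorem Optimal.sum_mul_target (hu : D.Optimal u) (v a : V → ℝ) (w : D.Line → ℝ) :
    ∑ i, v i * (a i - D.l i - D.div w i) = ∑ i, v i * (a i - u.g i)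
      - ∑ e : D.Line, (v (D.up e) - v (D.down e)) * (w e - u.p e) := by
  rw [← sum_mul_div v (fun e => w e - u.p e), ← Finset.sum_sub_distrib]
  refine Finset.sum_congr rfl fun i _ => ?_
  rw [div_sub]
  linear_combination v i * (hu.balance i)

/-- The primal inequality relative to the favoured profile contains the pairing of λ - λ* with the
new imbalance, the dual update that with the old one. The cross term of `farEnergy` cancels both,
leaving the pairing with the imbalance of the favoured profile, which is at most c - c‖λ - λ*‖.
Moving the profile costs only O(s). -/
theorem Optimal.far_step (h : D.IsRadial) (hu : D.Optimal u) (hc : D.CostAssumption m)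
    (hunique : ∀ u', D.IsEquilibrium u' → u' = u)
    (hg : ∀ i, D.gmin i ≤ D.gmax i) (hp : ∀ e, 0 ≤ D.pmax e) (hρ : 0 ≤ D.ρ) :
    ∃ c K : ℝ, 0 < c ∧ 0 ≤ K ∧ ∀ s h Q : ℝ, 0 ≤ s → s ≤ 1 → 0 ≤ h → 0 ≤ Q → ∀ x x' : D.Iterate,
      D.InBox x → D.InBox x' → D.PerturbedStep s h Q x x' →
      farEnergy u s x' ≤ farEnergy u s x
        - s * (c * ‖x.lam - u.lam‖ - K * (1 + h + s * Q * ‖x.lam - u.lam‖)) := by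
  obtain ⟨c, hc0, hgap⟩ := hu.exists_mul_norm_le_gap h (fun i => (hc i).1) hunique
  obtain ⟨M, hM, hMg, hMp, hMl, hMx⟩ := hu.exists_box_bounds hc
  set N : ℝ := (Fintype.card V : ℝ) with hN
  set n : ℝ := (Fintype.card D.Line : ℝ) with hn
  have hN0 : 0 ≤ N := by positivity
  have hn0 : 0 ≤ n := by positivity
  set K0 := 2 * (N * (M * M)) + 2 * (N * ((M + D.ρ * M) * ((1 + 2 * n) * M))) + N * M ^ 2
    + 2 * (N * (M * M)) + (N + n) * (2 * M * (2 * M)) + 2 * c with hK0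
  have hK00 : 0 ≤ K0 := by positivity
  refine ⟨2 * c, K0 + n * (2 * M) + 2 * (N * n), by positivity, by positivity, ?_⟩
  intro s hh Q hs hs1 hh0 hQ x x' hx hx' hst
  set Λ := ‖x.lam - u.lam‖
  have hΛ0 : 0 ≤ Λ := norm_nonneg _
  have hΛi : ∀ i, |x.lam i - u.lam i| ≤ Λ := fun i => norm_le_pi_norm (x.lam - u.lam) i
  have hsQ : 0 ≤ s * Q := mul_nonneg hs hQ
  have htg : ∀ (x : D.Iterate) i, targetG u x i ∈ Set.Icc (D.gmin i) (D.gmax i) :=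
    fun x i => clip_mem (hg i) _
  have htp : ∀ (x : D.Iterate) e, targetP u x e ∈ Set.Icc (-D.pmax e) (D.pmax e) :=
    fun x e => clip_mem (by linarith [hp e]) _
  have hprim := hst.primalDist_le hs (htg x) (htp x)
  have hb := fun i => (hMx x hx i).2.1
  have hβ' := fun i => (hMx x' hx' i).2.2
  -- moving the target
  have hmove := primalDist_sub_le (x := x') (a := targetG u x) (a' := targetG u x')
    (w := targetP u x) (w' := targetP u x') (M := M) (r := s * (2 * M)) (fun i => by
      refine (abs_clip_sub_clip_le _ _).trans ?_
      have : u.g i + -(x'.lam - u.lam) i - (u.g i + -(x.lam - u.lam) i)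
          = -(s * D.localImbalance i x) := by
        simp only [Pi.sub_apply, hst.lam_step]
        ring
      rw [this, abs_neg, abs_mul, abs_of_nonneg hs]
      gcongr
      linarith [hb i])
    (fun e => by
      refine (abs_clip_sub_clip_le _ _).trans ?_
      have : u.p e + ((x'.lam - u.lam) (D.up e) - (x'.lam - u.lam) (D.down e))
          - (u.p e + ((x.lam - u.lam) (D.up e) - (x.lam - u.lam) (D.down e)))
          = s * (D.localImbalance (D.up e) x - D.localImbalance (D.down e) x) := by
        simp only [Pi.sub_apply, hst.lam_step]
        ring
      rw [this, abs_mul, abs_of_nonneg hs]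
      gcongr
      linarith [abs_sub (D.localImbalance (D.up e) x) (D.localImbalance (D.down e) x),
        hb (D.up e), hb (D.down e)])
    (fun i => hMg i _ (hx'.g_mem i) _ (htg x i)) (fun i => hMg i _ (hx'.g_mem i) _ (htg x' i))
    (fun e => hMp e _ (hx'.phat_mem e) _ (htp x e)) (fun e => hMp e _ (hx'.phat_mem e) _ (htp x' e))
    (fun e => hMp e _ (hx'.pbrv_mem e) _ (htp x e)) (fun e => hMp e _ (hx'.pbrv_mem e) _ (htp x' e))
  -- the multipliers
  have hlam : ∑ i, (x'.lam i - u.lam i) ^ 2 = ∑ i, (x.lam i - u.lam i) ^ 2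
      + 2 * s * ∑ i, (x.lam i - u.lam i) * D.localImbalance i x
      + s ^ 2 * ∑ i, D.localImbalance i x ^ 2 := by
    rw [Finset.mul_sum, Finset.mul_sum, ← Finset.sum_add_distrib, ← Finset.sum_add_distrib]
    refine Finset.sum_congr rfl fun i _ => ?_
    rw [hst.lam_step]
    ring
  have hcross : ∑ i, (x'.lam i - u.lam i) * D.meanImbalance x' i
      = ∑ i, (x.lam i - u.lam i) * D.meanImbalance x' i
      + s * ∑ i, D.localImbalance i x * D.meanImbalance x' i := by
    rw [Finset.mul_sum, ← Finset.sum_add_distrib]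
    refine Finset.sum_congr rfl fun i _ => ?_
    rw [hst.lam_step]
    ring
  set βt : V → ℝ := fun i => targetG u x i - D.l i - D.div (targetP u x) i with hβt
  have hq : ∑ i, D.multiplier x i * (D.meanImbalance x' i - βt i)
      = ∑ i, (x.lam i - u.lam i) * D.meanImbalance x' i - ∑ i, (x.lam i - u.lam i) * βt i
      + ∑ i, (u.lam i + D.ρ * D.localImbalance i x) * (D.meanImbalance x' i - βt i) := by
    rw [← Finset.sum_sub_distrib, ← Finset.sum_add_distrib]
    refine Finset.sum_congr rfl fun i _ => ?_
    rw [multiplier]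
    ring
  have hdiff : ∑ i, (x.lam i - u.lam i) * D.localImbalance i x
      = ∑ i, (x.lam i - u.lam i) * D.meanImbalance x i
      + ∑ i, (x.lam i - u.lam i) * (D.localImbalance i x - D.meanImbalance x i) := by
    rw [← Finset.sum_add_distrib]
    exact Finset.sum_congr rfl fun i _ => by ring
  have hgap' : ∑ i, (x.lam i - u.lam i) * βt i ≤ c - c * Λ := by
    have h1 := hgap (x.lam - u.lam)
    have h2 := hu.sum_mul_target (x.lam - u.lam) (targetG u x) (targetP u x)
    exact h2.le.trans h1
  -- bounds of the remaining sums
  have b1 := (abs_le.1 (abs_sum_mul_le (fun i => (hMx x hx i).1)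
    fun i => hMg i _ (hx'.g_mem i) _ (htg x i))).1
  have b2 : |∑ i, (u.lam i + D.ρ * D.localImbalance i x) * (D.meanImbalance x' i - βt i)|
      ≤ N * ((M + D.ρ * M) * ((1 + 2 * n) * M)) := by
    refine abs_sum_mul_le (fun i => ?_) fun i => ?_
    · refine (abs_add_le _ _).trans ?_
      rw [abs_mul, abs_of_nonneg hρ]
      exact add_le_add (hMl i) (mul_le_mul_of_nonneg_left (hb i) hρ)
    · have e1 : D.meanImbalance x' i - βt i = (x'.g i - targetG u x i)
          - D.div (fun e => D.meanFlow x' e - targetP u x e) i := by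
        rw [div_sub, hβt, meanImbalance]
        ring
      have e2 := hMg i _ (hx'.g_mem i) _ (htg x i)
      have e3 := abs_div_le (i := i) (w := fun e => D.meanFlow x' e - targetP u x e) hM fun e => by
        have f1 := abs_le.1 (hMp e _ (hx'.phat_mem e) _ (htp x e))
        have f2 := abs_le.1 (hMp e _ (hx'.pbrv_mem e) _ (htp x e))
        unfold meanFlow
        rw [abs_le]
        constructor <;> linarith
      rw [← hn] at e3
      rw [e1]
      refine (abs_sub _ _).trans ?_
      linarith
  have b3 := sum_sq_le_norm_sq hb
  have b4 := (abs_le.1 (abs_sum_mul_le hb hβ')).2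
  have b5 := (abs_le.1 (abs_sum_mul_le hΛi
    fun i => abs_localImbalance_sub_le hsQ hst.disagreement i)).2
  have b6 : ∑ e, hh * (|x'.phat e - targetP u x e| + |x'.pbrv e - targetP u x e|)
      ≤ n * (hh * (2 * M)) := by
    rw [hn, ← nsmul_eq_mul, ← Finset.card_univ]
    refine Finset.sum_le_card_nsmul _ _ _ fun e _ => ?_
    refine mul_le_mul_of_nonneg_left ?_ hh0
    linarith [hMp e _ (hx'.phat_mem e) _ (htp x e), hMp e _ (hx'.pbrv_mem e) _ (htp x e)]
  simp only [← hN, ← hn] at hmove b1 b3 b4 b5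
  have hss : s ^ 2 ≤ s := by
    rw [sq]
    exact mul_le_of_le_one_left hs hs1
  have c3 : s ^ 2 * ∑ i, D.localImbalance i x ^ 2 ≤ s * (N * M ^ 2) :=
    mul_le_mul hss b3 (Finset.sum_nonneg fun i _ => sq_nonneg _) hs
  have c4 : s ^ 2 * ∑ i, D.localImbalance i x * D.meanImbalance x' i ≤ s * (N * (M * M)) :=
    (mul_le_mul_of_nonneg_left b4 (sq_nonneg s)).trans
      (mul_le_mul_of_nonneg_right hss (by positivity))
  have c1 := mul_le_mul_of_nonneg_left b1 hs
  have c2 := mul_le_mul_of_nonneg_left (abs_le.1 b2).1 hs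
  have c5 := mul_le_mul_of_nonneg_left b5 hs
  have c6 := mul_le_mul_of_nonneg_left b6 hs
  have c7 := mul_le_mul_of_nonneg_left hgap' hs
  have hfar : farEnergy u s x' ≤ farEnergy u s x + s * (K0 - 2 * c * Λ + n * (2 * M) * hh
      + 2 * (N * n) * (s * Q * Λ)) := by
    unfold farEnergy
    rw [hlam, hcross, hdiff]
    rw [hq] at hprim
    rw [hK0]
    linarith
  refine hfar.trans ?_
  have p1 : 0 ≤ K0 * hh := by positivity
  have p2 : 0 ≤ K0 * (s * Q * Λ) := by positivity
  have p3 : 0 ≤ n * (2 * M) := by positivity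
  have p4 : 0 ≤ n * (2 * M) * (s * Q * Λ) := by positivity
  have p5 : 0 ≤ 2 * (N * n) := by positivity
  have p6 : 0 ≤ 2 * (N * n) * hh := by positivity
  have : s * (K0 - 2 * c * Λ + n * (2 * M) * hh + 2 * (N * n) * (s * Q * Λ)) ≤
      s * ((K0 + n * (2 * M) + 2 * (N * n)) * (1 + hh + s * Q * Λ) - 2 * c * Λ) := by
    refine mul_le_mul_of_nonneg_left ?_ hs
    linarith
  linarith

end Far

end SCED

/-! ### Scalar recursions and geometric rates. -/

section Sequences

/-- Bernoulli's inequality with 1 - 1 / (2(N + 1)). -/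
theorem exists_half_le_pow (N : ℕ) : ∃ μ : ℝ, 0 < μ ∧ μ < 1 ∧ 1 / 2 ≤ μ ^ N := by
  have hN : (0 : ℝ) < 2 * (N + 1) := by positivity
  have h1 : (1 : ℝ) / (2 * (N + 1)) ≤ 1 / 2 := by
    rw [div_le_div_iff₀ hN two_pos]
    linarith [(Nat.cast_nonneg N : (0 : ℝ) ≤ N)]
  have h2 : (0 : ℝ) < 1 / (2 * (N + 1)) := by positivity
  refine ⟨1 - 1 / (2 * (N + 1)), by linarith, by linarith, ?_⟩
  have h3 := one_add_mul_le_pow (a := -(1 / (2 * (N + 1) : ℝ))) (by linarith) N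
  have h4 : (N : ℝ) * (1 / (2 * (N + 1))) ≤ 1 / 2 := by
    rw [mul_one_div, div_le_div_iff₀ hN two_pos]
    linarith
  rw [sub_eq_add_neg]
  linarith

theorem eventually_le_of_contraction {μ C : ℝ} (hμ0 : 0 ≤ μ) (hμ1 : μ < 1) {x : ℕ → ℝ} {k₀ : ℕ}
    (hx : ∀ k ≥ k₀, x (k + 1) ≤ μ * x k + C) :
    ∃ k₁ ≥ k₀, ∀ k ≥ k₁, x k ≤ C / (1 - μ) + 1 := by
  set L := C / (1 - μ) with hL
  have hLC : μ * L + C = L := by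
    have : 1 - μ ≠ 0 := by linarith
    rw [hL]
    field_simp
    ring
  have h1 : ∀ n, x (k₀ + n) ≤ L + μ ^ n * (x k₀ - L) := by
    intro n
    induction n with
    | zero => simp
    | succ n ih =>
      have h2 := hx (k₀ + n) (by omega)
      have h3 := mul_le_mul_of_nonneg_left ih hμ0
      rw [← add_assoc, pow_succ]
      linarith
  have h2 : Tendsto (fun n => μ ^ n * (x k₀ - L)) atTop (𝓝 0) := by
    simpa using (tendsto_pow_atTop_nhds_zero_of_lt_one hμ0 hμ1).mul_const (x k₀ - L)
  obtain ⟨n₀, hn₀⟩ := eventually_atTop.1 (h2.eventually_le_const one_pos)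
  refine ⟨k₀ + n₀, by omega, fun k hk => ?_⟩
  obtain ⟨n, rfl⟩ := Nat.exists_eq_add_of_le (show k₀ ≤ k by omega)
  linarith [h1 n, hn₀ n (by omega)]

/-- Beyond `R₀` the function `F` falls by at least `s` per step, so it reaches the level `R₁`. It
never leaves again: from within `R₀` one step adds at most `K'`, which is included in `R₁`. No
constant involves `s`. -/
theorem eventually_le_of_drift {N K K' c : ℝ} (hN : 0 ≤ N) (hK : 0 ≤ K) (hK' : 0 ≤ K') (hc : 0 < c) :
    ∃ R : ℝ, 0 ≤ R ∧ ∀ s : ℝ, 0 < s → s ≤ 1 → ∀ (F Λ : ℕ → ℝ) (k₀ : ℕ), (∀ k, 0 ≤ Λ k) →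
      (∀ k ≥ k₀, Λ k ^ 2 - K * Λ k ≤ F k ∧ F k ≤ N * Λ k ^ 2 + K * Λ k + K) →
      (∀ k ≥ k₀, F (k + 1) ≤ F k - s * (c * Λ k - K')) → ∃ k₁ ≥ k₀, ∀ k ≥ k₁, Λ k ≤ R := by
  set R₀ := (K' + 1) / c with hR₀
  have hR₀0 : 0 ≤ R₀ := by positivity
  have hcR : c * R₀ = K' + 1 := by
    rw [hR₀]
    field_simp
  set R₁ := N * R₀ ^ 2 + K * R₀ + K + K' with hR₁
  have hR₁0 : 0 ≤ R₁ := by positivity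
  refine ⟨K + R₁ + 1, by positivity, fun s hs hs1 F Λ k₀ hΛ hF hstep => ?_⟩
  have hsmall : ∀ k ≥ k₀, Λ k ≤ R₀ → F k ≤ R₁ - K' := fun k hk h => by
    have h1 : N * Λ k ^ 2 ≤ N * R₀ ^ 2 :=
      mul_le_mul_of_nonneg_left (pow_le_pow_left₀ (hΛ k) h 2) hN
    have h2 := mul_le_mul_of_nonneg_left h hK
    linarith [(hF k hk).2]
  have hlarge : ∀ k ≥ k₀, R₀ < Λ k → F (k + 1) ≤ F k - s := fun k hk h => by
    have h1 := mul_le_mul_of_nonneg_left h.le hc.le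
    have h2 : s * 1 ≤ s * (c * Λ k - K') := mul_le_mul_of_nonneg_left (by linarith) hs.le
    linarith [hstep k hk]
  have henter : ∃ k₁ ≥ k₀, F k₁ ≤ R₁ := by
    by_contra! hcon
    have h1 : ∀ k ≥ k₀, R₀ < Λ k := fun k hk => by
      by_contra! h
      linarith [hsmall k hk h, hcon k hk]
    have h2 : ∀ n : ℕ, F (k₀ + n) ≤ F k₀ - n * s := by
      intro n
      induction n with
      | zero => simp
      | succ n ih =>
        have := hlarge (k₀ + n) (by omega) (h1 _ (by omega))
        push_cast
        rw [← add_assoc]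
        linarith
    obtain ⟨n, hn⟩ := exists_nat_gt (F k₀ / s)
    rw [div_lt_iff₀ hs] at hn
    linarith [h2 n, hcon (k₀ + n) (by omega)]
  obtain ⟨k₁, hk₁, hFk₁⟩ := henter
  have hstay : ∀ k ≥ k₁, F k ≤ R₁ := by
    intro k hk
    induction k, hk using Nat.le_induction with
    | base => exact hFk₁
    | succ k hk ih =>
      rcases le_or_gt (Λ k) R₀ with h | h
      · have h1 := hsmall k (by omega) h
        have h2 := mul_le_of_le_one_left hK' hs1
        have h3 : 0 ≤ s * (c * Λ k) := mul_nonneg hs.le (mul_nonneg hc.le (hΛ k))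
        linarith [hstep k (by omega)]
      · linarith [hlarge k (by omega) h]
  refine ⟨k₁, hk₁, fun k hk => ?_⟩
  by_contra! h
  have h1 : (K + R₁ + 1) * (Λ k - K) < Λ k * (Λ k - K) :=
    mul_lt_mul_of_pos_right h (by linarith)
  have h2 : 1 * (R₁ + 1) ≤ (K + R₁ + 1) * (Λ k - K) :=
    mul_le_mul (by linarith) (by linarith) (by linarith) (by linarith)
  linarith [(hF k (by omega)).1, hstay k hk]

theorem exists_geometric_bound {a α : ℝ} (ha : 0 < a) (hα : 0 < α) {Y ξ : ℕ → ℝ} {k₀ : ℕ}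
    (hY : ∀ k ≥ k₀, Y (k + 1) ≤ a ^ 2 * Y k) (hξ : ∀ k ≥ k₀, α * ξ k ^ 2 ≤ Y k) :
    ∃ C : ℝ, 0 ≤ C ∧ ∀ k, ξ k ≤ C * a ^ k := by
  have h1 : ∀ n, Y (k₀ + n) ≤ (a ^ 2) ^ n * Y k₀ := by
    intro n
    induction n with
    | zero => simp
    | succ n ih =>
      have h2 := mul_le_mul_of_nonneg_left ih (sq_nonneg a)
      rw [← add_assoc, pow_succ (a ^ 2)]
      linarith [hY (k₀ + n) (by omega)]
  have hY0 : 0 ≤ Y k₀ := (by positivity : (0 : ℝ) ≤ α * ξ k₀ ^ 2).trans (hξ k₀ le_rfl)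
  set C₀ := √(Y k₀ / α) / a ^ k₀ with hC₀
  have hC₀0 : 0 ≤ C₀ := by positivity
  -- The sum covers the finitely many times before the decay sets in.
  refine ⟨C₀ + ∑ k ∈ Finset.range k₀, |ξ k| / a ^ k, by positivity, fun k => ?_⟩
  have hS0 : 0 ≤ ∑ k ∈ Finset.range k₀, |ξ k| / a ^ k := by positivity
  rcases lt_or_ge k k₀ with hk | hk
  · have h2 := Finset.single_le_sum (f := fun k => |ξ k| / a ^ k) (fun i _ => by positivity)
      (Finset.mem_range.2 hk)
    have h3 : |ξ k| = |ξ k| / a ^ k * a ^ k := by field_simp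
    calc ξ k ≤ |ξ k| := le_abs_self _
      _ = |ξ k| / a ^ k * a ^ k := h3
      _ ≤ _ := mul_le_mul_of_nonneg_right (by linarith) (by positivity)
  · obtain ⟨n, rfl⟩ := Nat.exists_eq_add_of_le hk
    have h2 : ξ (k₀ + n) ≤ √(Y k₀ / α) * a ^ n := by
      refine (le_abs_self _).trans (abs_le_of_sq_le_sq ?_ (by positivity))
      rw [mul_pow, Real.sq_sqrt (by positivity), div_mul_eq_mul_div, le_div_iff₀ hα]
      have := (hξ _ hk).trans (h1 n)
      rw [← pow_mul, mul_comm 2 n, pow_mul] at this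
      linarith
    have h3 : √(Y k₀ / α) * a ^ n = C₀ * a ^ (k₀ + n) := by
      rw [hC₀, pow_add]
      field_simp
    rw [h3] at h2
    refine h2.trans (mul_le_mul_of_nonneg_right (by linarith) (by positivity))

theorem norm_toLp_le_of_abs_le {ι : Type*} [Fintype ι] {v : ι → ℝ} {r : ℝ} (hv : ∀ i, |v i| ≤ r) :
    ‖(WithLp.toLp 2 v : EuclideanSpace ℝ ι)‖ ≤ Fintype.card ι * r := by
  rw [EuclideanSpace.norm_eq]
  have h1 : ∀ i, 0 ≤ r := fun i => (abs_nonneg _).trans (hv i)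
  refine (Real.sqrt_le_sqrt (Finset.sum_le_sum fun i _ =>
    (pow_le_pow_left₀ (norm_nonneg _) (hv i) 2))).trans ?_
  rw [Finset.sum_const, Finset.card_univ, nsmul_eq_mul]
  rcases isEmpty_or_nonempty ι with h | h
  · simp
  · obtain ⟨i⟩ := h
    have h2 : (1 : ℝ) ≤ Fintype.card ι := by exact_mod_cast Fintype.card_pos_iff.2 ⟨i⟩
    refine Real.sqrt_le_iff.2 ⟨mul_nonneg (by linarith) (h1 i), ?_⟩
    rw [mul_pow]
    exact mul_le_mul_of_nonneg_right (by nlinarith) (sq_nonneg r)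

end Sequences

namespace SCED

/-! ### Assembly of the convergence proof. -/

section Main

variable {V : Type*} [Fintype V] [DecidableEq V] {D : SCED V} {u : D.Triple} {m : ℝ}

/-- A trajectory of perturbed primal-dual steps within the bounds, with the error bounds `H` and `Q`
driven by the changes of the multipliers. -/
structure FilteredRun (D : SCED V) (s μ : ℝ) (X : ℕ → D.Iterate) (H Q : ℕ → ℝ) : Prop where
  H_nonneg : ∀ k, 0 ≤ H k
  Q_nonneg : ∀ k, 0 ≤ Q k
  H_succ : ∀ k, H (k + 1) = μ * H k + 16 * ‖D.multiplier (X (k + 1)) - D.multiplier (X k)‖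
  Q_succ : ∀ k, Q (k + 1) = μ * Q k + 4 * H k
  step : ∀ k, D.PerturbedStep s (H k + Q k) (Q k) (X k) (X (k + 1))

theorem PerturbedStep.inBox (hg : ∀ i, D.gmin i ≤ D.gmax i) (hp : ∀ e, 0 ≤ D.pmax e) {s h Q : ℝ}
    {x x' : D.Iterate} (hst : D.PerturbedStep s h Q x x') : D.InBox x' where
  g_mem i := hst.g_step i ▸ clip_mem (hg i) _
  phat_mem e := by
    obtain ⟨y, -, hy⟩ := hst.phat_step e
    exact hy ▸ clip_mem (by linarith [hp e]) _
  pbrv_mem e := by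
    obtain ⟨y, -, hy⟩ := hst.pbrv_step e
    exact hy ▸ clip_mem (by linarith [hp e]) _

theorem FilteredRun.inBox (hg : ∀ i, D.gmin i ≤ D.gmax i) (hp : ∀ e, 0 ≤ D.pmax e) {s μ : ℝ}
    {X : ℕ → D.Iterate} {H Q : ℕ → ℝ} (hX : D.FilteredRun s μ X H Q) {k : ℕ} (hk : 1 ≤ k) :
    D.InBox (X k) := by
  obtain ⟨n, rfl⟩ := Nat.exists_eq_add_of_le' hk
  exact (hX.step n).inBox hg hp

/-- On the box the multiplier increments are bounded, so both filters eventually satisfy bounds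
independent of the run and of `s`; after that the drift estimate applies. -/
theorem Optimal.eventually_dual_le (h : D.IsRadial) (hu : D.Optimal u) (hc : D.CostAssumption m)
    (hunique : ∀ u', D.IsEquilibrium u' → u' = u)
    (hg : ∀ i, D.gmin i ≤ D.gmax i) (hp : ∀ e, 0 ≤ D.pmax e) (hρ : 0 ≤ D.ρ) {μ : ℝ} (hμ0 : 0 ≤ μ)
    (hμ1 : μ < 1) :
    ∃ R sbar : ℝ, 0 ≤ R ∧ 0 < sbar ∧ ∀ s : ℝ, 0 < s → s ≤ sbar → ∀ X H Q,
      D.FilteredRun s μ X H Q → ∃ k₀ ≥ 1, ∀ k ≥ k₀, ‖(X k).lam - u.lam‖ ≤ R := by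
  obtain ⟨M, hM, hMg, hMp, -, hMx⟩ := hu.exists_box_bounds hc
  obtain ⟨K, hK, hKF⟩ := hu.farEnergy_bounds hc hg hp
  obtain ⟨c, K', hc0, hK', hfar⟩ := hu.far_step h hc hunique hg hp hρ
  set n : ℝ := (Fintype.card D.Line : ℝ) with hn
  have hn0 : 0 ≤ n := by positivity
  set Cω := 16 * (M + D.ρ * (1 + 2 * n) * M) with hCω
  have hCω0 : 0 ≤ Cω := by positivity
  have hμ : 0 < 1 - μ := by linarith
  set CH := Cω / (1 - μ) + 1 with hCH
  have hCH0 : 0 ≤ CH := by positivity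
  set CQ := 4 * CH / (1 - μ) + 1 with hCQ
  have hCQ0 : 0 ≤ CQ := by positivity
  obtain ⟨R, hR0, hR⟩ := eventually_le_of_drift (N := (Fintype.card V : ℝ)) (K := K)
    (K' := K' * (1 + CH + CQ)) (c := c / 2) (by positivity) hK (by positivity) (by positivity)
  -- The term `s * Q * Λ` then consumes at most half of the drift.
  refine ⟨R, min 1 (c / 2 / (K' * CQ + 1)), hR0, by positivity, fun s hs hss X H Q hX => ?_⟩
  have hs1 : s ≤ 1 := hss.trans (min_le_left _ _)
  have hs2 : s * (K' * CQ + 1) ≤ c / 2 :=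
    (le_div_iff₀ (by positivity)).1 (hss.trans (min_le_right _ _))
  -- The initial iterate is arbitrary and may violate the bounds, so time 0 is left out.
  have hH1 : ∀ k ≥ 1, H (k + 1) ≤ μ * H k + Cω := fun k hk => by
    have hb := hX.inBox hg hp hk
    have hb' := (hX.step k).inBox hg hp
    have h1 := (hX.step k).norm_multiplier_sub_le hρ hs.le
    have h2 : ‖D.imbalance (X k)‖ ≤ M :=
      (pi_norm_le_iff_of_nonneg hM).2 fun i => (hMx _ hb i).2.1
    have h3 : D.stepSize (X k) (X (k + 1)) ≤ M :=
      max_le ((pi_norm_le_iff_of_nonneg hM).2 fun i => hMg i _ (hb'.g_mem i) _ (hb.g_mem i))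
        (max_le
          ((pi_norm_le_iff_of_nonneg hM).2 fun e => hMp e _ (hb'.phat_mem e) _ (hb.phat_mem e))
          ((pi_norm_le_iff_of_nonneg hM).2 fun e => hMp e _ (hb'.pbrv_mem e) _ (hb.pbrv_mem e)))
    have h4 : s * ‖D.imbalance (X k)‖ ≤ M := (mul_le_of_le_one_left (norm_nonneg _) hs1).trans h2
    have h5 := mul_le_mul_of_nonneg_left h3 (by positivity : 0 ≤ D.ρ * (1 + 2 * n))
    linarith [hX.H_succ k]
  obtain ⟨k₁, hk₁, hH⟩ := eventually_le_of_contraction hμ0 hμ1 hH1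
  obtain ⟨k₂, hk₂, hQ⟩ := eventually_le_of_contraction (C := 4 * CH) hμ0 hμ1 (x := Q) (k₀ := k₁)
    fun k hk => by linarith [hX.Q_succ k, hH k hk]
  obtain ⟨k₃, hk₃, hΛ⟩ := hR s hs hs1 (fun k => farEnergy u s (X k))
    (fun k => ‖(X k).lam - u.lam‖) k₂ (fun k => norm_nonneg _)
    (fun k hk => hKF s hs.le hs1 _ (hX.inBox hg hp (by omega))) fun k hk => by
      have h1 := hfar s _ _ hs.le hs1 (add_nonneg (hX.H_nonneg k) (hX.Q_nonneg k)) (hX.Q_nonneg k)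
        _ _ (hX.inBox hg hp (by omega)) ((hX.step k).inBox hg hp) (hX.step k)
      refine h1.trans ?_
      set Λ := ‖(X k).lam - u.lam‖
      have hΛ0 : 0 ≤ Λ := norm_nonneg _
      have h2 : K' * (H k + Q k) ≤ K' * (CH + CQ) :=
        mul_le_mul_of_nonneg_left (add_le_add (hH k (by omega)) (hQ k hk)) hK'
      have h3 : K' * (s * Q k) ≤ c / 2 := by
        have := mul_le_mul_of_nonneg_left (hQ k hk) (mul_nonneg hK' hs.le)
        linarith
      have h4 := mul_le_mul_of_nonneg_right h3 hΛ0
      have h5 : s * (c / 2 * Λ - K' * (1 + CH + CQ)) ≤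
          s * (c * Λ - K' * (1 + (H k + Q k) + s * Q k * Λ)) :=
        mul_le_mul_of_nonneg_left (by linarith) hs.le
      linarith
  exact ⟨k₃, by omega, hΛ⟩

theorem Optimal.lyapunov_step (h : D.IsRadial) (hu : D.Optimal u) (hc : D.CostAssumption m)
    (hunique : ∀ u', D.IsEquilibrium u' → u' = u) (hm : 0 < m) (hρ : 0 < D.ρ) {μ κ₀ R : ℝ}
    (hμ0 : 0 ≤ μ) (hμ1 : μ < 1) (hκ₀ : 0 < κ₀) :
    ∃ κ θ c sbar : ℝ, 0 < κ ∧ κ ≤ κ₀ ∧ 0 < θ ∧ θ ≤ 1 ∧ 0 < c ∧ 0 < sbar ∧ sbar ≤ 1 ∧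
      ∀ (s : ℝ) (X : ℕ → D.Iterate) (H Q : ℕ → ℝ) (k : ℕ), 0 < s → s ≤ sbar →
      D.FilteredRun s μ X H Q → D.InBox (X k) → D.InBox (X (k + 1)) →
      ‖(X k).lam - u.lam‖ ≤ R →
      energy u (X (k + 1)) - energy u (X k) + κ * (D.potential (X (k + 1)) - D.potential (X k))
        + (H (k + 1) ^ 2 - H k ^ 2) + θ * (Q (k + 1) ^ 2 - Q k ^ 2) + 2 * s * slack u (X (k + 1))
      ≤ -(c * s * (‖(X k).g - u.g‖ ^ 2 + flowDist u (X k) ^ 2 + ‖(X k).lam - u.lam‖ ^ 2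
        + H k ^ 2 + Q k ^ 2)) := by
  obtain ⟨K₁, hK₁, hE⟩ := hu.energy_step hc hm.le hρ.le
  obtain ⟨K₂, hK₂, hP⟩ := hc.potential_step u hm.le hρ.le
  obtain ⟨K₃, hK₃, hF⟩ := hu.flowDist_le h
  obtain ⟨K₄, hK₄, hD⟩ := hu.dual_error_bound h hc hunique hρ.le R
  set n : ℝ := (Fintype.card D.Line : ℝ) with hn
  have hn0 : 0 ≤ n := by positivity
  set K₅ := 16 + 16 * (D.ρ * (1 + 2 * n)) with hK₅
  have hK₅0 : 0 ≤ 16 * (D.ρ * (1 + 2 * n)) := by positivity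
  set K := K₁ + K₂ + K₃ + K₄ + K₅ with hK
  have hK1 : 1 ≤ K := by linarith
  set ν := min m D.ρ with hν
  have hν0 : 0 < ν := lt_min hm hρ
  obtain ⟨κ, θ, c, sbar, hκ0, hκ, hθ0, hθ1, hc0, hs0, hs1, hL⟩ :=
    lyapunov_decrease hK1 hν0 hμ0 hμ1 hκ₀
  refine ⟨κ, θ, c, sbar, hκ0, hκ, hθ0, hθ1, hc0, hs0, hs1, ?_⟩
  intro s X H Q k hs hss hX hx hx' hR
  have hst := hX.step k
  have hH := hX.H_nonneg k
  have hQ := hX.Q_nonneg k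
  have hhQ := add_nonneg hH hQ
  have e1 := hE s _ _ hs.le hhQ hQ _ _ hx hst
  have e2 := hP s _ _ hs.le hhQ hQ _ _ hx hx' hst
  have e3 := hF (X k) (s * Q k) (by positivity) hst.disagreement
  have e4 := hD s _ _ hs.le (hss.trans hs1) hhQ _ _ hx hst hR
  have e5 := hst.norm_multiplier_sub_le hρ.le hs.le
  have e6 := hX.H_succ k
  rw [← hn] at e5
  have hγ0 : 0 ≤ ‖(X k).g - u.g‖ := norm_nonneg _
  have hΛ0 : 0 ≤ ‖(X k).lam - u.lam‖ := norm_nonneg _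
  have hb0 : 0 ≤ ‖D.imbalance (X k)‖ := norm_nonneg _
  have hπ0 := flowDist_nonneg (u := u) (X k)
  have hδ0 := stepSize_nonneg (X k) (X (k + 1))
  have hsQ : 0 ≤ s * Q k := by positivity
  set γ := ‖(X k).g - u.g‖
  set Λ := ‖(X k).lam - u.lam‖
  set b := ‖D.imbalance (X k)‖
  set δ := D.stepSize (X k) (X (k + 1))
  set π := flowDist u (X k)
  refine hL s γ π Λ b δ (H k) (Q k) (H (k + 1)) (Q (k + 1)) _ _ _ hs hss hγ0 hπ0 hΛ0 hb0 hδ0 hH hQ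
    (hX.H_nonneg _) (e1.trans ?_) (e2.trans ?_) (e3.trans ?_) (e4.trans ?_) ?_ (hX.Q_succ k)
  · refine mul_le_mul_of_nonneg_left (add_le_add ?_ ?_) hs.le
    · have h1 := mul_le_mul_of_nonneg_right (min_le_left m D.ρ) (sq_nonneg γ)
      have h2 := mul_le_mul_of_nonneg_right (min_le_right m D.ρ) (sq_nonneg b)
      rw [← hν] at h1 h2
      linarith
    · exact mul_le_mul_of_nonneg_right (by linarith) (by positivity)
  · gcongr
    linarith
  · exact mul_le_mul_of_nonneg_right (by linarith) (by positivity)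
  · exact mul_le_mul_of_nonneg_right (by linarith) (by positivity)
  · have h1 : 16 * (s * b) ≤ K * (s * b) :=
      mul_le_mul_of_nonneg_right (by linarith) (by positivity)
    have h2 : 16 * (D.ρ * (1 + 2 * n)) * δ ≤ K * δ := mul_le_mul_of_nonneg_right (by linarith) hδ0
    linarith

theorem Optimal.exists_geometric_rate (h : D.IsRadial) (hu : D.Optimal u)
    (hc : D.CostAssumption m) (hunique : ∀ u', D.IsEquilibrium u' → u' = u)
    (hg : ∀ i, D.gmin i ≤ D.gmax i) (hp : ∀ e, 0 ≤ D.pmax e) (hm : 0 < m) (hρ : 0 < D.ρ) {μ : ℝ}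
    (hμ0 : 0 ≤ μ) (hμ1 : μ < 1) :
    ∃ sbar : ℝ, 0 < sbar ∧ ∀ s : ℝ, 0 < s → s ≤ sbar → ∃ a : ℝ, 0 < a ∧ a < 1 ∧
      ∀ X H Q, D.FilteredRun s μ X H Q → ∃ C : ℝ, 0 ≤ C ∧ ∀ k,
        ‖(X k).g - u.g‖ ≤ C * a ^ k ∧ flowDist u (X k) ≤ C * a ^ k ∧
          ‖(X k).lam - u.lam‖ ≤ C * a ^ k := by
  obtain ⟨R, s₁, hR, hs₁, hfar⟩ := hu.eventually_dual_le h hc hunique hg hp hρ.le hμ0 hμ1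
  obtain ⟨K, hK, hpot⟩ := hu.potential_bounds hc hm.le hρ.le
  obtain ⟨κ, θ, c, s₂, hκ0, hκ, hθ0, hθ1, hc0, hs₂, hs₂1, hstep⟩ :=
    hu.lyapunov_step h hc hunique hm hρ (R := R) hμ0 hμ1
      -- So small a κ keeps the quadratic error of the potential below a quarter of the squared
      -- distances, of which the energy contains at least half.
      (by positivity : 0 < 1 / (4 * (K + 1)))
  have hκK : κ * (K + 1) ≤ 1 / 4 := by
    rw [le_div_iff₀ (by positivity)] at hκ
    linarith
  have hκK' : κ * K ≤ 1 / 4 := by linarith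
  have hκ1 : κ ≤ 1 := by linarith [mul_nonneg hκ0.le hK]
  set A : ℝ := Fintype.card V + Fintype.card D.Line + 2 with hA
  have hA0 : 0 < A := by positivity
  set c' := min (c / A) (1 / 2) with hc'
  have hc'0 : 0 < c' := by positivity
  have hc'A : c' * A ≤ c := (le_div_iff₀ hA0).1 (min_le_left _ _)
  have hc'2 : c' ≤ 1 / 2 := min_le_right _ _
  refine ⟨min s₁ s₂, lt_min hs₁ hs₂, fun s hs hss => ?_⟩
  have hs1 : s ≤ 1 := hss.trans ((min_le_right _ _).trans hs₂1)
  have hcs0 : 0 < c' * s := by positivity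
  have hcs : c' * s ≤ 1 / 2 := (mul_le_of_le_one_right hc'0.le hs1).trans hc'2
  refine ⟨√(1 - c' * s), Real.sqrt_pos.2 (by linarith),
    (Real.sqrt_lt' one_pos).2 (by linarith), fun X H Q hX => ?_⟩
  set a := √(1 - c' * s) with ha
  have ha0 : 0 < a := Real.sqrt_pos.2 (by linarith)
  have ha2 : a ^ 2 = 1 - c' * s := Real.sq_sqrt (by linarith)
  obtain ⟨k₀, hk₀, hΛ⟩ := hfar s hs (hss.trans (min_le_left _ _)) X H Q hX
  let S : ℕ → ℝ := fun k =>
    ‖(X k).g - u.g‖ ^ 2 + flowDist u (X k) ^ 2 + ‖(X k).lam - u.lam‖ ^ 2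
  let W : ℕ → ℝ := fun k => energy u (X k)
    + κ * (D.potential (X k) - ∑ i, D.f i (u.g i)) + H k ^ 2 + θ * Q k ^ 2
  have hS0 : ∀ k, 0 ≤ S k := fun k => by positivity
  have hl : ∀ k ≥ k₀, 0 ≤ slack u (X k) := fun k hk =>
    hu.slack_nonneg (hX.inBox hg hp (hk₀.trans hk))
  have hpk : ∀ k ≥ k₀, κ * slack u (X k) - 1 / 4 * S k
        ≤ κ * (D.potential (X k) - ∑ i, D.f i (u.g i)) ∧
      κ * (D.potential (X k) - ∑ i, D.f i (u.g i)) ≤ κ * slack u (X k) + 1 / 4 * S k :=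
    fun k hk => by
      have h1 := abs_le.1 (hpot _ (hX.inBox hg hp (hk₀.trans hk)))
      have h2 := mul_le_mul_of_nonneg_right hκK' (hS0 k)
      have h3 := mul_le_mul_of_nonneg_left h1.1 hκ0.le
      have h4 := mul_le_mul_of_nonneg_left h1.2 hκ0.le
      simp only [S] at h2 ⊢
      constructor <;> linarith
  have hlow : ∀ k ≥ k₀, 1 / 4 * S k ≤ W k + 2 * s * slack u (X k) := fun k hk => by
    have h1 := energy_lower (u := u) (X k)
    have h2 := (hpk k hk).1
    have h3 := mul_nonneg hκ0.le (hl k hk)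
    have h4 : 0 ≤ 2 * s * slack u (X k) := mul_nonneg (by positivity) (hl k hk)
    have h5 : 0 ≤ θ * Q k ^ 2 := by positivity
    have h6 : 0 ≤ H k ^ 2 := sq_nonneg _
    have h7 : 0 ≤ ‖(X k).g - u.g‖ ^ 2 := sq_nonneg _
    have h8 : 0 ≤ ‖(X k).lam - u.lam‖ ^ 2 := sq_nonneg _
    simp only [S, W] at h2 ⊢
    linarith
  have hup : ∀ k ≥ k₀, W k ≤ A * (S k + H k ^ 2 + Q k ^ 2) + κ * slack u (X k) := fun k hk => by
    have h1 := energy_upper (u := u) (X k)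
    have h2 := (hpk k hk).2
    have h5 : θ * Q k ^ 2 ≤ Q k ^ 2 := mul_le_of_le_one_left (sq_nonneg _) hθ1
    have h6 : 0 ≤ H k ^ 2 := sq_nonneg _
    have h7 : 0 ≤ Q k ^ 2 := sq_nonneg _
    have h8 : 0 ≤ ((Fintype.card V : ℝ) + Fintype.card D.Line) * (H k ^ 2 + Q k ^ 2) := by
      positivity
    have h9 := hS0 k
    simp only [S, W] at h2 h9 ⊢
    rw [hA]
    linarith
  have hdec : ∀ k ≥ k₀, W (k + 1) + 2 * s * slack u (X (k + 1))
      ≤ a ^ 2 * (W k + 2 * s * slack u (X k)) := fun k hk => by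
    have h1 := hstep s X H Q k hs (hss.trans (min_le_right _ _)) hX
      (hX.inBox hg hp (hk₀.trans hk)) (hX.inBox hg hp (by omega)) (hΛ k hk)
    have h2 : W (k + 1) + 2 * s * slack u (X (k + 1))
        ≤ W k - c * s * (S k + H k ^ 2 + Q k ^ 2) := by
      simp only [W, S]
      linarith
    have hZ : 0 ≤ S k + H k ^ 2 + Q k ^ 2 := by linarith [hS0 k, sq_nonneg (H k), sq_nonneg (Q k)]
    have h3 := mul_le_mul_of_nonneg_left (hup k hk) hcs0.le
    have h4 : c' * A * (s * (S k + H k ^ 2 + Q k ^ 2)) ≤ c * (s * (S k + H k ^ 2 + Q k ^ 2)) :=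
      mul_le_mul_of_nonneg_right hc'A (mul_nonneg hs.le hZ)
    -- The slack at time `k` has no decay of its own. The multiple of it needed for the contraction
    -- is paid for by the summand `2 * s * slack` of the Lyapunov function, which the step estimate
    -- gains anew at time `k + 1`.
    have h5 : c' * (κ + 2 * s) ≤ 2 := by
      have h6 : c' * (κ + 2 * s) ≤ 1 / 2 * (1 + 2 * 1) := by gcongr
      linarith
    have h6 := mul_le_mul_of_nonneg_right h5 (mul_nonneg hs.le (hl k hk))
    rw [ha2]
    linarith
  have hSC : ∀ ξ : ℕ → ℝ, (∀ k, ξ k ^ 2 ≤ S k) → ∃ C : ℝ, 0 ≤ C ∧ ∀ k, ξ k ≤ C * a ^ k :=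
    fun ξ hξ => exists_geometric_bound ha0 (by norm_num : (0 : ℝ) < 1 / 4) hdec fun k hk =>
      (mul_le_mul_of_nonneg_left (hξ k) (by norm_num)).trans (hlow k hk)
  obtain ⟨C₁, hC₁, h₁⟩ := hSC (fun k => ‖(X k).g - u.g‖) fun k => by
    simp only [S]
    linarith [sq_nonneg (flowDist u (X k)), sq_nonneg ‖(X k).lam - u.lam‖]
  obtain ⟨C₂, hC₂, h₂⟩ := hSC (fun k => flowDist u (X k)) fun k => by
    simp only [S]
    linarith [sq_nonneg ‖(X k).g - u.g‖, sq_nonneg ‖(X k).lam - u.lam‖]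
  obtain ⟨C₃, hC₃, h₃⟩ := hSC (fun k => ‖(X k).lam - u.lam‖) fun k => by
    simp only [S]
    linarith [sq_nonneg (flowDist u (X k)), sq_nonneg ‖(X k).g - u.g‖]
  refine ⟨C₁ + C₂ + C₃, by positivity, fun k => ⟨(h₁ k).trans ?_, (h₂ k).trans ?_,
    (h₃ k).trans ?_⟩⟩ <;> exact mul_le_mul_of_nonneg_right (by linarith) (by positivity)

theorem norm_error_le {x : D.Iterate} {r : ℝ} (hγ : ‖x.g - u.g‖ ≤ r) (hπ : flowDist u x ≤ r)
    (hΛ : ‖x.lam - u.lam‖ ≤ r) :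
    ‖D.error u x‖ ≤ Fintype.card (V ⊕ D.Line ⊕ V) * r := by
  refine norm_toLp_le_of_abs_le ?_
  rintro (i | e | i)
  · exact (norm_le_pi_norm (x.g - u.g) i).trans hγ
  · exact (abs_meanFlow_sub_le_flowDist x e).trans hπ
  · exact (norm_le_pi_norm (x.lam - u.lam) i).trans hΛ

theorem norm_localState_sub_le (i : V) {x : D.Iterate} {r : ℝ} (hγ : ‖x.g - u.g‖ ≤ r)
    (hπ : flowDist u x ≤ r) (hΛ : ‖x.lam - u.lam‖ ≤ r) :
    ‖D.localState i x - D.localTarget i u‖ ≤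
      Fintype.card (Unit ⊕ {e : D.Line // D.up e = i} ⊕ {e : D.Line // D.down e = i} ⊕ Unit)
        * r := by
  rw [localState, localTarget, localVec, localVec, ← WithLp.toLp_sub]
  refine norm_toLp_le_of_abs_le ?_
  rintro (_ | e | e | _)
  · exact (norm_le_pi_norm (x.g - u.g) i).trans hγ
  · exact (abs_phat_sub_le_flowDist x e.1).trans hπ
  · exact (abs_pbrv_sub_le_flowDist x e.1).trans hπ
  · exact (norm_le_pi_norm (x.lam - u.lam) i).trans hΛ

end Main

end SCED

theorem mainTheorem4 {V : Type*} [Fintype V] [DecidableEq V] (D : SCED V)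
    (hradial : D.IsRadial)
    (hg : ∀ i, D.gmin i ≤ D.gmax i) (hp : ∀ e, 0 ≤ D.pmax e) (hρ : 0 < D.ρ)
    (m : ℝ) (hm : 0 < m) (hcost : D.CostAssumption m)
    (ustar : D.Triple) (hstar : D.IsEquilibrium ustar)
    (hunique : ∀ u : D.Triple, D.IsEquilibrium u → u = ustar)
    (B : ℕ) (hB : 0 < B) :
    ∃ sbar : ℝ, 0 < sbar ∧ ∀ s : ℝ, 0 < s → s < sbar →
      ∃ a : ℝ, 0 < a ∧ a < 1 ∧
        ∀ Ec : ℕ → Finset (V × V), D.CommAssumption B Ec →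
          ∀ X : ℕ → D.Iterate, D.IsRun s Ec X →
            ∃ β : ℝ, 0 < β ∧
              (∀ K : ℕ, weightedNorm a K (fun k => D.error ustar (X k)) ≤ β) ∧
              ∀ i : V,
                Tendsto (fun k => D.localState i (X k)) atTop (𝓝 (D.localTarget i ustar)) ∧
                (fun k => D.localState i (X k) - D.localTarget i ustar)
                  =O[atTop] (fun k : ℕ => a ^ k) := by
  have hf : ∀ i, Differentiable ℝ (D.f i) := fun i => (hcost i).1
  have hu : D.Optimal ustar := hstar.optimal hradial hf hg hp
  -- The forgetting factor depends only on `B`; hence `sbar` depends only on the data and `B`, and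
  -- `a` in addition on `s`.
  obtain ⟨μ, hμ0, hμ1, hμ⟩ := exists_half_le_pow (4 * B + 1)
  obtain ⟨sbar, hsbar, hrate⟩ :=
    hu.exists_geometric_rate hradial hcost hunique hg hp hm hρ hμ0.le hμ1
  refine ⟨sbar, hsbar, fun s hs hss => ?_⟩
  obtain ⟨a, ha0, ha1, hrun⟩ := hrate s hs hss.le
  refine ⟨a, ha0, ha1, fun Ec hEc X hX => ?_⟩
  obtain ⟨H, Q, hH, hQ, hHs, hQs, hst⟩ := hX.perturbedStep hEc hf hs hμ0 hμ1.le hμ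
  obtain ⟨C, hC0, hC⟩ := hrun X H Q ⟨hH, hQ, hHs, hQs, hst⟩
  -- The 1 makes β positive even when `C` is 0.
  refine ⟨Fintype.card (V ⊕ D.Line ⊕ V) * C + 1, by positivity, fun K => ?_, fun i => ?_⟩
  · refine Finset.sup'_le _ _ fun k _ => ?_
    have h1 := SCED.norm_error_le (hC k).1 (hC k).2.1 (hC k).2.2
    have hak : 0 < a ^ k := pow_pos ha0 k
    rw [inv_mul_le_iff₀ hak]
    linarith
  · have hO : (fun k => D.localState i (X k) - D.localTarget i ustar)
        =O[atTop] (fun k : ℕ => a ^ k) := by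
      refine IsBigO.of_bound (Fintype.card (Unit ⊕ {e : D.Line // D.up e = i} ⊕
        {e : D.Line // D.down e = i} ⊕ Unit) * C) (Eventually.of_forall fun k => ?_)
      rw [Real.norm_of_nonneg (pow_pos ha0 k).le]
      exact (SCED.norm_localState_sub_le i (hC k).1 (hC k).2.1 (hC k).2.2).trans_eq
        (mul_assoc _ _ _).symm
    exact ⟨tendsto_sub_nhds_zero_iff.1
      (hO.trans_tendsto (tendsto_pow_atTop_nhds_zero_of_lt_one ha0.le ha1)), hO⟩
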